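/- Let $n\in\{2,3\}$. Let $\mathrm M(\mathbb R^n)$ be the space of finite $\mathbb C^n$-valued Radon measures on $\mathbb R^n$ with the total variation norm $\|\mu\|_{\mathrm M}=|\mu|(\mathbb R^n)$, let $\hat\mu(\xi)=(2\pi)^{-n/2}\int_{\mathbb R^n}e^{-ix\cdot\xi}\,d\mu(x)$, and put $$\mathrm{FM}=\{\hat\mu:\mu\in \mathrm M(\mathbb R^n)\},\qquad \|\hat\mu\|_{\mathrm{FM}}=\|\mu\|_{\mathrm M},\qquad \mathrm{FM}_0=\{\hat\mu:\mu\in \mathrm M(\mathbb R^n),\ \mu(\{0\})=0\},$$ $$\mathrm{FM}_{0,\sigma}=\{u\in\mathrm{FM}_0:\operatorname{div}u=0\}$$ (divergence in the sense of distributions), and let $\mathrm{FM}^4$ be the space of all $u\in\mathrm{FM}$ whose partial derivatives of order at most $4$ belong to $\mathrm{FM}$, normed by the sum of the $\mathrm{FM}$-norms of these derivatives. Let $\lambda_0,\Gamma_0\in\mathbb R$, $\Gamma_2>0$, $V\in\mathbb R^n$, let $M\in\mathbb R^{n\times n}$ be symmetric, and let $T\in(0,\infty)$. Then there is a constant $C=C(T)>0$,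 depending only on $T$ and on $n,\lambda_0,\Gamma_0,\Gamma_2,V,M$, such that for every $f\in L^1((0,T),\mathrm{FM}_{0,\sigma})$ and every $u_0\in\mathrm{FM}_{0,\sigma}$ the system $$u_t+\lambda_0(V\cdot\nabla)u+Mu-\Gamma_0\Delta u+\Gamma_2\Delta^2u+\nabla q=f,\qquad \operatorname{div}u=0\quad\text{in }(0,T)\times\mathbb R^n,\qquad u(0)=u_0\quad\text{in }\mathbb R^n,$$ has a solution $(u,q)$ with $$u\in W^{1,1}((0,T),\mathrm{FM}_{0,\sigma})\cap L^1((0,T),\mathrm{FM}^4),\qquad \nabla q\in L^1((0,T),\mathrm{FM}_0),$$ where $u(0)$ is the value at $0$ of the continuous representative of $u$. In this class $u$ is unique, and $q$ is unique up to adding, for almost every $t$, a constant in $x$. The solution satisfies $$\|u\|_{W^{1,1}((0,T),\mathrm{FM})}+\|u\|_{L^1((0,T),\mathrm{FM}^4)}+\|\nabla q\|_{L^1((0,T),\mathrm{FM})}\le C(T)\left(\|f\|_{L^1((0,T),\mathrm{FM})}+\|u_0\|_{\mathrm{FM}}\right).$$ -/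

import Mathlib

open MeasureTheory Set Filter Topology
open scoped ENNReal NNReal

noncomputable section

namespace ActiveFluid

/-- `ℝⁿ` with its Euclidean norm. -/
abbrev RSpace (n : ℕ) : Type := EuclideanSpace ℝ (Fin n)
/-- `ℂᵐ` with its Euclidean norm. -/
abbrev CSpace (m : ℕ) : Type := EuclideanSpace ℂ (Fin m)

/-! ### Finite vector-valued Radon measures -/

/-- The `ℂᵐ`-valued Borel measures on `ℝⁿ` of finite total variation. (A finite Borel measure on
`ℝⁿ`, such as the variation, is automatically regular.) -/
def radonSubmodule (n m : ℕ) : Submodule ℂ (VectorMeasure (RSpace n) (CSpace m)) where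
  carrier := {μ | μ.variation univ < ∞}
  zero_mem' := by simp
  add_mem' {μ ν} hμ hν := by
    refine lt_of_le_of_lt (VectorMeasure.variation_add_le (μ := μ) (ν := ν) univ) ?_
    simpa using ⟨hμ, hν⟩
  smul_mem' c μ hμ := by
    simp only [mem_ofPred_eq, VectorMeasure.variation_smul] at hμ ⊢
    simpa using ENNReal.mul_lt_top ENNReal.coe_lt_top hμ

/-- The space `M(ℝⁿ, ℂᵐ)`; its norm, defined below, is the total variation of `ℝⁿ`. -/
def RadonMeasure (n m : ℕ) : Type := ↥(radonSubmodule n m)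

namespace RadonMeasure

variable {n m : ℕ}

instance : AddCommGroup (RadonMeasure n m) := inferInstanceAs (AddCommGroup ↥(radonSubmodule n m))
instance : Module ℂ (RadonMeasure n m) := inferInstanceAs (Module ℂ ↥(radonSubmodule n m))

/-- The underlying vector measure. -/
def toVectorMeasure : RadonMeasure n m →ₗ[ℂ] VectorMeasure (RSpace n) (CSpace m) :=
  (radonSubmodule n m).subtype

lemma toVectorMeasure_injective :
    Function.Injective (toVectorMeasure : RadonMeasure n m → _) := Subtype.val_injective

instance isFiniteMeasure_variation (μ : RadonMeasure n m) :
    IsFiniteMeasure μ.toVectorMeasure.variation := ⟨μ.2⟩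

/-- The total variation norm `‖μ‖ = |μ|(ℝⁿ)`. -/
instance : NormedAddCommGroup (RadonMeasure n m) :=
  AddGroupNorm.toNormedAddCommGroup
    { toFun := fun μ => μ.toVectorMeasure.variation.real univ
      map_zero' := by simp
      neg' := fun μ => by simp
      add_le' := fun μ ν => by
        have h := VectorMeasure.variation_add_le (μ := μ.toVectorMeasure)
          (ν := ν.toVectorMeasure) univ
        rw [map_add]
        simp only [Measure.real]
        rw [← ENNReal.toReal_add (measure_ne_top _ _) (measure_ne_top _ _)]
        refine ENNReal.toReal_mono ?_ (by simpa using h)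
        simp
      eq_zero_of_map_eq_zero' := fun μ h => by
        apply toVectorMeasure_injective
        rw [map_zero, ← VectorMeasure.variation_eq_zero, ← Measure.measure_univ_eq_zero]
        rwa [measureReal_eq_zero_iff] at h }

lemma norm_def (μ : RadonMeasure n m) : ‖μ‖ = μ.toVectorMeasure.variation.real univ := rfl

lemma enorm_def (μ : RadonMeasure n m) : ‖μ‖ₑ = μ.toVectorMeasure.variation univ := by
  rw [← ofReal_norm, norm_def, ofReal_measureReal]

instance : NormedSpace ℂ (RadonMeasure n m) where
  norm_smul_le c μ := by
    rw [norm_def, norm_def, map_smul, VectorMeasure.variation_smul]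
    simp [Measure.real]

instance : CompleteSpace (RadonMeasure n m) := by
  refine NormedAddCommGroup.completeSpace_of_summable_imp_tendsto fun μ hμ => ?_
  have hfin : ∑' i, (μ i).toVectorMeasure.variation univ ≠ ∞ := by
    have := hμ.tsum_ofReal_ne_top
    simpa only [ofReal_norm, enorm_def] using this
  have hle : ∀ i s, ‖(μ i).toVectorMeasure s‖ ≤ ‖μ i‖ := fun i s => by
    rw [norm_def]
    exact (VectorMeasure.norm_measure_le_variation).trans (measureReal_mono (subset_univ _))
  have hs : ∀ s, Summable fun i => (μ i).toVectorMeasure s := fun s =>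
    Summable.of_norm_bounded hμ (fun i => hle i s)
  let ν : VectorMeasure (RSpace n) (CSpace m) :=
    { measureOf' := fun s => ∑' i, (μ i).toVectorMeasure s
      empty' := by simp
      not_measurable' := fun s h => by simp [VectorMeasure.not_measurable _ h]
      m_iUnion' := fun A hA hd => by
        have hsum : Summable fun p : ℕ × ℕ => (μ p.1).toVectorMeasure (A p.2) := by
          have hne : (∑' p : ℕ × ℕ, (μ p.1).toVectorMeasure.variation (A p.2)) ≠ ∞ := by
            rw [ENNReal.tsum_prod (f := fun i j => (μ i).toVectorMeasure.variation (A j))]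
            refine ne_top_of_le_ne_top hfin (ENNReal.tsum_le_tsum fun i => ?_)
            rw [← measure_iUnion hd hA]
            exact measure_mono (subset_univ _)
          refine Summable.of_norm_bounded (ENNReal.summable_toReal hne) fun p => ?_
          exact VectorMeasure.norm_measure_le_variation
        have h1 : HasSum (fun p : ℕ × ℕ => (μ p.1).toVectorMeasure (A p.2))
            (∑' i, (μ i).toVectorMeasure (⋃ j, A j)) := by
          have h2 := hsum.hasSum
          have h3 := h2.prod_fiberwise (fun i =>
            ((μ i).toVectorMeasure.m_iUnion hA hd))
          rw [h3.tsum_eq]; exact h2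
        have h4 : HasSum (fun p : ℕ × ℕ => (μ p.2).toVectorMeasure (A p.1))
            (∑' i, (μ i).toVectorMeasure (⋃ j, A j)) :=
          (Equiv.prodComm ℕ ℕ).hasSum_iff.2 h1
        exact h4.prod_fiberwise (fun j => (hs (A j)).hasSum) }
  have hν : ∀ s, ν s = ∑' i, (μ i).toVectorMeasure s := fun s => rfl
  have hsub : ∀ N, (ν - ∑ i ∈ Finset.range N, (μ i).toVectorMeasure).variation univ ≤
      ∑' i, (μ (i + N)).toVectorMeasure.variation univ := fun N => by
    have : (ν - ∑ i ∈ Finset.range N, (μ i).toVectorMeasure).variation ≤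
        Measure.sum fun i => (μ (i + N)).toVectorMeasure.variation := by
      refine VectorMeasure.variation_le_of_forall_enorm_le fun s hsm => ?_
      have e : (ν - ∑ i ∈ Finset.range N, (μ i).toVectorMeasure) s =
          ∑' i, (μ (i + N)).toVectorMeasure s := by
        have hc : (∑ i ∈ Finset.range N, (μ i).toVectorMeasure) s =
            ∑ i ∈ Finset.range N, (μ i).toVectorMeasure s := by
            simp
        rw [sub_apply, hc, hν, ← (hs s).sum_add_tsum_nat_add N, add_sub_cancel_left]
      rw [e, Measure.sum_apply _ hsm]
      refine enorm_tsum_le_tsum_enorm.trans (ENNReal.tsum_le_tsum fun i => ?_)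
      exact VectorMeasure.enorm_measure_le_variation _ _
    refine (this univ).trans_eq ?_
    rw [Measure.sum_apply _ MeasurableSet.univ]
  have hνmem : ν ∈ radonSubmodule n m := by
    have := hsub 0
    simp only [Finset.range_zero, Finset.sum_empty, sub_zero, add_zero] at this
    exact this.trans_lt hfin.lt_top
  obtain ⟨a, ha⟩ : ∃ a : RadonMeasure n m, a.toVectorMeasure = ν := ⟨⟨ν, hνmem⟩, rfl⟩
  refine ⟨a, ?_⟩
  rw [tendsto_iff_edist_tendsto_0]
  refine tendsto_of_tendsto_of_tendsto_of_le_of_le tendsto_const_nhds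
    (ENNReal.tendsto_sum_nat_add _ hfin) (fun _ => zero_le) fun N => ?_
  rw [edist_comm, edist_eq_enorm_sub, enorm_def, map_sub, map_sum, ha]
  exact hsub N


section Fourier

open ContinuousLinearMap

variable {X F F' E G : Type*} [MeasurableSpace X]
  [NormedAddCommGroup E] [NormedSpace ℝ E] [NormedAddCommGroup F] [NormedSpace ℝ F]
  [NormedAddCommGroup F'] [NormedSpace ℝ F'] [NormedAddCommGroup G] [NormedSpace ℝ G]

lemma variation_mapRange_le (μ : VectorMeasure X F) (C : F →L[ℝ] F') :
    (μ.mapRange C.toAddMonoidHom C.continuous).variation ≤ (‖C‖₊ : ℝ≥0∞) • μ.variation := by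
  refine VectorMeasure.variation_le_of_forall_enorm_le fun s _ => ?_
  have h := C.le_opENorm (μ s)
  refine h.trans ?_
  simp only [Measure.smul_apply, smul_eq_mul, enorm_eq_nnnorm]
  gcongr
  exact VectorMeasure.enorm_measure_le_variation _ _

lemma integral_mapRange (μ : VectorMeasure X F) (C : F →L[ℝ] F') (B : E →L[ℝ] F' →L[ℝ] G)
    {f : X → E} (hf : Integrable f μ.variation) :
    (μ.mapRange C.toAddMonoidHom C.continuous).integral f B =
      μ.integral f ((compL ℝ F F' G).flip C ∘L B) := by
  have hT : (μ.mapRange C.toAddMonoidHom C.continuous).transpose B =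
      μ.transpose ((compL ℝ F F' G).flip C ∘L B) := by
    ext s hs x
    rfl
  rw [VectorMeasure.integral_eq_setToFun, VectorMeasure.integral_eq_setToFun]
  symm
  have h2 := dominatedFinMeasAdditive_cbmApplyMeasure
    (μ.mapRange C.toAddMonoidHom C.continuous) B
  rw! [hT]
  exact setToFun_congr_measure_of_integrable _ (by simp) (variation_mapRange_le μ C) _ _ _ hf


/-- A signed measure all of whose cosine and sine integrals vanish is zero. -/
lemma signed_eq_zero {n : ℕ} (ν : SignedMeasure (RSpace n))
    (hc : ∀ ξ, ν.integral (fun x => Real.cos (inner ℝ x ξ)) (lsmul ℝ ℝ) = 0)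
    (hs : ∀ ξ, ν.integral (fun x => Real.sin (inner ℝ x ξ)) (lsmul ℝ ℝ) = 0) : ν = 0 := by
  set j := ν.toJordanDecomposition with hj
  have hν : ν = j.posPart.toSignedMeasure - j.negPart.toSignedMeasure :=
    ν.toSignedMeasure_toJordanDecomposition.symm
  have hB : (lsmul ℝ ℝ : ℝ →L[ℝ] ℝ →L[ℝ] ℝ) = (lsmul ℝ ℝ).flip := by
    ext; simp
  have key : ∀ g : RSpace n → ℝ, Continuous g → (∀ x, ‖g x‖ ≤ 1) →
      ν.integral g (lsmul ℝ ℝ) = 0 → ∫ x, g x ∂j.posPart = ∫ x, g x ∂j.negPart := by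
    intro g hg hb h
    have hi : ∀ (μ : Measure (RSpace n)) [IsFiniteMeasure μ], Integrable g μ := fun μ _ =>
      Integrable.of_bound hg.aestronglyMeasurable 1 (Eventually.of_forall hb)
    rw [hν, VectorMeasure.integral_sub_vectorMeasure, hB, VectorMeasure.integral_toSignedMeasure,
      VectorMeasure.integral_toSignedMeasure, sub_eq_zero] at h
    · exact h
    · simpa [VectorMeasure.Integrable] using hi _
    · simpa [VectorMeasure.Integrable] using hi _
  have hpn : j.posPart = j.negPart := by
    refine Measure.ext_of_charFun (funext fun ξ => ?_)
    rw [charFun_apply, charFun_apply]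
    have e : ∀ x : RSpace n, Complex.exp ((inner ℝ x ξ : ℝ) * Complex.I) =
        (Real.cos (inner ℝ x ξ) : ℂ) + (Real.sin (inner ℝ x ξ) : ℂ) * Complex.I := fun x => by
      rw [Complex.exp_mul_I, Complex.ofReal_cos, Complex.ofReal_sin]
    have h : ∀ (μ : Measure (RSpace n)) [IsFiniteMeasure μ],
        ∫ x, Complex.exp ((inner ℝ x ξ : ℝ) * Complex.I) ∂μ =
        ((∫ x, Real.cos (inner ℝ x ξ) ∂μ : ℝ) : ℂ) +
          ((∫ x, Real.sin (inner ℝ x ξ) ∂μ : ℝ) : ℂ) * Complex.I := fun μ _ => by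
      simp_rw [e]
      have hci : Integrable (fun x : RSpace n => Real.cos (inner ℝ x ξ)) μ :=
        Integrable.of_bound (Continuous.aestronglyMeasurable (by fun_prop)) 1
          (Eventually.of_forall fun x => Real.abs_cos_le_one _)
      have hsi : Integrable (fun x : RSpace n => Real.sin (inner ℝ x ξ)) μ :=
        Integrable.of_bound (Continuous.aestronglyMeasurable (by fun_prop)) 1
          (Eventually.of_forall fun x => Real.abs_sin_le_one _)
      rw [integral_add hci.ofReal (hsi.ofReal.mul_const _), integral_mul_const,
        integral_complex_ofReal, integral_complex_ofReal]
    rw [h, h, key _ (by fun_prop) (fun x => Real.abs_cos_le_one _) (hc ξ),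
      key _ (by fun_prop) (fun x => Real.abs_sin_le_one _) (hs ξ)]
  rw [hν]
  simp only [hpn, sub_self]

variable {n m : ℕ}

/-- The Fourier transform of a finite vector measure,
`μ̂(ξ) = (2π)^(-n/2) ∫ exp(-i x·ξ) dμ(x)`. -/
def fourierFun (μ : RadonMeasure n m) (ξ : RSpace n) : CSpace m :=
  ((2 * Real.pi) ^ (-(n : ℝ) / 2) : ℝ) •
    μ.toVectorMeasure.integral (fun x => Complex.exp (-((inner ℝ x ξ : ℝ) : ℂ) * Complex.I))
      (lsmul ℝ ℂ)

lemma continuous_kernel (ξ : RSpace n) :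
    Continuous fun x : RSpace n => Complex.exp (-((inner ℝ x ξ : ℝ) : ℂ) * Complex.I) := by
  fun_prop

lemma integrable_kernel (ν : Measure (RSpace n)) [IsFiniteMeasure ν] (ξ : RSpace n) :
    Integrable (fun x : RSpace n => Complex.exp (-((inner ℝ x ξ : ℝ) : ℂ) * Complex.I)) ν := by
  refine Integrable.of_bound (continuous_kernel ξ).aestronglyMeasurable 1
    (Eventually.of_forall fun x => ?_)
  rw [← Complex.ofReal_neg, Complex.norm_exp_ofReal_mul_I]

/-- The Fourier transform as a linear map. -/
def fourier : RadonMeasure n m →ₗ[ℂ] (RSpace n → CSpace m) where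
  toFun := fourierFun
  map_add' μ ν := by
    funext ξ
    simp only [fourierFun, map_add, Pi.add_apply]
    rw [VectorMeasure.integral_add_vectorMeasure (integrable_kernel _ ξ) (integrable_kernel _ ξ),
      smul_add]
  map_smul' c μ := by
    funext ξ
    simp only [fourierFun, map_smul, Pi.smul_apply, RingHom.id_apply]
    rw [smul_comm c]
    congr 1
    let C : CSpace m →L[ℝ] CSpace m := (lsmul ℝ ℂ c)
    have h1 : c • μ.toVectorMeasure =
        μ.toVectorMeasure.mapRange C.toAddMonoidHom C.continuous := by
      ext s hs
      rfl
    rw [h1, integral_mapRange _ _ _ (integrable_kernel _ ξ)]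
    change _ = C _
    rw [VectorMeasure.continuousLinearMap_apply_integral (integrable_kernel _ ξ)]
    congr 1
    ext z v
    simp [C, mul_left_comm]

lemma fourier_apply (μ : RadonMeasure n m) (ξ : RSpace n) : fourier μ ξ = fourierFun μ ξ := rfl

lemma fourier_injective : Function.Injective (fourier : RadonMeasure n m →ₗ[ℂ] _) := by
  rw [← LinearMap.ker_eq_bot, LinearMap.ker_eq_bot']
  intro μ hμ
  apply toVectorMeasure_injective
  rw [map_zero]
  set M := μ.toVectorMeasure with hM
  have hint : ∀ g : RSpace n → ℝ, Continuous g → (∀ x, ‖g x‖ ≤ 1) → Integrable g M.variation :=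
    fun g hg hb => Integrable.of_bound hg.aestronglyMeasurable 1 (Eventually.of_forall hb)
  have h0 : ∀ ξ, M.integral
      (fun x => Complex.exp (-((inner ℝ x ξ : ℝ) : ℂ) * Complex.I)) (lsmul ℝ ℂ) = 0 := by
    intro ξ
    have h := congrFun hμ ξ
    rw [fourier_apply, fourierFun, Pi.zero_apply, smul_eq_zero] at h
    exact h.resolve_left (by positivity)
  have hre : ∀ g : RSpace n → ℝ, Continuous g → (∀ x, ‖g x‖ ≤ 1) →
      M.integral (fun x => (g x : ℂ)) (lsmul ℝ ℂ) = M.integral g (lsmul ℝ ℝ) := by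
    intro g hg hb
    have := VectorMeasure.integral_continuousLinearMap_comp (μ := M) (f := g)
      (C := Complex.ofRealCLM) (B := (lsmul ℝ ℂ : ℂ →L[ℝ] CSpace m →L[ℝ] CSpace m)) (hint g hg hb)
    refine this.trans ?_
    congr 1
  have hcos : ∀ ξ, Continuous fun x : RSpace n => Real.cos (inner ℝ x ξ) := fun ξ => by fun_prop
  have hsin : ∀ ξ, Continuous fun x : RSpace n => Real.sin (inner ℝ x ξ) := fun ξ => by fun_prop
  have hcb : ∀ ξ, ∀ x : RSpace n, ‖Real.cos (inner ℝ x ξ)‖ ≤ 1 := fun ξ x =>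
    Real.abs_cos_le_one _
  have hsb : ∀ ξ, ∀ x : RSpace n, ‖Real.sin (inner ℝ x ξ)‖ ≤ 1 := fun ξ x =>
    Real.abs_sin_le_one _
  have hcs : ∀ ξ, M.integral (fun x => Real.cos (inner ℝ x ξ)) (lsmul ℝ ℝ) = 0 ∧
      M.integral (fun x => Real.sin (inner ℝ x ξ)) (lsmul ℝ ℝ) = 0 := by
    intro ξ
    have hp := h0 ξ
    have hn := h0 (-ξ)
    have ic := integrable_kernel M.variation ξ
    have id := integrable_kernel M.variation (-ξ)
    constructor
    · have h2 := VectorMeasure.integral_fun_add (B := (lsmul ℝ ℂ : ℂ →L[ℝ] CSpace m →L[ℝ] CSpace m))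
        (μ := M) ic id
      rw [hp, hn, add_zero] at h2
      rw [← hre _ (hcos ξ) (hcb ξ)]
      have h3 := VectorMeasure.integral_fun_smul M
        (lsmul ℝ ℂ : ℂ →L[ℝ] CSpace m →L[ℝ] CSpace m) (2 : ℝ)
        (fun x => ((Real.cos (inner ℝ x ξ) : ℝ) : ℂ))
      have e : (fun x : RSpace n => (2 : ℝ) • ((Real.cos (inner ℝ x ξ) : ℝ) : ℂ)) =
          fun x => Complex.exp (-((inner ℝ x ξ : ℝ) : ℂ) * Complex.I) +
            Complex.exp (-((inner ℝ x (-ξ) : ℝ) : ℂ) * Complex.I) := by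
        funext x
        simp only [inner_neg_right, Complex.ofReal_neg, neg_neg, Complex.real_smul,
          Complex.ofReal_cos, Complex.cos]
        push_cast
        ring
      rw [e, h2] at h3
      exact (smul_eq_zero.1 h3.symm).resolve_left two_ne_zero
    · have h2 := VectorMeasure.integral_fun_sub (B := (lsmul ℝ ℂ : ℂ →L[ℝ] CSpace m →L[ℝ] CSpace m))
        (μ := M) id ic
      rw [hp, hn, sub_zero] at h2
      rw [← hre _ (hsin ξ) (hsb ξ)]
      let J : ℂ →L[ℝ] ℂ := (lsmul ℝ ℂ (2 * Complex.I))
      let D : CSpace m →L[ℝ] CSpace m := (lsmul ℝ ℂ (2 * Complex.I))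
      have is : Integrable (fun x => ((Real.sin (inner ℝ x ξ) : ℝ) : ℂ)) M.variation :=
        (hint _ (hsin ξ) (hsb ξ)).ofReal
      have h3 := VectorMeasure.integral_continuousLinearMap_comp (μ := M) (C := J)
        (B := (lsmul ℝ ℂ : ℂ →L[ℝ] CSpace m →L[ℝ] CSpace m)) is
      have h4 := VectorMeasure.continuousLinearMap_apply_integral (μ := M) (C := D)
        (B := (lsmul ℝ ℂ : ℂ →L[ℝ] CSpace m →L[ℝ] CSpace m)) is
      have e : (fun x : RSpace n => J ((Real.sin (inner ℝ x ξ) : ℝ) : ℂ)) =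
          fun x => Complex.exp (-((inner ℝ x (-ξ) : ℝ) : ℂ) * Complex.I) -
            Complex.exp (-((inner ℝ x ξ : ℝ) : ℂ) * Complex.I) := by
        funext x
        simp only [inner_neg_right, Complex.ofReal_neg, neg_neg, J, lsmul_apply, smul_eq_mul,
          Complex.ofReal_sin, Complex.sin]
        linear_combination (Complex.exp (-((inner ℝ x ξ : ℝ) : ℂ) * Complex.I) -
          Complex.exp (((inner ℝ x ξ : ℝ) : ℂ) * Complex.I)) * Complex.I_sq
      have hBB : (lsmul ℝ ℂ : ℂ →L[ℝ] CSpace m →L[ℝ] CSpace m) ∘L J =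
          (compL ℝ (CSpace m) (CSpace m) (CSpace m)) D ∘L (lsmul ℝ ℂ) := by
        ext z v
        simp [J, D, mul_assoc]
      rw [e, h2, hBB, ← h4] at h3
      have h5 : (2 * Complex.I) • M.integral (fun x => ((Real.sin (inner ℝ x ξ) : ℝ) : ℂ))
        (lsmul ℝ ℂ) = 0 := h3.symm
      exact (smul_eq_zero.1 h5).resolve_left (by simp)
  have hL : ∀ L : CSpace m →L[ℝ] ℝ, ∀ s, L (M s) = 0 := by
    intro L s
    have hg : ∀ g : RSpace n → ℝ, Continuous g → (∀ x, ‖g x‖ ≤ 1) →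
        M.integral g (lsmul ℝ ℝ) = 0 →
        (M.mapRange L.toAddMonoidHom L.continuous).integral g (lsmul ℝ ℝ) = 0 := by
      intro g hg hb h
      rw [integral_mapRange M L _ (hint g hg hb)]
      have := VectorMeasure.continuousLinearMap_apply_integral (μ := M) (C := L)
        (B := (lsmul ℝ ℝ : ℝ →L[ℝ] CSpace m →L[ℝ] CSpace m)) (hint g hg hb)
      rw [h, map_zero] at this
      rw [this]
      congr 1
      ext v
      simp
    have := signed_eq_zero (M.mapRange L.toAddMonoidHom L.continuous)
      (fun ξ => hg _ (hcos ξ) (hcb ξ) (hcs ξ).1) (fun ξ => hg _ (hsin ξ) (hsb ξ) (hcs ξ).2)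
    have h := congrArg (fun N : SignedMeasure (RSpace n) => N s) this
    exact h
  ext s hs i
  apply Complex.ext
  · exact hL (Complex.reCLM ∘L (EuclideanSpace.proj i).restrictScalars ℝ) s
  · exact hL (Complex.imCLM ∘L (EuclideanSpace.proj i).restrictScalars ℝ) s

end Fourier

end RadonMeasure

/-! ### Fourier transformed Radon measures -/

/-- The functions `ℝⁿ → ℂᵐ` of the form `μ̂` with `μ ∈ M(ℝⁿ, ℂᵐ)`. -/
def fmSubmodule (n m : ℕ) : Submodule ℂ (RSpace n → CSpace m) :=
  LinearMap.range (RadonMeasure.fourier : RadonMeasure n m →ₗ[ℂ] _)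

/-- The space `FM(ℝⁿ, ℂᵐ)`; its norm, defined below, is `‖μ̂‖ = ‖μ‖`. -/
def FM (n m : ℕ) : Type := ↥(fmSubmodule n m)

namespace FM

variable {n m : ℕ}

instance : AddCommGroup (FM n m) := inferInstanceAs (AddCommGroup ↥(fmSubmodule n m))
instance : Module ℂ (FM n m) := inferInstanceAs (Module ℂ ↥(fmSubmodule n m))

instance : FunLike (FM n m) (RSpace n) (CSpace m) where
  coe u := u.1
  coe_injective := Subtype.val_injective

/-- A function that is a Fourier transformed Radon measure, as an element of `FM`. -/
def ofMem (u : RSpace n → CSpace m) (hu : u ∈ fmSubmodule n m) : FM n m := ⟨u, hu⟩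

@[simp] lemma coe_ofMem (u : RSpace n → CSpace m) (hu : u ∈ fmSubmodule n m) :
    ⇑(ofMem u hu) = u := rfl

/-- The measure whose Fourier transform is `u`. -/
def measure : FM n m ≃ₗ[ℂ] RadonMeasure n m :=
  (LinearEquiv.ofInjective _ RadonMeasure.fourier_injective).symm

lemma fourier_measure (u : FM n m) : RadonMeasure.fourier u.measure = ⇑u := by
  have h := LinearEquiv.apply_symm_apply
    (LinearEquiv.ofInjective (RadonMeasure.fourier : RadonMeasure n m →ₗ[ℂ] _)
      RadonMeasure.fourier_injective) u
  exact congrArg Subtype.val h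

/-- `‖u‖ = |μ|(ℝⁿ)` where `u = μ̂`. -/
instance : NormedAddCommGroup (FM n m) :=
  NormedAddCommGroup.induced (FM n m) (RadonMeasure n m) measure measure.injective

lemma norm_def (u : FM n m) : ‖u‖ = ‖u.measure‖ := rfl

instance : NormedSpace ℂ (FM n m) :=
  NormedSpace.induced ℂ (FM n m) (RadonMeasure n m) measure

instance : CompleteSpace (FM n m) :=
  (completeSpace_congr (e := measure.toEquiv)
    (AddMonoidHomClass.isometry_of_norm measure norm_def).isUniformEmbedding).2 inferInstance

end FM

/-- `FM₀(ℝⁿ, ℂᵐ)`: the elements of `FM` whose measure has no point mass at the origin. -/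
def FM₀ (n m : ℕ) : Submodule ℂ (FM n m) where
  carrier := {u | u.measure.toVectorMeasure {0} = 0}
  zero_mem' := by simp
  add_mem' {u v} hu hv := by
    simp only [mem_ofPred_eq, map_add] at *
    simp [hu, hv]
  smul_mem' c u hu := by
    simp only [mem_ofPred_eq, map_smul] at *
    simp [hu]

/-- The `j`-th coordinate direction of `ℝⁿ`. -/
abbrev dir {n : ℕ} (j : Fin n) : RSpace n := EuclideanSpace.single j 1

/-- The iterated partial derivative `∂_{w 1} ⋯ ∂_{w l} u`. -/
def wordDeriv {n m : ℕ} (l : ℕ) (w : Fin l → Fin n) (u : RSpace n → CSpace m) :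
    RSpace n → CSpace m :=
  fun x => iteratedFDeriv ℝ l u x fun i => dir (w i)

/-- The functions in `FM` all of whose partial derivatives of order at most `k` are in `FM`. As
elements of `FM` are continuous, distributional and classical derivatives agree here. -/
def fmkSubmodule (n m k : ℕ) : Submodule ℂ (RSpace n → CSpace m) where
  carrier := {u | u ∈ fmSubmodule n m ∧ ContDiff ℝ k u ∧
    ∀ (l : Fin (k + 1)) (w : Fin l → Fin n), wordDeriv l w u ∈ fmSubmodule n m}
  zero_mem' := by
    refine ⟨zero_mem _, contDiff_const, fun l w => ?_⟩
    have : wordDeriv l w (0 : RSpace n → CSpace m) = 0 := by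
      funext x
      simp [wordDeriv]
    rw [this]
    exact zero_mem _
  add_mem' {u v} hu hv := by
    refine ⟨add_mem hu.1 hv.1, hu.2.1.add hv.2.1, fun l w => ?_⟩
    have : wordDeriv l w (u + v) = wordDeriv l w u + wordDeriv l w v := by
      funext x
      have hl : ((l : ℕ) : WithTop ℕ∞) ≤ (k : ℕ) := by exact_mod_cast Nat.lt_succ_iff.1 l.2
      simp [wordDeriv, iteratedFDeriv_add_apply (hu.2.1.contDiffAt.of_le hl)
        (hv.2.1.contDiffAt.of_le hl)]
    rw [this]
    exact add_mem (hu.2.2 l w) (hv.2.2 l w)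
  smul_mem' c u hu := by
    refine ⟨Submodule.smul_mem _ c hu.1, hu.2.1.const_smul c, fun l w => ?_⟩
    have : wordDeriv l w (c • u) = c • wordDeriv l w u := by
      funext x
      have hl : ((l : ℕ) : WithTop ℕ∞) ≤ (k : ℕ) := by exact_mod_cast Nat.lt_succ_iff.1 l.2
      simp [wordDeriv, iteratedFDeriv_const_smul_apply (hu.2.1.contDiffAt.of_le hl)]
    rw [this]
    exact Submodule.smul_mem _ c (hu.2.2 l w)

/-- The space `FMᵏ(ℝⁿ, ℂᵐ)`; its norm, defined below, is the sum of the `FM`-norms of all partial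
derivatives of order at most `k`. -/
def FMk (n m k : ℕ) : Type := ↥(fmkSubmodule n m k)

namespace FMk

variable {n m k : ℕ}

instance : AddCommGroup (FMk n m k) := inferInstanceAs (AddCommGroup ↥(fmkSubmodule n m k))

/-- The inclusion of `FMᵏ` into `FM`. -/
def toFM (u : FMk n m k) : FM n m := FM.ofMem u.1 u.2.1

/-- The partial derivative of order `l ≤ k` in the directions listed by `w`, as an element of
`FM`. -/
def partialDeriv (l : Fin (k + 1)) (w : Fin l → Fin n) : FMk n m k →+ FM n m :=
  AddMonoidHom.mk' (fun u => FM.ofMem (wordDeriv l w u.1) (u.2.2.2 l w)) fun u v => by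
    apply DFunLike.coe_injective
    funext x
    have hl : ((l : ℕ) : WithTop ℕ∞) ≤ (k : ℕ) := by exact_mod_cast Nat.lt_succ_iff.1 l.2
    exact congrArg (fun T : ContinuousMultilinearMap ℝ (fun _ : Fin l => RSpace n) (CSpace m) =>
      T fun i => dir (w i)) (iteratedFDeriv_add_apply (u.2.2.1.contDiffAt.of_le hl)
          (v.2.2.1.contDiffAt.of_le hl))

lemma coe_partialDeriv (u : FMk n m k) (l : Fin (k + 1)) (w : Fin l → Fin n) :
    ⇑(partialDeriv l w u) = wordDeriv l w u.toFM := rfl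

lemma toFM_injective : Function.Injective (toFM : FMk n m k → FM n m) := fun _ _ h =>
  Subtype.ext (congrArg (fun g : FM n m => (g : RSpace n → CSpace m)) h)

lemma partialDeriv_zero (u : FMk n m k) (w : Fin (0 : Fin (k + 1)) → Fin n) :
    partialDeriv 0 w u = u.toFM := by
  apply DFunLike.coe_injective
  funext x
  exact iteratedFDeriv_zero_apply (𝕜 := ℝ) (f := u.1) (x := x) fun i => dir (w i)

/-- `‖u‖ = ∑ ‖∂_w u‖_FM` over all partial derivatives of order at most `k`. -/
instance : NormedAddCommGroup (FMk n m k) :=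
  AddGroupNorm.toNormedAddCommGroup
    { toFun := fun u => ∑ l : Fin (k + 1), ∑ w : Fin l → Fin n, ‖partialDeriv l w u‖
      map_zero' := by simp
      neg' := fun u => by simp
      add_le' := fun u v => by
        simp only [map_add, ← Finset.sum_add_distrib]
        gcongr
        exact norm_add_le _ _
      eq_zero_of_map_eq_zero' := fun u h => by
        have h0 := (Finset.sum_eq_zero_iff_of_nonneg
          (fun l _ => Finset.sum_nonneg fun w _ => norm_nonneg _)).1 h 0 (Finset.mem_univ _)
        let w₀ : Fin (0 : Fin (k + 1)) → Fin n := fun i => i.elim0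
        have h1 := (Finset.sum_eq_zero_iff_of_nonneg
          (fun w _ => norm_nonneg _)).1 h0 w₀ (Finset.mem_univ _)
        rw [norm_eq_zero, partialDeriv_zero] at h1
        exact toFM_injective h1 }

lemma norm_def (u : FMk n m k) :
    ‖u‖ = ∑ l : Fin (k + 1), ∑ w : Fin l → Fin n, ‖partialDeriv l w u‖ := rfl

end FMk

/-! ### Solenoidal fields and pressures -/

/-- `div u = 0` in the sense of tempered distributions. -/
def IsDivFree {n : ℕ} (u : RSpace n → CSpace n) : Prop :=
  ∀ φ : SchwartzMap (RSpace n) ℂ, ∫ x, ∑ j, fderiv ℝ φ x (dir j) * u x j = 0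

/-- `FM_{0,σ}(ℝⁿ)`: the divergence free fields in `FM₀(ℝⁿ, ℂⁿ)`. -/
def FM₀σ (n : ℕ) : Set (FM n n) := {u | u ∈ FM₀ n n ∧ IsDivFree u}

/-- The gradient of a scalar function. -/
def spatialGrad {n : ℕ} (q : RSpace n → ℂ) : RSpace n → CSpace n :=
  fun x => WithLp.toLp 2 fun j => fderiv ℝ q x (dir j)

/-- The pressures: scalar `q` with `∇q ∈ FM₀(ℝⁿ, ℂⁿ)`. (A distribution whose gradient lies in `FM₀`,
hence is continuous, is a differentiable function.) -/
structure Pressure (n : ℕ) where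
  toFun : RSpace n → ℂ
  differentiable : Differentiable ℝ toFun
  grad_mem_fm : spatialGrad toFun ∈ fmSubmodule n n
  grad_mem_fm₀ : FM.ofMem (spatialGrad toFun) grad_mem_fm ∈ FM₀ n n

/-- The gradient of a pressure, as an element of `FM`. -/
def Pressure.grad {n : ℕ} (q : Pressure n) : FM n n :=
  FM.ofMem (spatialGrad q.toFun) q.grad_mem_fm

/-! ### The linearized system -/

/-- `u ∈ W^{1,1}((0,T), X)` with weak derivative `u'`. -/
structure HasWeakTimeDeriv {X : Type*} [NormedAddCommGroup X] [NormedSpace ℝ X] (T : ℝ)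
    (u u' : ℝ → X) : Prop where
  integrableOn : IntegrableOn u (Ioo 0 T)
  integrableOn_deriv : IntegrableOn u' (Ioo 0 T)
  integral_eq : ∀ φ : ℝ → ℝ, ContDiff ℝ ((⊤ : ℕ∞) : WithTop ℕ∞) φ → HasCompactSupport φ →
    tsupport φ ⊆ Ioo 0 T →
    ∫ t in Ioo 0 T, deriv φ t • u t = -∫ t in Ioo 0 T, φ t • u' t

/-- `u(0) = u₀` for the continuous representative of `u` on `[0,T]`. -/
def HasInitialValue {X : Type*} [TopologicalSpace X] (T : ℝ) (u : ℝ → X) (u₀ : X) : Prop :=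
  ∃ v : ℝ → X, ContinuousOn v (Icc 0 T) ∧ (∀ᵐ t ∂volume.restrict (Ioo 0 T), v t = u t) ∧ v 0 = u₀

open scoped InnerProductSpace Laplacian in
/-- `(u, q)` is a solution on `(0,T) × ℝⁿ` of
`∂ₜu + λ₀ (V·∇)u + M u - Γ₀ Δu + Γ₂ Δ²u + ∇q = f`, `div u = 0`, `u(0) = u₀`, in the class
`u ∈ W^{1,1}((0,T), FM_{0,σ}) ∩ L¹((0,T), FM⁴)`, `∇q ∈ L¹((0,T), FM₀)`; `u'` is the weak time
derivative of `u`. -/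
structure IsSolution {n : ℕ} (lam₀ Γ₀ Γ₂ : ℝ) (V : RSpace n) (M : Matrix (Fin n) (Fin n) ℝ)
    (T : ℝ) (f : ℝ → FM n n) (u₀ : FM n n)
    (u : ℝ → FMk n n 4) (u' : ℝ → FM n n) (q : ℝ → Pressure n) : Prop where
  weakDeriv : HasWeakTimeDeriv T (fun t => (u t).toFM) u'
  solenoidal : ∀ᵐ t ∂volume.restrict (Ioo 0 T), (u t).toFM ∈ FM₀σ n ∧ u' t ∈ FM₀σ n
  integrableOn_FM4 : IntegrableOn u (Ioo 0 T)
  integrableOn_grad : IntegrableOn (fun t => (q t).grad) (Ioo 0 T)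
  equation : ∀ᵐ t ∂volume.restrict (Ioo 0 T), ∀ x : RSpace n,
    u' t x + lam₀ • fderiv ℝ (u t).toFM x V
      + Matrix.toEuclideanLin (M.map Complex.ofReal) ((u t).toFM x)
      - Γ₀ • Δ (⇑(u t).toFM) x + Γ₂ • Δ (Δ (⇑(u t).toFM)) x
      + (q t).grad x = f t x
  initial : HasInitialValue T (fun t => (u t).toFM) u₀

end ActiveFluid

end

/-!
# Maximal `L¹`-regularity of the linearized active fluid system in spaces of transformed measures

Multiplication of a measure by a bounded matrix valued function `a(x)` is bounded for the total
variation norm, so every bounded measurable symbol acts on `FM` as a Fourier multiplier (`FM.mult`),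
without any smoothness of `a`. Concretely, finitely many elements of `FM` have integrable densities
with respect to one finite measure (`FM.exists_ofDensity_eq_family`), and all operators act by
pointwise multiplication of these densities.

Two changes of variables remove all unboundedness and all divergence constraints. First, `FM⁴` is the
range of the injective multiplier `(1 + Δ²)⁻¹` (`surjective_smoothingLift`), so `u` is replaced by
`w = u + Δ²u` in `FM`. Secondly, the solenoidal fields without mass at the origin are the range of the
Helmholtz projection, the multiplier with the symbol `P(x) = 1 - x xᵀ/|x|²` for `x ≠ 0` and `P(0) = 0`
(`mem_FM₀σ_iff`). It annihilates the gradients of pressures, as these are curl free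
(`Pressure.helmholtz_grad`), and conversely the multiplier `x xᵀ/|x|²` produces gradients of pressures
(`exists_pressure`). Hence the system splits into the evolution equation `u' + (σ + P M P)u = f` for
solenoidal `u`, where `σ(x) = -iλ₀ x·V + Γ₀|x|² + Γ₂|x|⁴`, and a formula for the pressure
(`spatialOperator_eq_add`, `helmholtz_spatialOperator`).

The evolution equation is solved by Duhamel's formula with the semigroup of symbol
`exp(-τ(σ + P M P))P`. Completing the square in `Re σ` bounds this symbol by `C exp(-cτ|x|⁴)` on
`(0,T)`. The estimate behind maximal regularity is the elementary
`∫₀ᵀ (1 + |x|⁴) exp(-cτ|x|⁴) dτ ≤ T + 1/c`, uniformly in `x`: by Tonelli's theorem it yields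
`∫₀ᵀ ‖(1 + Δ²) S(τ) g‖ dτ ≤ K ‖g‖` for every `g` in `FM` (`FM.lintegral_enorm_mult_le`), and this is
exactly what makes the convolution of `(1 + Δ²) S` with an `L¹` function an `L¹` function
(`exists_duhamel`, `IsParabolic.exists_solution`).

For uniqueness, functions of class `W^{1,1}` are primitives of their derivatives
(`HasWeakTimeDeriv.ae_eq`), so the difference of two solutions satisfies the homogeneous evolution
equation in integrated form. Restricted to the frequencies in a ball the generator is bounded, and the
equation becomes a Volterra equation with only the trivial solution (`IsParabolic.ae_eq_zero`).
-/

noncomputable section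

namespace ActiveFluid

namespace FM

variable {n m : ℕ}

/-! ### Elements of `FM` given by densities -/

/-- The Radon-Nikodym theorem for `ℂᵐ`-valued measures, from the one for signed measures applied to
the real and imaginary parts of the coordinates. -/
lemma exists_withDensityᵥ_eq {X : Type*} [MeasurableSpace X] (μ : VectorMeasure X (CSpace m))
    (ν : Measure X) [IsFiniteMeasure ν] (hν : μ.variation ≪ ν) :
    ∃ h : X → CSpace m, Integrable h ν ∧ ν.withDensityᵥ h = μ := by
  let s : (CSpace m →L[ℝ] ℝ) → SignedMeasure X := fun L =>
    μ.mapRange L.toAddMonoidHom L.continuous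
  have hs : ∀ L, ν.withDensityᵥ ((s L).rnDeriv ν) = s L := fun L => by
    refine SignedMeasure.withDensityᵥ_rnDeriv_eq _ _ (VectorMeasure.AbsolutelyContinuous.mk ?_)
    intro t ht h0
    rw [Measure.toENNRealVectorMeasure_apply_measurable ht] at h0
    have h1 : μ t = 0 := by
      have := VectorMeasure.enorm_measure_le_variation μ t
      rw [hν h0] at this
      simpa using this
    change L (μ t) = 0
    rw [h1, map_zero]
  have hi : ∀ L, Integrable ((s L).rnDeriv ν) ν := fun L => SignedMeasure.integrable_rnDeriv _ _
  have hsa : ∀ L t, MeasurableSet t → ∫ x in t, (s L).rnDeriv ν x ∂ν = L (μ t) := fun L t ht => by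
    rw [← withDensityᵥ_apply (hi L) ht, hs]
    rfl
  let re : Fin m → (CSpace m →L[ℝ] ℝ) := fun i =>
    Complex.reCLM ∘L (EuclideanSpace.proj i : CSpace m →L[ℂ] ℂ).restrictScalars ℝ
  let im : Fin m → (CSpace m →L[ℝ] ℝ) := fun i =>
    Complex.imCLM ∘L (EuclideanSpace.proj i : CSpace m →L[ℂ] ℂ).restrictScalars ℝ
  let h : X → CSpace m := fun x => ∑ i, ((s (re i)).rnDeriv ν x • EuclideanSpace.single i (1 : ℂ)
    + (s (im i)).rnDeriv ν x • EuclideanSpace.single i Complex.I)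
  have hh : Integrable h ν := integrable_finsetSum _ fun i _ =>
    ((hi _).smul_const _).add ((hi _).smul_const _)
  refine ⟨h, hh, ?_⟩
  ext t ht j
  rw [withDensityᵥ_apply hh ht]
  have e : ∫ x in t, h x ∂ν = ∑ i, (re i (μ t) • EuclideanSpace.single i (1 : ℂ)
      + im i (μ t) • EuclideanSpace.single i Complex.I) := by
    have hsum : ∀ i ∈ (Finset.univ : Finset (Fin m)), Integrable (fun x =>
        (s (re i)).rnDeriv ν x • EuclideanSpace.single i (1 : ℂ)
          + (s (im i)).rnDeriv ν x • EuclideanSpace.single i Complex.I) (ν.restrict t) :=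
      fun i _ => (((hi (re i)).smul_const (EuclideanSpace.single i (1 : ℂ))).add
        ((hi (im i)).smul_const (EuclideanSpace.single i Complex.I))).integrableOn
    rw [integral_finsetSum _ hsum]
    refine Finset.sum_congr rfl fun i _ => ?_
    rw [integral_add ((hi _).smul_const _).integrableOn ((hi _).smul_const _).integrableOn,
      integral_smul_const, integral_smul_const, hsa _ _ ht, hsa _ _ ht]
  rw [e]
  simp [re, im, Pi.single_apply, Finset.sum_add_distrib]

/-- The Radon measure `h dν`; it is `0` if `h` is not integrable. -/
def _root_.ActiveFluid.RadonMeasure.ofDensity (ν : Measure (RSpace n)) (h : RSpace n → CSpace m) :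
    RadonMeasure n m :=
  (⟨ν.withDensityᵥ h, by
    by_cases hh : Integrable h ν
    · change (ν.withDensityᵥ h).variation univ < ∞
      rw [Measure.variation_withDensityᵥ hh]
      simpa using! hh.2
    · change (ν.withDensityᵥ h).variation univ < ∞
      simp [Measure.withDensityᵥ, hh]⟩ : ↥(radonSubmodule n m))

/-- The element of `FM` whose measure is `h dν`, for `h` integrable with respect to `ν`; it is `0`
if `h` is not integrable. -/
def ofDensity (ν : Measure (RSpace n)) (h : RSpace n → CSpace m) : FM n m :=
  measure.symm (RadonMeasure.ofDensity ν h)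

lemma measure_ofDensity (ν : Measure (RSpace n)) (h : RSpace n → CSpace m) :
    (ofDensity ν h).measure.toVectorMeasure = ν.withDensityᵥ h := by
  rw [ofDensity, LinearEquiv.apply_symm_apply]
  rfl

lemma ext_measure {u v : FM n m}
    (h : u.measure.toVectorMeasure = v.measure.toVectorMeasure) : u = v :=
  measure.injective (RadonMeasure.toVectorMeasure_injective h)

variable {ν : Measure (RSpace n)} {g h : RSpace n → CSpace m}

lemma norm_ofDensity (hh : Integrable h ν) : ‖ofDensity ν h‖ = ∫ x, ‖h x‖ ∂ν := by
  rw [norm_def, RadonMeasure.norm_def, measure_ofDensity, Measure.variation_withDensityᵥ hh,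
    integral_norm_eq_lintegral_enorm hh.1, Measure.real]
  simp

lemma ofDensity_add (hg : Integrable g ν) (hh : Integrable h ν) :
    ofDensity ν (fun x => g x + h x) = ofDensity ν g + ofDensity ν h := by
  apply ext_measure
  rw [map_add, map_add, measure_ofDensity, measure_ofDensity, measure_ofDensity]
  exact withDensityᵥ_add hg hh

lemma ofDensity_smul (c : ℂ) : ofDensity ν (fun x => c • h x) = c • ofDensity ν h := by
  apply ext_measure
  rw [map_smul, map_smul, measure_ofDensity, measure_ofDensity]
  exact withDensityᵥ_smul h c

lemma ofDensity_zero : ofDensity ν (fun _ => (0 : CSpace m)) = 0 := by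
  apply ext_measure
  rw [map_zero, map_zero, measure_ofDensity]
  exact withDensityᵥ_zero

lemma ofDensity_sub (hg : Integrable g ν) (hh : Integrable h ν) :
    ofDensity ν (fun x => g x - h x) = ofDensity ν g - ofDensity ν h := by
  apply ext_measure
  rw [map_sub, map_sub, measure_ofDensity, measure_ofDensity, measure_ofDensity]
  exact withDensityᵥ_sub hg hh

lemma ofDensity_congr (hgh : g =ᵐ[ν] h) : ofDensity ν g = ofDensity ν h := by
  apply ext_measure
  rw [measure_ofDensity, measure_ofDensity]
  exact WithDensityᵥEq.congr_ae hgh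

lemma ofDensity_inj (hg : Integrable g ν) (hh : Integrable h ν)
    (e : ofDensity ν g = ofDensity ν h) : g =ᵐ[ν] h := by
  refine hg.ae_eq_of_withDensityᵥ_eq hh ?_
  rw [← measure_ofDensity, ← measure_ofDensity, e]

lemma exists_ofDensity_eq_of_ac (u : FM n m) (ν : Measure (RSpace n)) [IsFiniteMeasure ν]
    (hν : u.measure.toVectorMeasure.variation ≪ ν) :
    ∃ h : RSpace n → CSpace m, Integrable h ν ∧ ofDensity ν h = u := by
  obtain ⟨h, hh, e⟩ := exists_withDensityᵥ_eq u.measure.toVectorMeasure ν hν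
  exact ⟨h, hh, ext_measure (by rw [measure_ofDensity, e])⟩

/-- Finitely many elements of `FM` have densities with respect to one finite measure. -/
lemma exists_ofDensity_eq_family {ι : Type*} [Finite ι] (u : ι → FM n m) :
    ∃ (ν : Measure (RSpace n)) (h : ι → RSpace n → CSpace m), IsFiniteMeasure ν ∧
      ∀ i, Integrable (h i) ν ∧ ofDensity ν (h i) = u i := by
  classical
  have := Fintype.ofFinite ι
  let ν : Measure (RSpace n) := ∑ i, (u i).measure.toVectorMeasure.variation
  have hν : IsFiniteMeasure ν := inferInstance
  have hac : ∀ i, (u i).measure.toVectorMeasure.variation ≪ ν := fun i =>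
    Measure.absolutelyContinuous_of_le (by
      simpa [ν] using Finset.single_le_sum (f := fun i => (u i).measure.toVectorMeasure.variation)
        (fun i _ => Measure.zero_le _) (Finset.mem_univ i))
  choose h hh using fun i => exists_ofDensity_eq_of_ac (u i) ν (hac i)
  exact ⟨ν, h, hν, hh⟩

/-- The representation that reduces statements about `FM` to statements about integrable
functions. -/
lemma exists_ofDensity_eq (u : FM n m) :
    ∃ (ν : Measure (RSpace n)) (h : RSpace n → CSpace m), IsFiniteMeasure ν ∧
      Integrable h ν ∧ ofDensity ν h = u := by
  obtain ⟨ν, h, hν, hh⟩ := exists_ofDensity_eq_family (fun _ : Unit => u)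
  exact ⟨ν, h (), hν, hh ()⟩

lemma exists_ofDensity_eq₂ (u v : FM n m) :
    ∃ (ν : Measure (RSpace n)) (g h : RSpace n → CSpace m), IsFiniteMeasure ν ∧
      Integrable g ν ∧ ofDensity ν g = u ∧ Integrable h ν ∧ ofDensity ν h = v := by
  obtain ⟨ν, h, hν, hh⟩ := exists_ofDensity_eq_family (fun b : Bool => if b then u else v)
  exact ⟨ν, h true, h false, hν, (hh true).1, by simpa using (hh true).2, (hh false).1,
    by simpa using (hh false).2⟩

lemma ofDensity_mem_FM₀ (hh : Integrable h ν) :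
    ofDensity ν h ∈ FM₀ n m ↔ ∀ᵐ x ∂ν, x = 0 → h x = 0 := by
  change (ofDensity ν h).measure.toVectorMeasure {0} = 0 ↔ _
  rw [measure_ofDensity, withDensityᵥ_apply hh (measurableSet_singleton _), integral_singleton]
  have e : (∀ᵐ x ∂ν, x = 0 → h x = 0) ↔ ν {0} = 0 ∨ h 0 = 0 := by
    by_cases h0 : h 0 = 0
    · simp only [h0, or_true, iff_true]
      exact Eventually.of_forall fun x hx => by rw [hx, h0]
    · simp only [h0, or_false, ae_iff]
      have : {x : RSpace n | ¬(x = 0 → h x = 0)} = {0} := by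
        ext x
        simp only [mem_ofPred_eq, mem_singleton_iff, Classical.not_imp]
        exact ⟨fun h => h.1, fun hx => ⟨hx, by rwa [hx]⟩⟩
      rw [this]
  rw [e, smul_eq_zero]
  by_cases h0 : h 0 = 0
  · simp [h0]
  · simp only [h0, or_false]
    have hfin : ν {0} ≠ ∞ := by
      have := hh.measure_norm_ge_lt_top (ε := ‖h 0‖) (norm_pos_iff.2 h0)
      refine ne_top_of_le_ne_top this.ne (measure_mono ?_)
      rintro x rfl
      simp
    rw [Measure.real, ENNReal.toReal_eq_zero_iff]
    simp [hfin]

/-! ### Fourier multipliers on `FM` -/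

lemma ofDensity_eq_rnDeriv_smul {κ τ : Measure (RSpace n)} [IsFiniteMeasure κ]
    [IsFiniteMeasure τ] (hκ : κ ≪ τ) {f : RSpace n → CSpace m} (hf : Integrable f κ) :
    Integrable (fun x => (κ.rnDeriv τ x).toReal • f x) τ ∧
      ofDensity κ f = ofDensity τ (fun x => (κ.rnDeriv τ x).toReal • f x) := by
  have := Measure.haveLebesgueDecomposition_of_sigmaFinite κ τ
  have hi : Integrable (fun x => (κ.rnDeriv τ x).toReal • f x) τ :=
    (integrable_rnDeriv_smul_iff hκ).2 hf
  refine ⟨hi, ext_measure ?_⟩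
  rw [measure_ofDensity, measure_ofDensity]
  ext1 s hs
  rw [withDensityᵥ_apply hf hs, withDensityᵥ_apply hi hs, setIntegral_rnDeriv_smul hκ hs]

/-- If `h dν = k dρ`, then `a h dν = a k dρ`: multiplication of a measure by a matrix function does
not depend on the representation of the measure by a density. -/
lemma ofDensity_clm_congr {ν ρ : Measure (RSpace n)} [IsFiniteMeasure ν] [IsFiniteMeasure ρ]
    {h k : RSpace n → CSpace m} (hh : Integrable h ν) (hk : Integrable k ρ)
    (e : ofDensity ν h = ofDensity ρ k) (a : RSpace n → CSpace m →L[ℂ] CSpace m)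
    (hah : Integrable (fun x => a x (h x)) ν) (hak : Integrable (fun x => a x (k x)) ρ) :
    ofDensity ν (fun x => a x (h x)) = ofDensity ρ (fun x => a x (k x)) := by
  let τ := ν + ρ
  have : IsFiniteMeasure τ := inferInstance
  have hν : ν ≪ τ := Measure.absolutelyContinuous_of_le (Measure.le_add_right le_rfl)
  have hρ : ρ ≪ τ := Measure.absolutelyContinuous_of_le (Measure.le_add_left le_rfl)
  obtain ⟨i1, e1⟩ := ofDensity_eq_rnDeriv_smul hν hh
  obtain ⟨i2, e2⟩ := ofDensity_eq_rnDeriv_smul hρ hk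
  obtain ⟨-, e3⟩ := ofDensity_eq_rnDeriv_smul hν hah
  obtain ⟨-, e4⟩ := ofDensity_eq_rnDeriv_smul hρ hak
  rw [e3, e4]
  rw [e1, e2] at e
  refine ofDensity_congr ?_
  filter_upwards [ofDensity_inj i1 i2 e] with x hx
  have : ∀ (c : ℝ) (v : CSpace m), c • a x v = a x (c • v) := fun c v =>
    ((a x).map_smul_of_tower c v).symm
  rw [this, this, hx]

end FM

/-- The bounded measurable matrix valued functions of the frequency, which act on `FM` as Fourier
multipliers. -/
structure IsSymbol {n m : ℕ} (a : RSpace n → CSpace m →L[ℂ] CSpace m) : Prop where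
  stronglyMeasurable : StronglyMeasurable a
  bounded : ∃ C, ∀ x, ‖a x‖ ≤ C

namespace IsSymbol

variable {n m : ℕ} {a b : RSpace n → CSpace m →L[ℂ] CSpace m}

lemma integrable (ha : IsSymbol a) {ν : Measure (RSpace n)} {h : RSpace n → CSpace m}
    (hh : Integrable h ν) : Integrable (fun x => a x (h x)) ν := by
  obtain ⟨C, hC⟩ := ha.bounded
  refine Integrable.mono' (hh.norm.const_mul C) ?_ (Eventually.of_forall fun x => ?_)
  · exact (isBoundedBilinearMap_apply (𝕜 := ℂ)).continuous.comp_aestronglyMeasurable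
      (ha.stronglyMeasurable.aestronglyMeasurable.prodMk hh.1)
  · exact (a x).le_of_opNorm_le (hC x) _

lemma add (ha : IsSymbol a) (hb : IsSymbol b) : IsSymbol fun x => a x + b x := by
  obtain ⟨C, hC⟩ := ha.bounded
  obtain ⟨D, hD⟩ := hb.bounded
  exact ⟨ha.1.add hb.1, C + D, fun x => (norm_add_le _ _).trans (add_le_add (hC x) (hD x))⟩

lemma mul (ha : IsSymbol a) (hb : IsSymbol b) : IsSymbol fun x => a x * b x := by
  obtain ⟨C, hC⟩ := ha.bounded
  obtain ⟨D, hD⟩ := hb.bounded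
  refine ⟨ha.1.mul hb.1, C * D, fun x => (norm_mul_le _ _).trans ?_⟩
  exact mul_le_mul (hC x) (hD x) (norm_nonneg _) ((norm_nonneg _).trans (hC x))

lemma sub (ha : IsSymbol a) (hb : IsSymbol b) : IsSymbol fun x => a x - b x := by
  obtain ⟨C, hC⟩ := ha.bounded
  obtain ⟨D, hD⟩ := hb.bounded
  exact ⟨ha.1.sub hb.1, C + D, fun x => (norm_sub_le _ _).trans (add_le_add (hC x) (hD x))⟩

lemma const (A : CSpace m →L[ℂ] CSpace m) : IsSymbol fun _ : RSpace n => A :=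
  ⟨stronglyMeasurable_const, ‖A‖, fun _ => le_rfl⟩

/-- A bounded measurable scalar function, as a multiple of the identity matrix. -/
lemma scalar {c : RSpace n → ℂ} (hc : Measurable c) {C : ℝ} (hC : ∀ x, ‖c x‖ ≤ C) :
    IsSymbol fun x => c x • (1 : CSpace m →L[ℂ] CSpace m) := by
  refine ⟨hc.stronglyMeasurable.smul_const _, C * ‖(1 : CSpace m →L[ℂ] CSpace m)‖, fun x => ?_⟩
  rw [norm_smul]
  exact mul_le_mul_of_nonneg_right (hC x) (norm_nonneg _)

end IsSymbol

namespace FM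

variable {n m : ℕ} {a b : RSpace n → CSpace m →L[ℂ] CSpace m}

open Classical in
/-- The Fourier multiplier with the bounded symbol `a`: it multiplies the measure of an element of
`FM` by `a`. It is defined through a chosen density; by `multFun_ofDensity` any other gives the same
result. -/
def multFun (a : RSpace n → CSpace m →L[ℂ] CSpace m) (u : FM n m) : FM n m :=
  ofDensity (exists_ofDensity_eq u).choose
    (fun x => a x ((exists_ofDensity_eq u).choose_spec.choose x))

lemma multFun_ofDensity (ha : IsSymbol a) {ν : Measure (RSpace n)} [IsFiniteMeasure ν]
    {h : RSpace n → CSpace m} (hh : Integrable h ν) :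
    multFun a (ofDensity ν h) = ofDensity ν fun x => a x (h x) := by
  obtain ⟨hf, hi, he⟩ := (exists_ofDensity_eq (ofDensity ν h)).choose_spec.choose_spec
  exact ofDensity_clm_congr hi hh he a (ha.integrable hi) (ha.integrable hh)

lemma norm_multFun_le (ha : IsSymbol a) {C : ℝ} (hC : ∀ x, ‖a x‖ ≤ C) (u : FM n m) :
    ‖multFun a u‖ ≤ C * ‖u‖ := by
  obtain ⟨ν, h, hν, hh, rfl⟩ := exists_ofDensity_eq u
  rw [multFun_ofDensity ha hh, norm_ofDensity hh, norm_ofDensity (ha.integrable hh),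
    ← integral_const_mul]
  exact integral_mono (ha.integrable hh).norm (hh.norm.const_mul C)
    fun x => (a x).le_of_opNorm_le (hC x) _

open Classical in
/-- The Fourier multiplier with symbol `a`, as a bounded operator on `FM`; it is `0` if `a` is not
a symbol. -/
def mult (a : RSpace n → CSpace m →L[ℂ] CSpace m) : FM n m →L[ℂ] FM n m :=
  if ha : IsSymbol a then
    LinearMap.mkContinuous
      { toFun := multFun a
        map_add' := fun u v => by
          obtain ⟨ν, g, h, hν, hg, rfl, hh, rfl⟩ := exists_ofDensity_eq₂ u v
          have hgh : Integrable (fun x => g x + h x) ν := hg.add hh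
          rw [← ofDensity_add hg hh, multFun_ofDensity ha hg, multFun_ofDensity ha hh,
            multFun_ofDensity ha hgh, ← ofDensity_add (ha.integrable hg) (ha.integrable hh)]
          simp only [map_add]
        map_smul' := fun c u => by
          obtain ⟨ν, h, hν, hh, rfl⟩ := exists_ofDensity_eq u
          have hch : Integrable (fun x => c • h x) ν := hh.smul c
          rw [← ofDensity_smul, multFun_ofDensity ha hh, multFun_ofDensity ha hch,
            RingHom.id_apply, ← ofDensity_smul]
          simp only [map_smul] }
      ha.bounded.choose (norm_multFun_le ha ha.bounded.choose_spec)
  else 0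

lemma mult_ofDensity (ha : IsSymbol a) {ν : Measure (RSpace n)} [IsFiniteMeasure ν]
    {h : RSpace n → CSpace m} (hh : Integrable h ν) :
    mult a (ofDensity ν h) = ofDensity ν fun x => a x (h x) := by
  rw [mult, dif_pos ha]
  exact multFun_ofDensity ha hh

lemma mult_mult (ha : IsSymbol a) (hb : IsSymbol b) (u : FM n m) :
    mult a (mult b u) = mult (fun x => a x * b x) u := by
  obtain ⟨ν, h, hν, hh, rfl⟩ := exists_ofDensity_eq u
  rw [mult_ofDensity hb hh, mult_ofDensity ha (hb.integrable hh), mult_ofDensity (ha.mul hb) hh]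
  rfl

lemma mult_add (ha : IsSymbol a) (hb : IsSymbol b) (u : FM n m) :
    mult (fun x => a x + b x) u = mult a u + mult b u := by
  obtain ⟨ν, h, hν, hh, rfl⟩ := exists_ofDensity_eq u
  rw [mult_ofDensity hb hh, mult_ofDensity ha hh, mult_ofDensity (ha.add hb) hh,
    ← ofDensity_add (ha.integrable hh) (hb.integrable hh)]
  rfl

lemma mult_sub (ha : IsSymbol a) (hb : IsSymbol b) (u : FM n m) :
    mult (fun x => a x - b x) u = mult a u - mult b u := by
  obtain ⟨ν, h, hν, hh, rfl⟩ := exists_ofDensity_eq u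
  rw [mult_ofDensity hb hh, mult_ofDensity ha hh, mult_ofDensity (ha.sub hb) hh,
    ← ofDensity_sub (ha.integrable hh) (hb.integrable hh)]
  rfl

/-- An element of `FM` is determined by its products with the indicators of the balls. -/
lemma eq_zero_of_forall_mult_indicator {u : FM n m}
    (h0 : ∀ R : ℕ, mult (fun x : RSpace n => (if ‖x‖ ≤ R then (1 : ℂ) else 0) • 1) u = 0) :
    u = 0 := by
  obtain ⟨ν, h, hν, hh, rfl⟩ := exists_ofDensity_eq u
  have hs : ∀ R : ℕ, IsSymbol (fun x : RSpace n => (if ‖x‖ ≤ R then (1 : ℂ) else 0) •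
      (1 : CSpace m →L[ℂ] CSpace m)) := fun R =>
    IsSymbol.scalar (C := 1) (Measurable.ite (measurableSet_le measurable_norm measurable_const)
      measurable_const measurable_const) fun x => by split_ifs <;> simp
  have h1 : ∀ᵐ x ∂ν, ∀ R : ℕ, ((if ‖x‖ ≤ R then (1 : ℂ) else 0) •
      (1 : CSpace m →L[ℂ] CSpace m)) (h x) = 0 := by
    refine ae_all_iff.2 fun R => ?_
    have := h0 R
    rw [mult_ofDensity (hs R) hh, ← ofDensity_zero (ν := ν)] at this
    exact ofDensity_inj ((hs R).integrable hh) (integrable_zero _ _ _) this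
  rw [← ofDensity_zero (ν := ν)]
  refine ofDensity_congr ?_
  filter_upwards [h1] with x hx
  obtain ⟨R, hR⟩ := exists_nat_ge ‖x‖
  simpa [hR] using hx R

end FM

/-! ### The Fourier transform of a density and its derivatives -/

/-- The integral of a bounded function against the vector measure `h dν`. -/
lemma integral_withDensityᵥ {X : Type*} [MeasurableSpace X] {m : ℕ} {ν : Measure X}
    {h : X → CSpace m} (hh : Integrable h ν) {f : X → ℂ} (hf : StronglyMeasurable f) {C : ℝ}
    (hC : ∀ x, ‖f x‖ ≤ C) :
    (ν.withDensityᵥ h).integral f (ContinuousLinearMap.lsmul ℝ ℂ) = ∫ x, f x • h x ∂ν := by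
  have : IsFiniteMeasure (ν.withDensityᵥ h).variation := by
    constructor
    rw [Measure.variation_withDensityᵥ hh]
    simpa using! hh.2
  have hsm : ∀ g : X → ℂ, StronglyMeasurable g → (∀ x, ‖g x‖ ≤ max C 0) →
      Integrable (fun x => g x • h x) ν := fun g hg hgb =>
    hh.bdd_smul (max C 0) hg.aestronglyMeasurable (Eventually.of_forall hgb)
  have key : ∀ g : SimpleFunc X ℂ,
      (ν.withDensityᵥ h).integral g (ContinuousLinearMap.lsmul ℝ ℂ) = ∫ x, g x • h x ∂ν := by
    intro g
    induction g using SimpleFunc.induction with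
    | const c hs =>
      rename_i s
      have e : (⇑(SimpleFunc.piecewise s hs (SimpleFunc.const X c) (SimpleFunc.const X 0)) : X → ℂ)
          = s.indicator fun _ => c := by
        ext x
        simp [Set.indicator, Set.piecewise]
      rw [e, VectorMeasure.integral_indicator_const _ hs, withDensityᵥ_apply hh hs]
      have e2 : (fun x => s.indicator (fun _ => c) x • h x) = s.indicator fun x => c • h x := by
        ext1 x
        by_cases hx : x ∈ s <;> simp [hx]
      rw [e2, integral_indicator hs, integral_smul]
      rfl
    | add _ hf hg =>
      rename_i f g _
      have hb : ∀ g : SimpleFunc X ℂ, ∃ D, ∀ x, ‖g x‖ ≤ D := fun g => g.exists_forall_norm_le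
      have hi : ∀ g : SimpleFunc X ℂ, (ν.withDensityᵥ h).Integrable g := fun g => by
        obtain ⟨D, hD⟩ := hb g
        exact Integrable.of_bound g.stronglyMeasurable.aestronglyMeasurable D
          (Eventually.of_forall hD)
      have hi2 : ∀ g : SimpleFunc X ℂ, Integrable (fun x => g x • h x) ν := fun g => by
        obtain ⟨D, hD⟩ := hb g
        exact hh.bdd_smul D g.stronglyMeasurable.aestronglyMeasurable
          (Eventually.of_forall hD)
      rw [SimpleFunc.coe_add, VectorMeasure.integral_add (hi f) (hi g), hf, hg,
        ← integral_add (hi2 f) (hi2 g)]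
      simp only [Pi.add_apply, add_smul]
  have hC0 : ∀ x, ‖f x‖ ≤ max C 0 := fun x => (hC x).trans (le_max_left _ _)
  have l1 : Tendsto (fun k => (ν.withDensityᵥ h).integral (hf.approxBounded (max C 0) k)
      (ContinuousLinearMap.lsmul ℝ ℂ)) atTop
      (𝓝 ((ν.withDensityᵥ h).integral f (ContinuousLinearMap.lsmul ℝ ℂ))) :=
    VectorMeasure.tendsto_integral_of_dominated_convergence (fun _ => max C 0)
      (fun k => (SimpleFunc.stronglyMeasurable _).aestronglyMeasurable) (integrable_const _)
      (fun k => Eventually.of_forall fun x => hf.norm_approxBounded_le (le_max_right _ _) k x)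
      (Eventually.of_forall fun x => hf.tendsto_approxBounded_of_norm_le (hC0 x))
  have l2 : Tendsto (fun k => ∫ x, hf.approxBounded (max C 0) k x • h x ∂ν) atTop
      (𝓝 (∫ x, f x • h x ∂ν)) := by
    refine tendsto_integral_of_dominated_convergence (fun x => max C 0 * ‖h x‖)
      (fun k => AEStronglyMeasurable.fun_smul
        (SimpleFunc.stronglyMeasurable _).aestronglyMeasurable hh.1)
      (hh.norm.const_mul _) (fun k => Eventually.of_forall fun x => ?_)
      (Eventually.of_forall fun x => (hf.tendsto_approxBounded_of_norm_le (hC0 x)).smul_const _)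
    rw [norm_smul]
    exact mul_le_mul_of_nonneg_right (hf.norm_approxBounded_le (le_max_right _ _) k x)
      (norm_nonneg _)
  simp only [key] at l1
  exact tendsto_nhds_unique l1 l2

/-- The pairing `(x, ξ) ↦ x·ξ / 2π`, for which Mathlib's Fourier integral has the kernel
`exp(-i x·ξ)`. -/
def phase (n : ℕ) : RSpace n →L[ℝ] RSpace n →L[ℝ] ℝ := (2 * Real.pi)⁻¹ • innerSL ℝ

lemma phase_apply {n : ℕ} (x ξ : RSpace n) : phase n x ξ = (2 * Real.pi)⁻¹ * inner ℝ x ξ :=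
  rfl

namespace FM

variable {n m : ℕ} {ν : Measure (RSpace n)} {h : RSpace n → CSpace m}

lemma fourierChar_phase (x ξ : RSpace n) :
    (Real.fourierChar (-(phase n x ξ)) : ℂ) =
      Complex.exp (-((inner ℝ x ξ : ℝ) : ℂ) * Complex.I) := by
  rw [Real.fourierChar_apply, phase_apply]
  congr 1
  push_cast
  field_simp

lemma ofDensity_apply (hh : Integrable h ν) (ξ : RSpace n) :
    ofDensity ν h ξ = ((2 * Real.pi) ^ (-(n : ℝ) / 2) : ℝ) •
      ∫ x, Complex.exp (-((inner ℝ x ξ : ℝ) : ℂ) * Complex.I) • h x ∂ν := by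
  rw [← fourier_measure, RadonMeasure.fourier_apply, RadonMeasure.fourierFun, measure_ofDensity,
    integral_withDensityᵥ hh (RadonMeasure.continuous_kernel ξ).stronglyMeasurable (C := 1)]
  intro x
  rw [← Complex.ofReal_neg, Complex.norm_exp_ofReal_mul_I]

lemma coe_ofDensity (hh : Integrable h ν) :
    ⇑(ofDensity ν h) = ((2 * Real.pi) ^ (-(n : ℝ) / 2) : ℝ) •
      VectorFourier.fourierIntegral Real.fourierChar ν (phase n).toLinearMap₁₂ h := by
  funext ξ
  rw [ofDensity_apply hh, Pi.smul_apply, VectorFourier.fourierIntegral]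
  congr 1
  refine integral_congr_ae (Eventually.of_forall fun x => ?_)
  change _ = Real.fourierChar (-(phase n x ξ)) • h x
  rw [Circle.smul_def, fourierChar_phase]

@[fun_prop]
lemma continuous_coe (u : FM n m) : Continuous u := by
  obtain ⟨ν, h, hν, hh, rfl⟩ := exists_ofDensity_eq u
  rw [coe_ofDensity hh]
  exact (VectorFourier.fourierIntegral_continuous Real.continuous_fourierChar
    (by apply (phase n).continuous₂) hh).const_smul _

lemma norm_apply_le (u : FM n m) (ξ : RSpace n) :
    ‖u ξ‖ ≤ (2 * Real.pi) ^ (-(n : ℝ) / 2) * ‖u‖ := by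
  obtain ⟨ν, h, hν, hh, rfl⟩ := exists_ofDensity_eq u
  rw [coe_ofDensity hh, Pi.smul_apply, norm_smul, norm_ofDensity hh, Real.norm_of_nonneg
    (by positivity)]
  exact mul_le_mul_of_nonneg_left
    (VectorFourier.norm_fourierIntegral_le_integral_norm _ _ _ _ _) (by positivity)

lemma contDiff_ofDensity {N : ℕ}
    (hN : ∀ k ≤ N, Integrable (fun x => ‖x‖ ^ k * ‖h x‖) ν) (hh : Integrable h ν) :
    ContDiff ℝ N (ofDensity ν h) := by
  rw [coe_ofDensity hh]
  have hc : ContDiff ℝ (N : ℕ∞)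
      (VectorFourier.fourierIntegral Real.fourierChar ν (phase n).toLinearMap₁₂ h) :=
    VectorFourier.contDiff_fourierIntegral (phase n) fun k hk => hN k (by exact_mod_cast hk)
  exact hc.const_smul ((2 * Real.pi) ^ (-(n : ℝ) / 2) : ℝ)

/-- The symbol `∏ᵢ (-i x·vᵢ)` of the iterated derivative in the directions `vᵢ`. -/
def derivSymbol {l : ℕ} (v : Fin l → RSpace n) (x : RSpace n) : ℂ :=
  (-Complex.I) ^ l * ∏ i, ((inner ℝ x (v i) : ℝ) : ℂ)

lemma continuous_derivSymbol {l : ℕ} (v : Fin l → RSpace n) : Continuous (derivSymbol v) := by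
  unfold derivSymbol
  fun_prop

lemma norm_derivSymbol_le {l : ℕ} (v : Fin l → RSpace n) (x : RSpace n) :
    ‖derivSymbol v x‖ ≤ (∏ i, ‖v i‖) * ‖x‖ ^ l := by
  rw [derivSymbol, norm_mul, norm_pow, norm_neg, Complex.norm_I, one_pow, one_mul, norm_prod,
    mul_comm]
  calc ∏ i, ‖((inner ℝ x (v i) : ℝ) : ℂ)‖ ≤ ∏ i, (‖x‖ * ‖v i‖) := by
        refine Finset.prod_le_prod (fun i _ => norm_nonneg _) fun i _ => ?_
        rw [Complex.norm_real]
        exact norm_inner_le_norm _ _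
    _ = _ := by rw [Finset.prod_mul_distrib]; simp

lemma integrable_derivSymbol {l : ℕ} (v : Fin l → RSpace n) (hh : AEStronglyMeasurable h ν)
    (hl : Integrable (fun x => ‖x‖ ^ l * ‖h x‖) ν) :
    Integrable (fun x => derivSymbol v x • h x) ν := by
  refine Integrable.mono' (hl.const_mul (∏ i, ‖v i‖))
    ((continuous_derivSymbol v).aestronglyMeasurable.smul hh) (Eventually.of_forall fun x => ?_)
  rw [norm_smul, ← mul_assoc]
  exact mul_le_mul_of_nonneg_right (norm_derivSymbol_le v x) (norm_nonneg _)

lemma iteratedFDeriv_ofDensity {N : ℕ}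
    (hN : ∀ k ≤ N, Integrable (fun x => ‖x‖ ^ k * ‖h x‖) ν) (hh : Integrable h ν) {l : ℕ}
    (hl : l ≤ N) (v : Fin l → RSpace n) (ξ : RSpace n) :
    iteratedFDeriv ℝ l (ofDensity ν h) ξ v = ofDensity ν (fun x => derivSymbol v x • h x) ξ := by
  have hN' : ∀ k : ℕ, (k : ℕ∞) ≤ (N : ℕ∞) → Integrable (fun x => ‖x‖ ^ k * ‖h x‖) ν :=
    fun k hk => hN k (by exact_mod_cast hk)
  have hc : ContDiff ℝ (N : ℕ∞)
      (VectorFourier.fourierIntegral Real.fourierChar ν (phase n).toLinearMap₁₂ h) :=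
    VectorFourier.contDiff_fourierIntegral (phase n) hN'
  have hl' : (l : ℕ∞) ≤ (N : ℕ∞) := by exact_mod_cast hl
  have hl'' : (l : WithTop ℕ∞) ≤ ((N : ℕ∞) : WithTop ℕ∞) := by exact_mod_cast hl
  have hi := VectorFourier.integrable_fourierPowSMulRight (phase n) (hN l hl) hh.1
  rw [ofDensity_apply (integrable_derivSymbol v hh.1 (hN l hl)), coe_ofDensity hh,
    iteratedFDeriv_const_smul_apply (hc.contDiffAt.of_le hl''),
    VectorFourier.iteratedFDeriv_fourierIntegral (phase n) hN' hh.1 hl']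
  change ((2 * Real.pi) ^ (-(n : ℝ) / 2) : ℝ) • (VectorFourier.fourierIntegral Real.fourierChar ν
    (phase n).toLinearMap₁₂ (fun v ↦ VectorFourier.fourierPowSMulRight (phase n) h v l) ξ) v = _
  rw [VectorFourier.fourierIntegral_continuousMultilinearMap_apply Real.continuous_fourierChar hi,
    VectorFourier.fourierIntegral]
  congr 1
  refine integral_congr_ae (Eventually.of_forall fun x => ?_)
  change Real.fourierChar (-(phase n x ξ)) • VectorFourier.fourierPowSMulRight (phase n) h x l v = _
  rw [VectorFourier.fourierPowSMulRight_apply]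
  rw [Circle.smul_def, fourierChar_phase]
  congr 1
  rw [← Complex.coe_smul (∏ i, phase n x (v i)), smul_smul]
  congr 1
  simp only [phase_apply, derivSymbol, Finset.prod_mul_distrib, Finset.prod_const,
    Finset.card_univ, Fintype.card_fin]
  push_cast
  rw [← mul_assoc, ← mul_pow]
  congr 2
  field_simp

end FM

namespace FM

variable {n m : ℕ} {ν : Measure (RSpace n)} {h : RSpace n → CSpace m}

@[simp] lemma coe_add (u v : FM n m) : ⇑(u + v) = ⇑u + ⇑v := rfl
@[simp] lemma coe_sub (u v : FM n m) : ⇑(u - v) = ⇑u - ⇑v := rfl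
@[simp] lemma coe_smul (c : ℂ) (u : FM n m) : ⇑(c • u) = c • ⇑u := rfl

lemma mem_fmSubmodule (u : FM n m) : ⇑u ∈ fmSubmodule n m := u.2

lemma ofDensity_sum {ι : Type*} (s : Finset ι) (f : ι → RSpace n → CSpace m)
    (hf : ∀ i ∈ s, Integrable (f i) ν) :
    ofDensity ν (fun x => ∑ i ∈ s, f i x) = ∑ i ∈ s, ofDensity ν (f i) := by
  classical
  induction s using Finset.induction_on with
  | empty => simpa using ofDensity_zero
  | insert i s hi ih =>
    have h1 : ∀ j ∈ s, Integrable (f j) ν := fun j hj => hf j (Finset.mem_insert_of_mem hj)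
    simp only [Finset.sum_insert hi]
    rw [ofDensity_add (hf i (Finset.mem_insert_self _ _)) (integrable_finsetSum _ h1), ih h1]

lemma coe_sum {ι : Type*} (s : Finset ι) (u : ι → FM n m) (ξ : RSpace n) :
    (∑ i ∈ s, u i) ξ = ∑ i ∈ s, u i ξ := by
  classical
  induction s using Finset.induction_on with
  | empty => rfl
  | insert i s hi ih => rw [Finset.sum_insert hi, Finset.sum_insert hi, ← ih]; rfl

lemma laplacian_ofDensity
    (hN : ∀ k ≤ 2, Integrable (fun x => ‖x‖ ^ k * ‖h x‖) ν) (hh : Integrable h ν) :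
    Laplacian.laplacian (⇑(ofDensity ν h)) =
      ofDensity ν fun x => (-(‖x‖ : ℂ) ^ 2) • h x := by
  have hb := InnerProductSpace.laplacian_eq_iteratedFDeriv_stdOrthonormalBasis
    (E := RSpace n) (⇑(ofDensity ν h))
  rw [hb]
  funext ξ
  beta_reduce
  set b := stdOrthonormalBasis ℝ (RSpace n)
  have hi : ∀ i, Integrable (fun x => derivSymbol ![b i, b i] x • h x) ν := fun i =>
    integrable_derivSymbol _ hh.1 (hN 2 le_rfl)
  rw [Finset.sum_congr rfl fun i _ => iteratedFDeriv_ofDensity hN hh le_rfl ![b i, b i] ξ,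
    ← coe_sum, ← ofDensity_sum _ _ fun i _ => hi i]
  congr 2
  funext x
  rw [← Finset.sum_smul]
  congr 1
  simp only [derivSymbol, Fin.prod_univ_two, Matrix.cons_val_zero, Matrix.cons_val_one]
  rw [← Finset.mul_sum, neg_sq, Complex.I_sq, neg_one_mul]
  congr 1
  rw [← Complex.ofReal_pow, ← OrthonormalBasis.sum_sq_inner_left b x]
  push_cast
  exact Finset.sum_congr rfl fun i _ => (sq _).symm

end FM

/-! ### The multiplier `(1 + Δ²)⁻¹` -/

/-- The symbol `1/(1 + |x|⁴)`. -/
def decay {n : ℕ} (x : RSpace n) : ℂ := ((1 + ‖x‖ ^ 4 : ℝ) : ℂ)⁻¹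

section decay
variable {n m : ℕ}

lemma one_add_pow_ne_zero (x : RSpace n) : ((1 + ‖x‖ ^ 4 : ℝ) : ℂ) ≠ 0 :=
  Complex.ofReal_ne_zero.2 (by positivity)

lemma continuous_decay : Continuous (decay : RSpace n → ℂ) := by
  unfold decay
  exact Continuous.inv₀ (by fun_prop) one_add_pow_ne_zero

lemma norm_decay (x : RSpace n) : ‖decay x‖ = (1 + ‖x‖ ^ 4)⁻¹ := by
  rw [decay, norm_inv, Complex.norm_real, Real.norm_of_nonneg (by positivity)]

lemma pow_le_one_add_pow {r : ℝ} (hr : 0 ≤ r) {k : ℕ} (hk : k ≤ 4) : r ^ k ≤ 1 + r ^ 4 := by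
  rcases le_total r 1 with h | h
  · exact (pow_le_one₀ hr h).trans (by simp; positivity)
  · exact (pow_le_pow_right₀ h hk).trans (by simp)

lemma pow_mul_norm_decay_le (x : RSpace n) {k : ℕ} (hk : k ≤ 4) : ‖x‖ ^ k * ‖decay x‖ ≤ 1 := by
  rw [norm_decay, ← div_eq_mul_inv, div_le_one (by positivity)]
  exact pow_le_one_add_pow (norm_nonneg x) hk

/-- A continuous scalar symbol of growth at most `|x|⁴`, divided by `1 + |x|⁴`. -/
lemma isSymbol_smul_decay {c : RSpace n → ℂ} (hc : Measurable c) {C : ℝ}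
    (hC : ∀ x, ‖c x‖ ≤ C * (1 + ‖x‖ ^ 4)) :
    IsSymbol fun x => (c x * decay x) • (1 : CSpace m →L[ℂ] CSpace m) := by
  refine IsSymbol.scalar (C := C) (hc.mul continuous_decay.measurable) fun x => ?_
  rw [norm_mul, norm_decay, ← div_eq_mul_inv, div_le_iff₀ (by positivity)]
  exact hC x

lemma isSymbol_decay : IsSymbol fun x : RSpace n => decay x • (1 : CSpace m →L[ℂ] CSpace m) :=
  IsSymbol.scalar (C := 1) continuous_decay.measurable fun x => by
    simpa using pow_mul_norm_decay_le x (Nat.zero_le 4)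

variable {ν : Measure (RSpace n)} {h : RSpace n → CSpace m}

lemma integrable_decay_smul (hh : Integrable h ν) : Integrable (fun x => decay x • h x) ν :=
  isSymbol_decay.integrable hh

lemma integrable_pow_mul_decay (hh : Integrable h ν) {k : ℕ} (hk : k ≤ 4) :
    Integrable (fun x => ‖x‖ ^ k * ‖decay x • h x‖) ν := by
  refine Integrable.mono' hh.norm
    (AEStronglyMeasurable.mul (by fun_prop) (integrable_decay_smul hh).1.norm)
    (Eventually.of_forall fun x => ?_)
  rw [norm_mul, norm_norm, norm_smul, norm_pow, norm_norm, ← mul_assoc]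
  exact mul_le_of_le_one_left (norm_nonneg _) (pow_mul_norm_decay_le x hk)

/-- The multiplier `(1 + Δ²)⁻¹` on `FM`. Writing `u = (1 + Δ²)⁻¹ w` replaces the unbounded
differential operators acting on `u` by bounded multipliers acting on `w`. -/
def smoothing : FM n m →L[ℂ] FM n m := FM.mult fun x => decay x • 1

lemma smoothing_ofDensity [IsFiniteMeasure ν] (hh : Integrable h ν) :
    smoothing (FM.ofDensity ν h) = FM.ofDensity ν fun x => decay x • h x :=
  FM.mult_ofDensity isSymbol_decay hh

/-- The symbol `∏ᵢ(-i x·vᵢ)/(1 + |x|⁴)`. -/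
def wordSymbol {l : ℕ} (v : Fin l → RSpace n) (x : RSpace n) : CSpace m →L[ℂ] CSpace m :=
  (FM.derivSymbol v x * decay x) • 1

lemma isSymbol_wordSymbol {l : ℕ} (hl : l ≤ 4) (v : Fin l → RSpace n) :
    IsSymbol (wordSymbol v : RSpace n → CSpace m →L[ℂ] CSpace m) :=
  isSymbol_smul_decay (FM.continuous_derivSymbol v).measurable (C := ∏ i, ‖v i‖) fun x =>
    (FM.norm_derivSymbol_le v x).trans (mul_le_mul_of_nonneg_left
      (pow_le_one_add_pow (norm_nonneg x) hl) (Finset.prod_nonneg fun _ _ => norm_nonneg _))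

lemma iteratedFDeriv_smoothing (w : FM n m) {l : ℕ} (hl : l ≤ 4) (v : Fin l → RSpace n)
    (ξ : RSpace n) :
    iteratedFDeriv ℝ l (smoothing w) ξ v = FM.mult (wordSymbol v) w ξ := by
  obtain ⟨ν, h, hν, hh, rfl⟩ := FM.exists_ofDensity_eq w
  rw [smoothing_ofDensity hh, FM.iteratedFDeriv_ofDensity
    (fun k hk => integrable_pow_mul_decay hh hk) (integrable_decay_smul hh) hl,
    FM.mult_ofDensity (isSymbol_wordSymbol hl v) hh]
  congr 2
  funext x
  simp [wordSymbol, mul_smul]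

lemma contDiff_smoothing (w : FM n m) : ContDiff ℝ 4 (smoothing w) := by
  obtain ⟨ν, h, hν, hh, rfl⟩ := FM.exists_ofDensity_eq w
  rw [smoothing_ofDensity hh]
  exact FM.contDiff_ofDensity (N := 4) (fun k hk => integrable_pow_mul_decay hh hk)
    (integrable_decay_smul hh)

lemma fderiv_smoothing (w : FM n m) (V ξ : RSpace n) :
    fderiv ℝ (smoothing w) ξ V =
      FM.mult (fun x => ((-Complex.I * (inner ℝ x V : ℝ)) * decay x) • 1) w ξ := by
  have := iteratedFDeriv_smoothing w (l := 1) (by norm_num) ![V] ξ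
  rw [iteratedFDeriv_one_apply] at this
  simp only [Matrix.cons_val_zero] at this
  rw [this]
  congr 3
  funext x
  simp [wordSymbol, FM.derivSymbol]

lemma isSymbol_sq_decay : IsSymbol fun x : RSpace n =>
    ((-(‖x‖ : ℂ) ^ 2) * decay x) • (1 : CSpace m →L[ℂ] CSpace m) :=
  isSymbol_smul_decay (by fun_prop) (C := 1) fun x => by
    simpa using pow_le_one_add_pow (norm_nonneg x) (k := 2) (by norm_num)

lemma isSymbol_pow_four_decay : IsSymbol fun x : RSpace n =>
    ((‖x‖ : ℂ) ^ 4 * decay x) • (1 : CSpace m →L[ℂ] CSpace m) :=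
  isSymbol_smul_decay (by fun_prop) (C := 1) fun x => by simp

lemma laplacian_smoothing (w : FM n m) :
    Laplacian.laplacian (⇑(smoothing w)) =
      FM.mult (fun x => ((-(‖x‖ : ℂ) ^ 2) * decay x) • 1) w := by
  obtain ⟨ν, h, hν, hh, rfl⟩ := FM.exists_ofDensity_eq w
  rw [smoothing_ofDensity hh, FM.mult_ofDensity isSymbol_sq_decay hh, FM.laplacian_ofDensity
    (fun k hk => integrable_pow_mul_decay hh (hk.trans (by norm_num))) (integrable_decay_smul hh)]
  congr 2
  funext x
  simp [mul_smul]

lemma laplacian_laplacian_smoothing (w : FM n m) :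
    Laplacian.laplacian (Laplacian.laplacian (⇑(smoothing w))) =
      FM.mult (fun x => ((‖x‖ : ℂ) ^ 4 * decay x) • 1) w := by
  rw [laplacian_smoothing]
  obtain ⟨ν, h, hν, hh, rfl⟩ := FM.exists_ofDensity_eq w
  have hi : Integrable (fun x => ((-(‖x‖ : ℂ) ^ 2) * decay x) • h x) ν :=
    isSymbol_sq_decay.integrable hh
  rw [FM.mult_ofDensity isSymbol_sq_decay hh, FM.mult_ofDensity isSymbol_pow_four_decay hh]
  simp only [smul_apply, one_apply_eq_self]
  rw [FM.laplacian_ofDensity (fun k hk => ?_) hi]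
  · congr 2
    funext x
    rw [smul_smul]
    congr 1
    ring
  · refine (integrable_pow_mul_decay hh (k := k + 2) (by omega)).congr
      (Eventually.of_forall fun x => ?_)
    simp only [norm_smul, norm_mul, norm_neg, norm_pow, Complex.norm_real, norm_norm]
    ring

/-- The lift of the multiplier `(1 + Δ²)⁻¹` to a map `FM → FM⁴`. -/
def smoothingLift : FM n m →+ FMk n m 4 where
  toFun w := ⟨smoothing w, FM.mem_fmSubmodule _, contDiff_smoothing w, fun l v => by
    have : wordDeriv l v (smoothing w) = FM.mult (wordSymbol fun i => dir (v i)) w := by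
      funext ξ
      exact iteratedFDeriv_smoothing w (Nat.lt_succ_iff.1 l.2) _ ξ
    rw [this]
    exact FM.mem_fmSubmodule _⟩
  map_zero' := FMk.toFM_injective (map_zero smoothing)
  map_add' u v := FMk.toFM_injective (map_add smoothing u v)

@[simp] lemma toFM_smoothingLift (w : FM n m) : (smoothingLift w).toFM = smoothing w := rfl

lemma partialDeriv_smoothingLift (w : FM n m) (l : Fin (4 + 1)) (v : Fin l → Fin n) :
    FMk.partialDeriv l v (smoothingLift w) = FM.mult (wordSymbol fun i => dir (v i)) w := by
  apply DFunLike.coe_injective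
  funext ξ
  exact iteratedFDeriv_smoothing w (Nat.lt_succ_iff.1 l.2) _ ξ

lemma exists_norm_smoothingLift_le (n m : ℕ) :
    ∃ C : ℝ, 0 ≤ C ∧ ∀ w : FM n m, ‖smoothingLift w‖ ≤ C * ‖w‖ := by
  refine ⟨∑ l : Fin (4 + 1), ∑ v : Fin l → Fin n,
    ‖(FM.mult (wordSymbol fun i => dir (v i)) : FM n m →L[ℂ] FM n m)‖, by positivity, fun w => ?_⟩
  rw [FMk.norm_def, Finset.sum_mul]
  gcongr with l
  rw [Finset.sum_mul]
  gcongr with v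
  rw [partialDeriv_smoothingLift]
  exact ContinuousLinearMap.le_opNorm _ _

lemma continuous_smoothingLift : Continuous (smoothingLift : FM n m →+ FMk n m 4) := by
  obtain ⟨C, -, hC⟩ := exists_norm_smoothingLift_le n m
  exact AddMonoidHomClass.continuous_of_bound _ C hC

end decay

/-! ### Testing against Schwartz functions -/

section testing
variable {n m : ℕ}

open scoped SchwartzMap LineDeriv FourierTransform

/-- The transform `x ↦ ∫ exp(-i x·ξ) φ(ξ) dξ` of a test function. -/
def testTransform (φ : 𝓢(RSpace n, ℂ)) (x : RSpace n) : ℂ :=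
  VectorFourier.fourierIntegral Real.fourierChar volume (phase n).toLinearMap₁₂ φ x

lemma flip_phase : (phase n).flip = phase n := by
  ext x y
  simp [phase_apply, real_inner_comm]

lemma continuous_testTransform (φ : 𝓢(RSpace n, ℂ)) : Continuous (testTransform φ) :=
  VectorFourier.fourierIntegral_continuous Real.continuous_fourierChar
    (by apply (phase n).continuous₂) φ.integrable

lemma norm_testTransform_le (φ : 𝓢(RSpace n, ℂ)) (x : RSpace n) :
    ‖testTransform φ x‖ ≤ ∫ ξ, ‖φ ξ‖ :=
  VectorFourier.norm_fourierIntegral_le_integral_norm _ _ _ _ _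

lemma testTransform_lineDeriv (φ : 𝓢(RSpace n, ℂ)) (v x : RSpace n) :
    testTransform (∂_{v} φ) x = Complex.I * (inner ℝ x v : ℝ) * testTransform φ x := by
  have hi : Integrable (fderiv ℝ φ) := (SchwartzMap.fderivCLM ℝ (RSpace n) ℂ φ).integrable
  have h := VectorFourier.fourierIntegral_fderiv (phase n) (μ := volume) φ.integrable
    φ.differentiable hi
  have h2 := congrArg (fun T : RSpace n →L[ℝ] ℂ => T v) (congrFun h x)
  simp only [VectorFourier.fourierSMulRight_apply] at h2
  rw [VectorFourier.fourierIntegral_continuousLinearMap_apply Real.continuous_fourierChar hi] at h2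
  refine h2.trans ?_
  rw [flip_phase]
  change -(2 * Real.pi * Complex.I) • (-(phase n x v)) • testTransform φ x = _
  rw [phase_apply, smul_eq_mul, ← Complex.coe_smul, smul_eq_mul, ← mul_assoc]
  congr 1
  push_cast
  field_simp

/-- By Fourier inversion every compactly supported smooth function is such a transform. -/
lemma exists_testTransform_eq {ψ : RSpace n → ℝ}
    (hψ : ContDiff ℝ ((⊤ : ℕ∞) : WithTop ℕ∞) ψ) (hc : HasCompactSupport ψ) :
    ∃ φ : 𝓢(RSpace n, ℂ), ∀ x, testTransform φ x = ψ x := by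
  let e : RSpace n ≃L[ℝ] RSpace n :=
    ContinuousLinearEquiv.smulLeft (Units.mk0 (2 * Real.pi) (by positivity))
  have he : ∀ y, e y = (2 * Real.pi) • y := fun y => rfl
  let g : RSpace n → ℂ := fun y => (ψ (e y) : ℂ)
  have hg : ContDiff ℝ ((⊤ : ℕ∞) : WithTop ℕ∞) g :=
    Complex.ofRealCLM.contDiff.comp (hψ.comp e.contDiff)
  have hgc : HasCompactSupport g :=
    (hc.comp_homeomorph e.toHomeomorph).comp_left (g := fun r : ℝ => (r : ℂ)) Complex.ofReal_zero
  let φ : 𝓢(RSpace n, ℂ) := 𝓕⁻ (hgc.toSchwartzMap hg)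
  refine ⟨φ, fun x => ?_⟩
  have h1 : testTransform φ x = (𝓕 (φ : RSpace n → ℂ)) ((2 * Real.pi)⁻¹ • x) := by
    rw [Real.fourier_eq, testTransform, VectorFourier.fourierIntegral]
    refine integral_congr_ae (Eventually.of_forall fun ξ => ?_)
    change Real.fourierChar (-(phase n ξ x)) • φ ξ = _
    rw [phase_apply]
    beta_reduce
    rw [inner_smul_right]
  have h2 : 𝓕 (φ : RSpace n → ℂ) = g := by
    rw [← SchwartzMap.fourier_coe, FourierTransform.fourier_fourierInv_eq]
    rfl
  rw [h1, h2]
  change ((ψ (e _) : ℝ) : ℂ) = _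
  rw [he, smul_smul, mul_inv_cancel₀ (by positivity), one_smul]

/-- Consequently, functions are determined by their integrals against these transforms. -/
lemma ae_eq_zero_of_forall_integral_testTransform {E : Type*} [NormedAddCommGroup E]
    [NormedSpace ℂ E] [CompleteSpace E] {ν : Measure (RSpace n)} [IsFiniteMeasure ν]
    {g : RSpace n → E}
    (hg : LocallyIntegrable g ν)
    (h0 : ∀ φ : 𝓢(RSpace n, ℂ), ∫ x, testTransform φ x • g x ∂ν = 0) : ∀ᵐ x ∂ν, g x = 0 := by
  refine ae_eq_zero_of_integral_contDiff_smul_eq_zero hg fun ψ hψ hc => ?_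
  obtain ⟨φ, hφ⟩ := exists_testTransform_eq hψ hc
  have := h0 φ
  simp only [hφ, Complex.coe_smul] at this
  exact this

variable {ν : Measure (RSpace n)} {h : RSpace n → CSpace m}

lemma integrable_testTransform_smul {E : Type*} [NormedAddCommGroup E] [NormedSpace ℂ E]
    {g : RSpace n → E} (hg : Integrable g ν) (φ : 𝓢(RSpace n, ℂ)) :
    Integrable (fun x => testTransform φ x • g x) ν :=
  hg.bdd_smul _ (continuous_testTransform φ).aestronglyMeasurable
    (Eventually.of_forall (norm_testTransform_le φ))

/-- Parseval's relation between an element of `FM` and its measure. -/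
lemma integral_smul_ofDensity [IsFiniteMeasure ν] (hh : Integrable h ν) (φ : 𝓢(RSpace n, ℂ)) :
    ∫ ξ, φ ξ • FM.ofDensity ν h ξ = ((2 * Real.pi) ^ (-(n : ℝ) / 2) : ℝ) •
      ∫ x, testTransform φ x • h x ∂ν := by
  have key := VectorFourier.integral_fourierIntegral_smul_eq_flip (μ := volume) (ν := ν)
    (L := (phase n).toLinearMap₁₂) (f := φ) (g := h) Real.continuous_fourierChar
    (by apply (phase n).continuous₂) φ.integrable hh
  change ∫ x, testTransform φ x • h x ∂ν = _ at key
  have hf : (phase n).toLinearMap₁₂.flip = (phase n).toLinearMap₁₂ := by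
    ext x y
    exact congrArg (fun T : RSpace n →L[ℝ] RSpace n →L[ℝ] ℝ => T x y) (flip_phase (n := n))
  rw [key, hf, FM.coe_ofDensity hh, ← integral_smul]
  refine integral_congr_ae (Eventually.of_forall fun ξ => ?_)
  simp only [Pi.smul_apply]
  rw [smul_comm]

lemma integrable_smul_coe (u : FM n m) (φ : 𝓢(RSpace n, ℂ)) : Integrable fun ξ => φ ξ • u ξ := by
  refine (φ.integrable.norm.mul_const ((2 * Real.pi) ^ (-(n : ℝ) / 2) * ‖u‖)).mono'
    (φ.continuous.smul u.continuous_coe).aestronglyMeasurable (Eventually.of_forall fun ξ => ?_)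
  rw [norm_smul]
  exact mul_le_mul_of_nonneg_left (u.norm_apply_le ξ) (norm_nonneg _)

lemma integral_mul_ofDensity [IsFiniteMeasure ν] (hh : Integrable h ν) (φ : 𝓢(RSpace n, ℂ))
    (j : Fin m) :
    ∫ ξ, φ ξ * FM.ofDensity ν h ξ j = ((2 * Real.pi) ^ (-(n : ℝ) / 2) : ℝ) •
      ∫ x, testTransform φ x * h x j ∂ν := by
  have key := congrArg (EuclideanSpace.proj j : CSpace m →L[ℂ] ℂ) (integral_smul_ofDensity hh φ)
  rw [← ContinuousLinearMap.integral_comp_comm _ (integrable_smul_coe _ φ),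
    ContinuousLinearMap.map_smul_of_tower,
    ← ContinuousLinearMap.integral_comp_comm _ (integrable_testTransform_smul hh φ)] at key
  exact key

lemma integrable_coord (hh : Integrable h ν) (j : Fin m) : Integrable (fun x => h x j) ν :=
  (EuclideanSpace.proj j : CSpace m →L[ℂ] ℂ).integrable_comp hh

lemma locallyIntegrable_mul [IsFiniteMeasure ν] {E : Type*} [NormedAddCommGroup E] [NormedSpace ℂ E]
    {g : RSpace n → E} (hg : Integrable g ν) {c : RSpace n → ℂ} (hc : Continuous c) :
    LocallyIntegrable (fun x => c x • g x) ν :=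
  hg.locallyIntegrable.continuous_smul hc

lemma inner_dir (x : RSpace n) (j : Fin n) : (inner ℝ x (dir j : RSpace n) : ℝ) = x j := by
  rw [EuclideanSpace.inner_single_right]
  simp

/-- Divergence freeness in terms of the measure: its density is orthogonal to the frequency. -/
lemma isDivFree_ofDensity [IsFiniteMeasure ν] {h : RSpace n → CSpace n} (hh : Integrable h ν) :
    IsDivFree (FM.ofDensity ν h) ↔ ∀ᵐ x ∂ν, ∑ j, (x j : ℂ) * h x j = 0 := by
  have key : ∀ φ : 𝓢(RSpace n, ℂ), ∫ x, ∑ j, fderiv ℝ φ x (dir j) * FM.ofDensity ν h x j =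
      ((2 * Real.pi) ^ (-(n : ℝ) / 2) : ℝ) •
        ∫ x, testTransform φ x • (Complex.I * ∑ j, (x j : ℂ) * h x j) ∂ν := by
    intro φ
    have e1 : ∀ j, Integrable fun ξ => (∂_{(dir j : RSpace n)} φ) ξ * FM.ofDensity ν h ξ j :=
      fun j => (EuclideanSpace.proj j : CSpace n →L[ℂ] ℂ).integrable_comp
        (integrable_smul_coe (FM.ofDensity ν h) (∂_{(dir j : RSpace n)} φ))
    have e2 : ∀ j, Integrable
        (fun x => testTransform (∂_{(dir j : RSpace n)} φ) x * h x j) ν := fun j =>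
      integrable_testTransform_smul (integrable_coord hh j) _
    calc ∫ x, ∑ j, fderiv ℝ φ x (dir j) * FM.ofDensity ν h x j
        = ∑ j, ∫ x, (∂_{(dir j : RSpace n)} φ) x * FM.ofDensity ν h x j :=
          integral_finsetSum _ fun j _ => e1 j
      _ = ((2 * Real.pi) ^ (-(n : ℝ) / 2) : ℝ) •
          ∑ j, ∫ x, testTransform (∂_{(dir j : RSpace n)} φ) x * h x j ∂ν := by
          rw [Finset.smul_sum]
          exact Finset.sum_congr rfl fun j _ => integral_mul_ofDensity hh _ j
      _ = _ := by
          rw [← integral_finsetSum _ fun j _ => e2 j]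
          congr 1
          refine integral_congr_ae (Eventually.of_forall fun x => ?_)
          simp only [testTransform_lineDeriv, inner_dir, smul_eq_mul, Finset.mul_sum]
          exact Finset.sum_congr rfl fun j _ => by ring
  constructor
  · intro hd
    have hl : LocallyIntegrable (fun x => Complex.I * ∑ j, (x j : ℂ) * h x j) ν := by
      have : LocallyIntegrable (fun x => ∑ j, (x j : ℂ) • h x j) ν :=
        locallyIntegrable_finsetSum _ fun j _ =>
          locallyIntegrable_mul (integrable_coord hh j) (by fun_prop)
      exact this.smul Complex.I
    have := ae_eq_zero_of_forall_integral_testTransform hl fun φ => by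
      have h1 := hd φ
      rw [key φ, smul_eq_zero] at h1
      exact h1.resolve_left (by positivity)
    filter_upwards [this] with x hx
    simpa using hx
  · intro h0 φ
    rw [key φ, integral_eq_zero_of_ae, smul_zero]
    filter_upwards [h0] with x hx
    simp [hx]

/-- If the directional derivative of `u = μ̂` is `ρ̂`, then `ρ = -i(x·v) μ`. -/
lemma density_eq_of_fderiv_eq [IsFiniteMeasure ν] {h g : RSpace n → CSpace m}
    (hh : Integrable h ν) (hg : Integrable g ν) (v : RSpace n)
    (hd : Differentiable ℝ (FM.ofDensity ν h))
    (e : ∀ ξ, fderiv ℝ (FM.ofDensity ν h) ξ v = FM.ofDensity ν g ξ) :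
    ∀ᵐ x ∂ν, g x = (-Complex.I * (inner ℝ x v : ℝ)) • h x := by
  have hl : LocallyIntegrable (fun x => g x + (Complex.I * (inner ℝ x v : ℝ)) • h x) ν :=
    hg.locallyIntegrable.add (locallyIntegrable_mul hh (by fun_prop))
  have := ae_eq_zero_of_forall_integral_testTransform hl fun φ => by
    have h1 := integral_smul_fderiv_eq_neg_fderiv_smul_of_integrable (μ := volume) (f := φ)
      (g := FM.ofDensity ν h) (v := v) (integrable_smul_coe (FM.ofDensity ν h) (∂_{v} φ))
      (by simp only [e]; exact integrable_smul_coe _ φ) (integrable_smul_coe _ φ)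
      (fun x _ => φ.differentiable x) (fun x _ => hd x)
    simp only [e] at h1
    have h2 : ∫ ξ, fderiv ℝ φ ξ v • FM.ofDensity ν h ξ = _ :=
      integral_smul_ofDensity hh (∂_{v} φ)
    rw [h2, integral_smul_ofDensity hg φ, ← smul_neg] at h1
    have h3 := smul_right_injective _ (show ((2 * Real.pi) ^ (-(n : ℝ) / 2) : ℝ) ≠ 0 by positivity) h1
    simp only [smul_add]
    have e2 : ∀ x, testTransform φ x • (Complex.I * (inner ℝ x v : ℝ)) • h x =
        testTransform (∂_{v} φ) x • h x := fun x => by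
      rw [testTransform_lineDeriv, smul_smul, mul_comm]
    simp only [e2]
    rw [integral_add (integrable_testTransform_smul hg φ) (integrable_testTransform_smul hh _), h3]
    simp
  filter_upwards [this] with x hx
  rw [neg_mul, neg_smul]
  exact eq_neg_of_add_eq_zero_left hx

end testing

/-! ### `FM⁴` as the range of `(1 + Δ²)⁻¹` -/

section surjective
variable {n m : ℕ}

lemma wordDeriv_succ {l : ℕ} {u : RSpace n → CSpace m} (hu : ContDiff ℝ 4 u) (hl : l < 4)
    (v : Fin (l + 1) → Fin n) (ξ : RSpace n) :
    wordDeriv (l + 1) v u ξ = fderiv ℝ (wordDeriv l (Fin.tail v) u) ξ (dir (v 0)) := by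
  have hd : DifferentiableAt ℝ (iteratedFDeriv ℝ l u) ξ :=
    hu.differentiable_iteratedFDeriv (by exact_mod_cast hl) ξ
  change _ = fderiv ℝ (fun y => iteratedFDeriv ℝ l u y fun i => dir (Fin.tail v i)) ξ (dir (v 0))
  rw [fderiv_continuousMultilinear_apply_const_apply hd]
  rfl

lemma differentiable_wordDeriv {l : ℕ} {u : RSpace n → CSpace m} (hu : ContDiff ℝ 4 u) (hl : l < 4)
    (v : Fin l → Fin n) : Differentiable ℝ (wordDeriv l v u) := fun ξ =>
  (hu.differentiable_iteratedFDeriv (by exact_mod_cast hl) ξ).continuousMultilinear_apply_const _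

/-- Every element of `FM⁴` arises from `FM` by applying `(1 + Δ²)⁻¹`. -/
lemma surjective_smoothingLift : Function.Surjective (smoothingLift : FM n m →+ FMk n m 4) := by
  intro u
  obtain ⟨ν, H, hν, hH⟩ := FM.exists_ofDensity_eq_family
    (fun i : (Σ l : Fin (4 + 1), (Fin l → Fin n)) => FMk.partialDeriv i.1 i.2 u)
  -- `w₀` is the empty word, so that `H ⟨0, w₀⟩` is the density of `u` itself
  let w₀ : Fin (0 : Fin (4 + 1)) → Fin n := fun i => i.elim0
  have hu0 : FM.ofDensity ν (H ⟨0, w₀⟩) = u.toFM := by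
    rw [(hH ⟨0, w₀⟩).2, FMk.partialDeriv_zero]
  -- every partial derivative of `u` has the density of `u` times the expected symbol
  have key : ∀ (l : ℕ) (hl : l < 4 + 1) (v : Fin l → Fin n),
      ∀ᵐ x ∂ν, H ⟨⟨l, hl⟩, v⟩ x = FM.derivSymbol (fun i => dir (v i)) x • H ⟨0, w₀⟩ x := by
    intro l
    induction l with
    | zero =>
      intro hl v
      have : v = w₀ := funext fun i => i.elim0
      subst this
      exact Eventually.of_forall fun x => by simp [FM.derivSymbol]
    | succ l ih =>
      intro hl v
      have hl' : l < 4 := by omega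
      have h1 := density_eq_of_fderiv_eq (hH ⟨⟨l, by omega⟩, Fin.tail v⟩).1 (hH ⟨⟨l + 1, hl⟩, v⟩).1
        (dir (v 0)) (by
          rw [(hH ⟨⟨l, by omega⟩, Fin.tail v⟩).2]
          exact differentiable_wordDeriv u.2.2.1 hl' _) (fun ξ => by
          rw [(hH ⟨⟨l, by omega⟩, Fin.tail v⟩).2, (hH ⟨⟨l + 1, hl⟩, v⟩).2]
          exact (wordDeriv_succ u.2.2.1 hl' v ξ).symm)
      filter_upwards [h1, ih (by omega) (Fin.tail v)] with x hx1 hx2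
      rw [hx1, hx2, smul_smul]
      congr 1
      simp only [FM.derivSymbol, Fin.prod_univ_succ, pow_succ, Fin.tail]
      ring
  -- the preimage of `u` is `u + Δ²u`, with `Δ² = ∑ᵢⱼ ∂ᵢ∂ᵢ∂ⱼ∂ⱼ`
  let g : Fin n → Fin n → RSpace n → CSpace m := fun i j => H ⟨⟨4, by norm_num⟩, ![i, i, j, j]⟩
  have hgi : ∀ i j, Integrable (g i j) ν := fun i j => (hH _).1
  have hi : Integrable (fun x => H ⟨0, w₀⟩ x + ∑ i, ∑ j, g i j x) ν :=
    (hH _).1.add (integrable_finsetSum _ fun i _ => integrable_finsetSum _ fun j _ => hgi i j)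
  refine ⟨FM.ofDensity ν fun x => H ⟨0, w₀⟩ x + ∑ i, ∑ j, g i j x, FMk.toFM_injective ?_⟩
  rw [toFM_smoothingLift, smoothing_ofDensity hi, ← hu0]
  refine FM.ofDensity_congr ?_
  have hall : ∀ᵐ x ∂ν, ∀ i j, g i j x =
      FM.derivSymbol (fun k => dir ((![i, i, j, j] : Fin 4 → Fin n) k)) x • H ⟨0, w₀⟩ x :=
    ae_all_iff.2 fun i => ae_all_iff.2 fun j => key 4 (by norm_num) ![i, i, j, j]
  filter_upwards [hall] with x hx
  simp only [hx]
  have e : ∀ i j, FM.derivSymbol (fun k => dir ((![i, i, j, j] : Fin 4 → Fin n) k)) x =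
      (x i : ℂ) ^ 2 * (x j : ℂ) ^ 2 := fun i j => by
    have h4 : (-Complex.I) ^ 4 = 1 := by rw [Even.neg_pow (by decide), Complex.I_pow_four]
    simp only [FM.derivSymbol, inner_dir, Fin.prod_univ_four, h4]
    change 1 * ((x i : ℂ) * x i * x j * x j) = _
    ring
  simp only [e, ← Finset.sum_smul, ← Finset.mul_sum, ← Finset.sum_mul]
  have hs : ∑ i, (x i : ℂ) ^ 2 = (‖x‖ : ℂ) ^ 2 := by
    rw [← Complex.ofReal_pow, EuclideanSpace.norm_sq_eq]
    simp
  rw [hs, ← one_smul ℂ (H ⟨0, w₀⟩ x), smul_smul, mul_one, ← add_smul, smul_smul]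
  congr 1
  have := one_add_pow_ne_zero x
  rw [decay]
  push_cast at this ⊢
  field_simp

end surjective

/-! ### The Helmholtz projection -/

section projection
variable {n : ℕ}

/-- The frequency as a complex vector. -/
def cvec (x : RSpace n) : CSpace n := WithLp.toLp 2 fun j => (x j : ℂ)

@[simp] lemma cvec_apply (x : RSpace n) (j : Fin n) : cvec x j = (x j : ℂ) := rfl

lemma continuous_cvec : Continuous (cvec : RSpace n → CSpace n) := by
  unfold cvec
  fun_prop

lemma norm_cvec (x : RSpace n) : ‖cvec x‖ = ‖x‖ := by
  simp [EuclideanSpace.norm_eq]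

lemma inner_cvec (x : RSpace n) (v : CSpace n) : inner ℂ (cvec x) v = ∑ j, (x j : ℂ) * v j := by
  simp [PiLp.inner_apply, mul_comm]

/-- The symbol `x xᵀ/|x|²` of the projection onto gradient fields; it is `0` at the origin. -/
def gradSymbol (x : RSpace n) : CSpace n →L[ℂ] CSpace n :=
  ((‖x‖ : ℂ) ^ 2)⁻¹ • InnerProductSpace.rankOne ℂ (cvec x) (cvec x)

lemma gradSymbol_apply (x : RSpace n) (v : CSpace n) :
    gradSymbol x v = (((‖x‖ : ℂ) ^ 2)⁻¹ * ∑ j, (x j : ℂ) * v j) • cvec x := by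
  rw [gradSymbol, smul_apply, InnerProductSpace.rankOne_apply, inner_cvec, smul_smul]

open Classical in
/-- The symbol `1 - x xᵀ/|x|²` of the Helmholtz projection, with the value `0` at the origin: the
corresponding multiplier projects `FM` onto the solenoidal fields without mass at the origin. -/
def helmholtzSymbol (x : RSpace n) : CSpace n →L[ℂ] CSpace n :=
  if x = 0 then 0 else 1 - gradSymbol x

lemma norm_gradSymbol_le (x : RSpace n) : ‖gradSymbol x‖ ≤ 1 := by
  rw [gradSymbol, norm_smul, InnerProductSpace.norm_rankOne, norm_cvec, norm_inv, norm_pow,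
    Complex.norm_real, norm_norm, ← sq, inv_mul_eq_div]
  exact div_self_le_one _

lemma continuous_rankOne_self (E : Type*) [NormedAddCommGroup E] [InnerProductSpace ℂ E] :
    Continuous fun x : E => InnerProductSpace.rankOne ℂ x x :=
  (ContinuousLinearMap.smulRightL ℂ E E).continuous₂.comp
    ((innerSL ℂ).continuous.prodMk continuous_id)

lemma isSymbol_gradSymbol : IsSymbol (gradSymbol : RSpace n → CSpace n →L[ℂ] CSpace n) := by
  refine ⟨?_, 1, norm_gradSymbol_le⟩
  have h1 : Measurable fun x : RSpace n => ((‖x‖ : ℂ) ^ 2)⁻¹ := by fun_prop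
  have h2 : Continuous fun x : RSpace n => InnerProductSpace.rankOne ℂ (cvec x) (cvec x) :=
    (continuous_rankOne_self (CSpace n)).comp continuous_cvec
  exact h1.stronglyMeasurable.smul h2.stronglyMeasurable

lemma gradSymbol_zero : gradSymbol (0 : RSpace n) = 0 := by
  simp [gradSymbol]

lemma helmholtzSymbol_zero : helmholtzSymbol (0 : RSpace n) = 0 := if_pos rfl

lemma helmholtzSymbol_of_ne {x : RSpace n} (hx : x ≠ 0) : helmholtzSymbol x = 1 - gradSymbol x :=
  if_neg hx

lemma isSymbol_helmholtzSymbol :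
    IsSymbol (helmholtzSymbol : RSpace n → CSpace n →L[ℂ] CSpace n) := by
  have h := (IsSymbol.const (1 : CSpace n →L[ℂ] CSpace n)).sub (isSymbol_gradSymbol (n := n))
  obtain ⟨C, hC⟩ := h.bounded
  refine ⟨StronglyMeasurable.ite (measurableSet_singleton 0) stronglyMeasurable_zero h.1, C, ?_⟩
  intro x
  unfold helmholtzSymbol
  split_ifs
  · simpa using (norm_nonneg _).trans (hC 0)
  · exact hC x

lemma sum_ofReal_sq (x : RSpace n) : ∑ j, (x j : ℂ) * (x j : ℂ) = (‖x‖ : ℂ) ^ 2 := by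
  rw [← Complex.ofReal_pow, EuclideanSpace.norm_sq_eq]
  simp [sq]

/-- The gradient projection preserves the divergence. -/
lemma sum_mul_gradSymbol (x : RSpace n) (v : CSpace n) :
    ∑ j, (x j : ℂ) * gradSymbol x v j = ∑ j, (x j : ℂ) * v j := by
  rcases eq_or_ne x 0 with rfl | hx
  · simp
  · have hx' : (‖x‖ : ℂ) ^ 2 ≠ 0 := by simpa using hx
    rw [gradSymbol_apply]
    simp only [PiLp.smul_apply, cvec_apply, smul_eq_mul]
    rw [Finset.sum_congr rfl fun j _ => mul_left_comm _ _ _, ← Finset.mul_sum, sum_ofReal_sq,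
      mul_comm, mul_inv_cancel_left₀ hx']

lemma gradSymbol_mul_self (x : RSpace n) : gradSymbol x * gradSymbol x = gradSymbol x := by
  ext1 v
  change gradSymbol x (gradSymbol x v) = _
  rw [gradSymbol_apply x (gradSymbol x v), sum_mul_gradSymbol, ← gradSymbol_apply]

lemma helmholtzSymbol_mul_gradSymbol (x : RSpace n) : helmholtzSymbol x * gradSymbol x = 0 := by
  rcases eq_or_ne x 0 with rfl | hx
  · rw [gradSymbol_zero, mul_zero]
  · rw [helmholtzSymbol_of_ne hx, sub_mul, one_mul, gradSymbol_mul_self, sub_self]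

lemma helmholtzSymbol_mul_self (x : RSpace n) :
    helmholtzSymbol x * helmholtzSymbol x = helmholtzSymbol x := by
  rcases eq_or_ne x 0 with rfl | hx
  · rw [helmholtzSymbol_zero, mul_zero]
  · nth_rw 2 [helmholtzSymbol_of_ne hx]
    rw [mul_sub, helmholtzSymbol_mul_gradSymbol, mul_one, sub_zero]

/-- The range of the projection consists of the vectors orthogonal to `x`, and is trivial at the
origin. -/
lemma helmholtzSymbol_apply_eq_self_iff (x : RSpace n) (v : CSpace n) :
    helmholtzSymbol x v = v ↔ (x = 0 → v = 0) ∧ ∑ j, (x j : ℂ) * v j = 0 := by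
  rcases eq_or_ne x 0 with rfl | hx
  · rw [helmholtzSymbol_zero]
    simp [eq_comm]
  · rw [helmholtzSymbol_of_ne hx]
    change v - gradSymbol x v = v ↔ _
    rw [sub_eq_self]
    constructor
    · intro h
      refine ⟨fun h0 => absurd h0 hx, ?_⟩
      rw [← sum_mul_gradSymbol, h]
      simp
    · intro h
      rw [gradSymbol_apply, h.2]
      simp

/-- The Helmholtz projection of `FM` onto its solenoidal elements without mass at the origin. -/
def helmholtz : FM n n →L[ℂ] FM n n := FM.mult helmholtzSymbol

lemma mem_FM₀σ_iff (u : FM n n) : u ∈ FM₀σ n ↔ helmholtz u = u := by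
  obtain ⟨ν, h, hν, hh, rfl⟩ := FM.exists_ofDensity_eq u
  change FM.ofDensity ν h ∈ FM₀ n n ∧ IsDivFree (FM.ofDensity ν h) ↔ _
  rw [FM.ofDensity_mem_FM₀ hh, isDivFree_ofDensity hh, helmholtz,
    FM.mult_ofDensity isSymbol_helmholtzSymbol hh]
  constructor
  · rintro ⟨h1, h2⟩
    refine FM.ofDensity_congr ?_
    filter_upwards [h1, h2] with x h1 h2
    exact (helmholtzSymbol_apply_eq_self_iff x (h x)).2 ⟨h1, h2⟩
  · intro e
    have := FM.ofDensity_inj (isSymbol_helmholtzSymbol.integrable hh) hh e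
    have h3 : ∀ᵐ x ∂ν, (x = 0 → h x = 0) ∧ ∑ j, (x j : ℂ) * h x j = 0 := by
      filter_upwards [this] with x hx
      exact (helmholtzSymbol_apply_eq_self_iff x (h x)).1 hx
    exact ⟨h3.mono fun x hx => hx.1, h3.mono fun x hx => hx.2⟩

lemma helmholtz_helmholtz (u : FM n n) : helmholtz (helmholtz u) = helmholtz u := by
  rw [helmholtz, FM.mult_mult isSymbol_helmholtzSymbol isSymbol_helmholtzSymbol]
  simp only [helmholtzSymbol_mul_self]

end projection

/-! ### Pressures and their gradients -/

section pressure
variable {n : ℕ}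

open scoped SchwartzMap LineDeriv

lemma Pressure.fderiv_dir (q : Pressure n) (j : Fin n) (ξ : RSpace n) :
    fderiv ℝ q.toFun ξ (dir j) = q.grad ξ j := rfl

/-- A pressure has bounded gradient. -/
lemma Pressure.exists_norm_fderiv_le (q : Pressure n) : ∃ C, ∀ ξ, ‖fderiv ℝ q.toFun ξ‖ ≤ C := by
  obtain ⟨D, hD⟩ : ∃ D, ∀ ξ, ‖q.grad ξ‖ ≤ D := ⟨_, q.grad.norm_apply_le⟩
  have hD0 : 0 ≤ D := (norm_nonneg _).trans (hD 0)
  refine ⟨n * D, fun ξ => ContinuousLinearMap.opNorm_le_bound _ (by positivity) fun y => ?_⟩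
  have hy : y = ∑ j, y j • (dir j : RSpace n) := by
    ext i
    simp [Pi.single_apply]
  have : fderiv ℝ q.toFun ξ y = ∑ j, y j • q.grad ξ j := by
    conv_lhs => rw [hy]
    simp only [map_sum, map_smul]
    rfl
  rw [this]
  calc ‖∑ j, y j • q.grad ξ j‖ ≤ ∑ j : Fin n, ‖y j • q.grad ξ j‖ := norm_sum_le _ _
    _ ≤ ∑ _j : Fin n, ‖y‖ * D := by
        refine Finset.sum_le_sum fun j _ => ?_
        rw [norm_smul]
        exact mul_le_mul (PiLp.norm_apply_le y j) ((PiLp.norm_apply_le _ j).trans (hD ξ))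
          (norm_nonneg _) (norm_nonneg _)
    _ = n * D * ‖y‖ := by
        rw [Finset.sum_const, Finset.card_univ, Fintype.card_fin, nsmul_eq_mul]
        ring

/-- A pressure grows at most linearly, hence is integrable against Schwartz functions. -/
lemma Pressure.integrable_mul (q : Pressure n) (φ : 𝓢(RSpace n, ℂ)) :
    Integrable fun ξ => φ ξ * q.toFun ξ := by
  obtain ⟨C, hC⟩ := q.exists_norm_fderiv_le
  have hb : ∀ ξ, ‖q.toFun ξ‖ ≤ ‖q.toFun 0‖ + C * ‖ξ‖ := fun ξ => by
    have := convex_univ.norm_image_sub_le_of_norm_fderiv_le (𝕜 := ℝ) (f := q.toFun)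
      (fun x _ => q.differentiable x) (fun x _ => hC x) (mem_univ 0) (mem_univ ξ)
    rw [sub_zero] at this
    calc ‖q.toFun ξ‖ = ‖q.toFun 0 + (q.toFun ξ - q.toFun 0)‖ := by rw [add_sub_cancel]
      _ ≤ _ := (norm_add_le _ _).trans (by gcongr)
  refine Integrable.mono' ((φ.integrable.norm.const_mul ‖q.toFun 0‖).add
    ((φ.integrable_pow_mul volume 1).const_mul C))
    (φ.continuous.mul q.differentiable.continuous).aestronglyMeasurable
    (Eventually.of_forall fun ξ => ?_)
  rw [norm_mul]
  calc ‖φ ξ‖ * ‖q.toFun ξ‖ ≤ ‖φ ξ‖ * (‖q.toFun 0‖ + C * ‖ξ‖) := by gcongr; exact hb ξ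
    _ = _ := by simp only [Pi.add_apply, pow_one]; ring

lemma lineDeriv_comm (φ : 𝓢(RSpace n, ℂ)) (v w ξ : RSpace n) :
    ∂_{v} (∂_{w} φ) ξ = ∂_{w} (∂_{v} φ) ξ := by
  have hd : DifferentiableAt ℝ (fderiv ℝ φ) ξ :=
    (SchwartzMap.fderivCLM ℝ (RSpace n) ℂ φ).differentiable ξ
  have key : ∀ a b : RSpace n, ∂_{a} (∂_{b} φ) ξ = fderiv ℝ (fderiv ℝ φ) ξ a b := fun a b => by
    change fderiv ℝ (fun y => fderiv ℝ φ y b) ξ a = _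
    rw [fderiv_clm_apply hd (differentiableAt_const b)]
    simp
  rw [key, key]
  have hs : IsSymmSndFDerivAt ℝ φ ξ :=
    (φ.smooth 2).contDiffAt.isSymmSndFDerivAt (by simp)
  exact hs v w

lemma Pressure.integral_mul_grad (q : Pressure n) (φ : 𝓢(RSpace n, ℂ)) (j : Fin n) :
    ∫ ξ, φ ξ * q.grad ξ j = -∫ ξ, (∂_{(dir j : RSpace n)} φ) ξ * q.toFun ξ := by
  have h1 : Integrable fun ξ => fderiv ℝ φ ξ (dir j) * q.toFun ξ :=
    q.integrable_mul (∂_{(dir j : RSpace n)} φ)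
  have h2 : Integrable fun ξ => φ ξ * fderiv ℝ q.toFun ξ (dir j) :=
    (EuclideanSpace.proj j : CSpace n →L[ℂ] ℂ).integrable_comp (integrable_smul_coe q.grad φ)
  exact integral_mul_fderiv_eq_neg_fderiv_mul_of_integrable h1 h2 (q.integrable_mul φ)
    (fun x _ => φ.differentiable x) (fun x _ => q.differentiable x)

/-- Pressure gradients are curl free, so the Helmholtz projection annihilates them. -/
lemma Pressure.helmholtz_grad (q : Pressure n) : helmholtz q.grad = 0 := by
  obtain ⟨ν, h, hν, hh, e⟩ := FM.exists_ofDensity_eq q.grad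
  have hcurl : ∀ j k, ∀ᵐ x ∂ν, (x k : ℂ) • h x j - (x j : ℂ) • h x k = 0 := by
    intro j k
    refine ae_eq_zero_of_forall_integral_testTransform
      ((locallyIntegrable_mul (integrable_coord hh j) (by fun_prop)).sub
        (locallyIntegrable_mul (integrable_coord hh k) (by fun_prop))) fun φ => ?_
    have h1 : ∫ ξ, (∂_{(dir k : RSpace n)} φ) ξ * q.grad ξ j =
        ∫ ξ, (∂_{(dir j : RSpace n)} φ) ξ * q.grad ξ k := by
      rw [q.integral_mul_grad, q.integral_mul_grad]
      simp only [lineDeriv_comm φ (dir j) (dir k)]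
    rw [← e, integral_mul_ofDensity hh, integral_mul_ofDensity hh] at h1
    have h2 := smul_right_injective _
      (show ((2 * Real.pi) ^ (-(n : ℝ) / 2) : ℝ) ≠ 0 by positivity) h1
    have e2 : ∀ x, testTransform φ x • ((x k : ℂ) • h x j - (x j : ℂ) • h x k) =
        -Complex.I * (testTransform (∂_{(dir k : RSpace n)} φ) x * h x j -
          testTransform (∂_{(dir j : RSpace n)} φ) x * h x k) := fun x => by
      simp only [testTransform_lineDeriv, inner_dir, smul_eq_mul]
      linear_combination (testTransform φ x * ((x k : ℂ) * h x j - (x j : ℂ) * h x k)) *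
        Complex.I_sq
    have hi : ∀ (i : Fin n) (ψ : 𝓢(RSpace n, ℂ)),
        Integrable (fun x => testTransform ψ x * h x i) ν := fun i ψ =>
      integrable_testTransform_smul (integrable_coord hh i) ψ
    simp only [e2]
    rw [integral_const_mul, integral_sub (hi j _) (hi k _)]
    simp only [h2, sub_self, mul_zero]
  rw [← e, helmholtz, FM.mult_ofDensity isSymbol_helmholtzSymbol hh, ← FM.ofDensity_zero (ν := ν)]
  refine FM.ofDensity_congr ?_
  have hall := ae_all_iff.2 fun j => ae_all_iff.2 fun k => hcurl j k
  filter_upwards [hall] with x hx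
  rcases eq_or_ne x 0 with rfl | h0
  · rw [helmholtzSymbol_zero]
    rfl
  · rw [helmholtzSymbol_of_ne h0]
    change h x - gradSymbol x (h x) = 0
    have hx' : (‖x‖ : ℂ) ^ 2 ≠ 0 := by simpa using h0
    rw [sub_eq_zero, gradSymbol_apply]
    ext j
    simp only [PiLp.smul_apply, cvec_apply, smul_eq_mul]
    -- as the curl vanishes, `h x` is parallel to `x`
    have : (∑ k, (x k : ℂ) * h x k) * x j = (‖x‖ : ℂ) ^ 2 * h x j := by
      rw [← sum_ofReal_sq, Finset.sum_mul, Finset.sum_mul]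
      refine Finset.sum_congr rfl fun k _ => ?_
      have := sub_eq_zero.1 (hx j k)
      simp only [smul_eq_mul] at this
      linear_combination (-(x k : ℂ)) * this
    rw [mul_assoc, this, inv_mul_cancel_left₀ hx']

/-- The kernel `exp(-i x·ξ) - 1` is `O(|x|)`. -/
lemma norm_exp_neg_sub_one_le (x ξ : RSpace n) :
    ‖Complex.exp (-((inner ℝ x ξ : ℝ) : ℂ) * Complex.I) - 1‖ ≤ ‖x‖ * ‖ξ‖ := by
  have := Real.norm_exp_I_mul_ofReal_sub_one_le (x := -inner ℝ x ξ)
  rw [Complex.ofReal_neg, mul_comm] at this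
  refine this.trans ?_
  rw [norm_neg]
  exact norm_inner_le_norm _ _

/-- Every gradient multiplier `x xᵀ/|x|²` yields the gradient of a pressure, namely of
`q(ξ) = (2π)^(-n/2) ∫ (exp(-i x·ξ) - 1) i |x|⁻² (x·h(x)) dν(x)`. The term `-1` makes the integral
converge at small frequencies. -/
lemma exists_pressure (w : FM n n) : ∃ q : Pressure n, q.grad = FM.mult gradSymbol w := by
  obtain ⟨ν, h, hν, hh, rfl⟩ := FM.exists_ofDensity_eq w
  set G := FM.mult gradSymbol (FM.ofDensity ν h) with hG
  have hi : Integrable (fun x => gradSymbol x (h x)) ν := isSymbol_gradSymbol.integrable hh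
  rw [FM.mult_ofDensity isSymbol_gradSymbol hh] at hG
  -- the density of `q` before the correction by `-1`; it has a singularity of order `|x|⁻¹`
  let s : RSpace n → ℂ := fun x => Complex.I * (((‖x‖ : ℂ) ^ 2)⁻¹ * inner ℂ (cvec x) (h x))
  have hs : ∀ x, ‖x‖ * ‖s x‖ ≤ ‖h x‖ := fun x => by
    simp only [s, norm_mul, Complex.norm_I, one_mul, norm_inv, norm_pow, Complex.norm_real,
      norm_norm]
    rcases eq_or_ne x 0 with rfl | h0
    · simp
    · have hx : 0 < ‖x‖ := norm_pos_iff.2 h0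
      have := norm_inner_le_norm (𝕜 := ℂ) (cvec x) (h x)
      rw [norm_cvec] at this
      calc ‖x‖ * ((‖x‖ ^ 2)⁻¹ * ‖inner ℂ (cvec x) (h x)‖)
          ≤ ‖x‖ * ((‖x‖ ^ 2)⁻¹ * (‖x‖ * ‖h x‖)) := by gcongr
        _ = ‖h x‖ := by field_simp
  have hsm : AEStronglyMeasurable s ν := by
    have h1 : Measurable fun x : RSpace n => ((‖x‖ : ℂ) ^ 2)⁻¹ := by fun_prop
    exact (h1.aestronglyMeasurable.mul
      (continuous_cvec.aestronglyMeasurable.inner hh.1)).const_mul _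
  let c : ℝ := (2 * Real.pi) ^ (-(n : ℝ) / 2)
  let F : RSpace n → RSpace n → ℂ := fun ξ x =>
    (Complex.exp (-((inner ℝ x ξ : ℝ) : ℂ) * Complex.I) - 1) * s x
  let F' : RSpace n → RSpace n → RSpace n →L[ℝ] ℂ := fun ξ x =>
    (s x * (Complex.exp (-((inner ℝ x ξ : ℝ) : ℂ) * Complex.I) * (-Complex.I))) •
      (Complex.ofRealCLM ∘L innerSL ℝ x)
  have hFm : ∀ ξ, AEStronglyMeasurable (F ξ) ν := fun ξ =>
    (Continuous.aestronglyMeasurable (by fun_prop)).mul hsm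
  have hFi : ∀ ξ, Integrable (F ξ) ν := fun ξ => by
    refine Integrable.mono' (hh.norm.const_mul ‖ξ‖) (hFm ξ) (Eventually.of_forall fun x => ?_)
    calc ‖F ξ x‖ ≤ (‖x‖ * ‖ξ‖) * ‖s x‖ := by
          rw [norm_mul]
          gcongr
          exact norm_exp_neg_sub_one_le x ξ
      _ = ‖ξ‖ * (‖x‖ * ‖s x‖) := by ring
      _ ≤ ‖ξ‖ * ‖h x‖ := by gcongr; exact hs x
  have hF'm : ∀ ξ, AEStronglyMeasurable (F' ξ) ν := fun ξ => by
    refine AEStronglyMeasurable.fun_smul (hsm.mul (Continuous.aestronglyMeasurable (by fun_prop))) ?_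
    exact Continuous.aestronglyMeasurable
      ((ContinuousLinearMap.compL ℝ (RSpace n) ℝ ℂ Complex.ofRealCLM).continuous.comp
        (innerSL ℝ).continuous)
  have hF'b : ∀ ξ x, ‖F' ξ x‖ ≤ ‖h x‖ := fun ξ x => by
    have h1 : ‖Complex.exp (-((inner ℝ x ξ : ℝ) : ℂ) * Complex.I) * (-Complex.I)‖ = 1 := by
      rw [norm_mul, norm_neg, Complex.norm_I, ← Complex.ofReal_neg,
        Complex.norm_exp_ofReal_mul_I, mul_one]
    rw [norm_smul, norm_mul, h1, mul_one]
    refine le_trans ?_ (hs x)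
    rw [mul_comm]
    gcongr
    refine (ContinuousLinearMap.opNorm_comp_le _ _).trans ?_
    rw [Complex.ofRealCLM_norm, one_mul, innerSL_apply_norm]
  have hd : ∀ x ξ, HasFDerivAt (fun ξ => F ξ x) (F' ξ x) ξ := fun x ξ => by
    have h1 : HasFDerivAt (fun ξ : RSpace n => ((inner ℝ x ξ : ℝ) : ℂ))
        (Complex.ofRealCLM ∘L innerSL ℝ x) ξ :=
      (Complex.ofRealCLM ∘L innerSL ℝ x).hasFDerivAt
    have h2 := (((h1.neg.mul_const Complex.I).cexp).sub_const 1).mul_const (s x)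
    refine h2.congr_fderiv ?_
    ext y
    simp [F']
    ring
  have hq : ∀ ξ, HasFDerivAt (fun ξ => ∫ x, F ξ x ∂ν) (∫ x, F' ξ x ∂ν) ξ := fun ξ =>
    hasFDerivAt_integral_of_dominated_of_fderiv_le (s := univ) univ_mem
      (Eventually.of_forall hFm) (hFi ξ) (hF'm ξ) (bound := fun x => ‖h x‖)
      (Eventually.of_forall fun x ξ _ => hF'b ξ x) hh.norm
      (Eventually.of_forall fun x ξ _ => hd x ξ)
  have hq' : ∀ ξ, HasFDerivAt (fun ξ => c • ∫ x, F ξ x ∂ν) (c • ∫ x, F' ξ x ∂ν) ξ := fun ξ =>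
    (hq ξ).const_smul c
  have hgrad : spatialGrad (fun ξ => c • ∫ x, F ξ x ∂ν) = G := by
    funext ξ
    rw [hG, FM.ofDensity_apply hi]
    ext j
    have hF'i : Integrable (F' ξ) ν :=
      Integrable.mono' hh.norm (hF'm ξ) (Eventually.of_forall fun x => hF'b ξ x)
    have hei : Integrable (fun x => Complex.exp (-((inner ℝ x ξ : ℝ) : ℂ) * Complex.I) •
        gradSymbol x (h x)) ν :=
      hi.bdd_smul 1 (RadonMeasure.continuous_kernel ξ).aestronglyMeasurable
        (Eventually.of_forall fun x => by
          rw [← Complex.ofReal_neg, Complex.norm_exp_ofReal_mul_I])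
    have e1 : (c • ∫ x, F' ξ x ∂ν) (dir j) = c • ∫ x, F' ξ x (dir j) ∂ν := by
      rw [smul_apply, ContinuousLinearMap.integral_apply hF'i]
    have e2 := (EuclideanSpace.proj j : CSpace n →L[ℂ] ℂ).integral_comp_comm hei
    change fderiv ℝ (fun ξ => c • ∫ x, F ξ x ∂ν) ξ (dir j) = c • (EuclideanSpace.proj j :
      CSpace n →L[ℂ] ℂ) (∫ x, Complex.exp (-((inner ℝ x ξ : ℝ) : ℂ) * Complex.I) •
        gradSymbol x (h x) ∂ν)
    rw [(hq' ξ).fderiv, e1, ← e2]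
    congr 1
    refine integral_congr_ae (Eventually.of_forall fun x => ?_)
    change (s x * (Complex.exp (-((inner ℝ x ξ : ℝ) : ℂ) * Complex.I) * (-Complex.I))) •
      ((inner ℝ x (dir j : RSpace n) : ℝ) : ℂ) =
      Complex.exp (-((inner ℝ x ξ : ℝ) : ℂ) * Complex.I) * gradSymbol x (h x) j
    rw [inner_dir, gradSymbol_apply]
    simp only [PiLp.smul_apply, cvec_apply, smul_eq_mul, s, inner_cvec]
    linear_combination (-(((‖x‖ : ℂ) ^ 2)⁻¹ * (∑ j, (x j : ℂ) * h x j) *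
      Complex.exp (-((inner ℝ x ξ : ℝ) : ℂ) * Complex.I) * x j)) * Complex.I_sq
  have hmem : spatialGrad (fun ξ => c • ∫ x, F ξ x ∂ν) ∈ fmSubmodule n n := by
    rw [hgrad]
    exact FM.mem_fmSubmodule G
  have heq : FM.ofMem _ hmem = G := DFunLike.coe_injective hgrad
  refine ⟨⟨fun ξ => c • ∫ x, F ξ x ∂ν, fun ξ => (hq' ξ).differentiableAt, hmem, ?_⟩, heq⟩
  rw [heq, hG, FM.ofDensity_mem_FM₀ hi]
  refine Eventually.of_forall fun x hx => ?_
  rw [hx, gradSymbol_zero]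
  rfl

/-- Pressures with the same gradient differ by a constant. -/
lemma Pressure.exists_eq_add_const {q r : Pressure n} (e : q.grad = r.grad) :
    ∃ c : ℂ, ∀ x, r.toFun x = q.toFun x + c := by
  have hd : Differentiable ℝ (fun x => r.toFun x - q.toFun x) :=
    r.differentiable.sub q.differentiable
  refine ⟨r.toFun 0 - q.toFun 0, fun x => ?_⟩
  have h0 : ∀ ξ, fderiv ℝ (fun x => r.toFun x - q.toFun x) ξ = 0 := fun ξ => by
    rw [fderiv_fun_sub (r.differentiable ξ) (q.differentiable ξ), sub_eq_zero]
    have hb : ∀ j : Fin n, fderiv ℝ r.toFun ξ (dir j) = fderiv ℝ q.toFun ξ (dir j) := fun j => by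
      rw [q.fderiv_dir, r.fderiv_dir, e]
    apply ContinuousLinearMap.coe_injective
    refine (EuclideanSpace.basisFun (Fin n) ℝ).toBasis.ext fun j => ?_
    simpa using hb j
  have := is_const_of_fderiv_eq_zero hd h0 x 0
  linear_combination this

end pressure

/-! ### Functions of class `W^{1,1}` in time -/

section weakDerivative
variable {X : Type*} [NormedAddCommGroup X] [NormedSpace ℝ X] {T : ℝ}

lemma continuousOn_add_primitive {g : ℝ → X} (hg : IntegrableOn g (Ioo 0 T)) (y : X) :
    ContinuousOn (fun t => y + ∫ s in Ioc 0 t, g s) (Icc 0 T) :=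
  continuousOn_const.add
    (intervalIntegral.continuousOn_primitive
      ((integrableOn_Icc_iff_integrableOn_Ioo (by simp) (by simp)).2 hg))

lemma integrableOn_add_primitive {g : ℝ → X} (hg : IntegrableOn g (Ioo 0 T)) (y : X) :
    IntegrableOn (fun t => y + ∫ s in Ioc 0 t, g s) (Ioo 0 T) :=
  ((continuousOn_add_primitive hg y).integrableOn_compact isCompact_Icc).mono_set Ioo_subset_Icc_self

variable [CompleteSpace X]

/-- A test function on `(0,T)` integrates its derivative over `(s,T)` to `-φ(s)`. -/
lemma setIntegral_deriv_Ioo {φ : ℝ → ℝ} (hφ : ContDiff ℝ ((⊤ : ℕ∞) : WithTop ℕ∞) φ)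
    (hs : tsupport φ ⊆ Ioo 0 T) {s : ℝ} (hsT : s ≤ T) :
    ∫ t in Ioo s T, deriv φ t = -φ s := by
  have hd : Differentiable ℝ φ := hφ.differentiable (by simp)
  have hT : φ T = 0 := image_eq_zero_of_notMem_tsupport fun h => lt_irrefl _ (hs h).2
  rw [← integral_Ioc_eq_integral_Ioo, ← intervalIntegral.integral_of_le hsT,
    intervalIntegral.integral_deriv_eq_sub (fun x _ => hd x)
      ((hφ.continuous_deriv (by simp)).intervalIntegrable _ _), hT, zero_sub]

/-- Fubini's theorem turns the primitive of `g` into a weak primitive. -/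
lemma integral_deriv_smul_primitive {g : ℝ → X} (hg : IntegrableOn g (Ioo 0 T)) {φ : ℝ → ℝ}
    (hφ : ContDiff ℝ ((⊤ : ℕ∞) : WithTop ℕ∞) φ) (hc : HasCompactSupport φ)
    (hs : tsupport φ ⊆ Ioo 0 T) :
    ∫ t in Ioo 0 T, deriv φ t • ∫ s in Ioc 0 t, g s = -∫ s in Ioo 0 T, φ s • g s := by
  set μ := volume.restrict (Ioo 0 T) with hμ
  have hdc : Continuous (deriv φ) := hφ.continuous_deriv (by simp)
  have hdi : Integrable (deriv φ) μ := (hdc.integrable_of_hasCompactSupport hc.deriv).restrict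
  let H : ℝ × ℝ → X := {p : ℝ × ℝ | p.2 ≤ p.1}.indicator fun p => deriv φ p.1 • g p.2
  have hH : Integrable H (μ.prod μ) :=
    (Integrable.smul_prod hdi hg).indicator (measurableSet_le measurable_snd measurable_fst)
  have hH' : ∀ t s, H (t, s) = deriv φ t • (Iic t).indicator g s := fun t s => by
    by_cases h : s ≤ t <;> simp [H, Set.indicator, h]
  have e1 : ∀ᵐ t ∂μ, ∫ s, H (t, s) ∂μ = deriv φ t • ∫ s in Ioc 0 t, g s := by
    filter_upwards [ae_restrict_mem measurableSet_Ioo] with t ht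
    simp only [hH', integral_smul]
    rw [integral_indicator measurableSet_Iic, hμ, Measure.restrict_restrict measurableSet_Iic]
    congr 3
    ext s
    simp only [mem_inter_iff, mem_Iic, mem_Ioo, mem_Ioc]
    exact ⟨fun h => ⟨h.2.1, h.1⟩, fun h => ⟨h.2, h.1, h.2.trans_lt ht.2⟩⟩
  have e2 : ∀ᵐ s ∂μ, ∫ t, H (t, s) ∂μ = -(φ s • g s) := by
    filter_upwards [ae_restrict_mem measurableSet_Ioo] with s hs'
    have : ∀ t, H (t, s) = (Ici s).indicator (deriv φ) t • g s := fun t => by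
      by_cases h : s ≤ t <;> simp [H, Set.indicator, h]
    simp only [this]
    rw [integral_smul_const, integral_indicator measurableSet_Ici, hμ,
      Measure.restrict_restrict measurableSet_Ici]
    have hset : Ici s ∩ Ioo 0 T = Ico s T := by
      ext t
      simp only [mem_inter_iff, mem_Ici, mem_Ioo, mem_Ico]
      exact ⟨fun h => ⟨h.1, h.2.2⟩, fun h => ⟨h.1, hs'.1.trans_le h.1, h.2⟩⟩
    rw [hset, integral_Ico_eq_integral_Ioo, setIntegral_deriv_Ioo hφ hs hs'.2.le, neg_smul]
  rw [← integral_congr_ae e1, integral_integral_swap (f := fun t s => H (t, s)) hH,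
    integral_congr_ae e2, integral_neg]

/-- A function that agrees almost everywhere with a primitive of `g` has the weak derivative `g`. -/
lemma hasWeakTimeDeriv_of_ae_eq (hT : 0 < T) {u g : ℝ → X} (hg : IntegrableOn g (Ioo 0 T)) {y : X}
    (hu : ∀ᵐ t ∂volume.restrict (Ioo 0 T), u t = y + ∫ s in Ioc 0 t, g s) :
    HasWeakTimeDeriv T u g := by
  refine ⟨(integrableOn_add_primitive hg y).congr (hu.mono fun t h => h.symm), hg,
    fun φ hφ hc hs => ?_⟩
  have hdc : Continuous (deriv φ) := hφ.continuous_deriv (by simp)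
  have hdi : Integrable (deriv φ) (volume.restrict (Ioo 0 T)) :=
    (hdc.integrable_of_hasCompactSupport hc.deriv).restrict
  obtain ⟨C, hC⟩ := hc.deriv.exists_bound_of_continuous hdc
  have hp : IntegrableOn (fun t => ∫ s in Ioc 0 t, g s) (Ioo 0 T) := by
    simpa using integrableOn_add_primitive hg 0
  have h1 : Integrable (fun t => deriv φ t • ∫ s in Ioc 0 t, g s) (volume.restrict (Ioo 0 T)) :=
    Integrable.bdd_smul hp C hdc.aestronglyMeasurable (Eventually.of_forall hC)
  have h0 : φ 0 = 0 := image_eq_zero_of_notMem_tsupport fun h => lt_irrefl _ (hs h).1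
  calc ∫ t in Ioo 0 T, deriv φ t • u t
      = ∫ t in Ioo 0 T, (deriv φ t • y + deriv φ t • ∫ s in Ioc 0 t, g s) :=
        integral_congr_ae (hu.mono fun t h => by simp only [h, smul_add])
    _ = (∫ t in Ioo 0 T, deriv φ t) • y + ∫ t in Ioo 0 T, deriv φ t • ∫ s in Ioc 0 t, g s := by
        rw [integral_add (hdi.smul_const y) h1, integral_smul_const]
    _ = -∫ s in Ioo 0 T, φ s • g s := by
        rw [setIntegral_deriv_Ioo hφ hs hT.le, h0, neg_zero, zero_smul, zero_add,
          integral_deriv_smul_primitive hg hφ hc hs]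

lemma hasInitialValue_of_ae_eq {u g : ℝ → X} (hg : IntegrableOn g (Ioo 0 T)) {y : X}
    (hu : ∀ᵐ t ∂volume.restrict (Ioo 0 T), u t = y + ∫ s in Ioc 0 t, g s) :
    HasInitialValue T u y :=
  ⟨fun t => y + ∫ s in Ioc 0 t, g s, continuousOn_add_primitive hg y,
    hu.mono fun t h => h.symm, by simp⟩

/-- A smooth function with support in `(0,T)` and integral zero is the derivative of a test
function on `(0,T)`. -/
lemma exists_testFunction_deriv_eq {θ : ℝ → ℝ} (hθ : ContDiff ℝ ((⊤ : ℕ∞) : WithTop ℕ∞) θ)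
    (hc : HasCompactSupport θ) (hs : tsupport θ ⊆ Ioo 0 T) (h0 : ∫ t, θ t = 0) :
    ∃ φ : ℝ → ℝ, ContDiff ℝ ((⊤ : ℕ∞) : WithTop ℕ∞) φ ∧ HasCompactSupport φ ∧
      tsupport φ ⊆ Ioo 0 T ∧ deriv φ = θ := by
  have hd : ∀ t, HasDerivAt (fun t => ∫ s in (0 : ℝ)..t, θ s) (θ t) t := fun t =>
    intervalIntegral.integral_hasDerivAt_right (hθ.continuous.intervalIntegrable _ _)
      hθ.continuous.stronglyMeasurable.stronglyMeasurableAtFilter hθ.continuous.continuousAt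
  have hde : deriv (fun t => ∫ s in (0 : ℝ)..t, θ s) = θ := funext fun t => (hd t).deriv
  rcases (tsupport θ).eq_empty_or_nonempty with hemp | hne
  · have hz : θ = 0 := by rwa [tsupport_eq_empty_iff] at hemp
    refine ⟨0, contDiff_const, HasCompactSupport.zero, by simp [tsupport], ?_⟩
    rw [hz]
    funext t
    simp
  have hcK : IsCompact (tsupport θ) := hc
  obtain ⟨a, haK, ha⟩ := hcK.exists_isLeast hne
  obtain ⟨b, hbK, hb⟩ := hcK.exists_isGreatest hne
  have hz : ∀ t, t ∉ Icc a b → θ t = 0 := fun t ht =>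
    image_eq_zero_of_notMem_tsupport fun h => ht ⟨ha h, hb h⟩
  have ha0 := (hs haK).1
  have hbT := (hs hbK).2
  -- the primitive of `θ` vanishes outside the convex hull `[a, b]` of the support of `θ`
  have hsupp : Function.support (fun t => ∫ s in (0 : ℝ)..t, θ s) ⊆ Icc a b := by
    intro t ht
    by_contra hn
    apply ht
    rw [mem_Icc, not_and_or, not_le, not_le] at hn
    rcases hn with h | h
    · refine intervalIntegral.integral_zero_ae (Eventually.of_forall fun s hs' => hz s fun hs2 => ?_)
      have := hs'.2
      have : s ≤ max 0 t := hs'.2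
      exact absurd (hs2.1.trans this) (not_le.2 (max_lt ha0 h))
    · have h1 : ∫ s in (0 : ℝ)..t, θ s = ∫ s, θ s := by
        rw [intervalIntegral.integral_of_le (by linarith [ha hbK])]
        refine setIntegral_eq_integral_of_forall_compl_eq_zero fun s hs' => hz s fun hs2 => hs' ?_
        exact ⟨ha0.trans_le hs2.1, hs2.2.trans h.le⟩
      change ∫ s in (0 : ℝ)..t, θ s = 0
      rw [h1, h0]
  have hts : tsupport (fun t => ∫ s in (0 : ℝ)..t, θ s) ⊆ Icc a b :=
    closure_minimal hsupp isClosed_Icc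
  refine ⟨fun t => ∫ s in (0 : ℝ)..t, θ s, ?_, ?_, ?_, hde⟩
  · exact contDiff_infty_iff_deriv.2 ⟨fun t => (hd t).differentiableAt, by rw [hde]; exact hθ⟩
  · exact HasCompactSupport.of_support_subset_isCompact isCompact_Icc hsupp
  · exact hts.trans (Icc_subset_Ioo ha0 hbT)

/-- The du Bois-Reymond lemma: a function with zero weak derivative is constant. -/
lemma exists_ae_eq_const {z : ℝ → X} (hT : 0 < T) (hz : IntegrableOn z (Ioo 0 T))
    (h0 : ∀ φ : ℝ → ℝ, ContDiff ℝ ((⊤ : ℕ∞) : WithTop ℕ∞) φ → HasCompactSupport φ →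
      tsupport φ ⊆ Ioo 0 T → ∫ t in Ioo 0 T, deriv φ t • z t = 0) :
    ∃ c, ∀ᵐ t ∂volume.restrict (Ioo 0 T), z t = c := by
  -- a test function on `(0,T)` with integral one
  let b : ContDiffBump (T / 2) := ⟨T / 8, T / 4, by linarith, by linarith⟩
  let ψ : ℝ → ℝ := b.normed volume
  have hψ : ContDiff ℝ ((⊤ : ℕ∞) : WithTop ℕ∞) ψ := b.contDiff_normed
  have hψc : HasCompactSupport ψ := b.hasCompactSupport_normed
  have hψs : tsupport ψ ⊆ Ioo 0 T := by
    rw [b.tsupport_normed_eq, Real.closedBall_eq_Icc]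
    exact Icc_subset_Ioo (by change 0 < T / 2 - T / 4; linarith)
      (by change T / 2 + T / 4 < T; linarith)
  have hψ1 : ∫ t, ψ t = 1 := b.integral_normed
  have hzφ : ∀ φ : ℝ → ℝ, Continuous φ → HasCompactSupport φ →
      Integrable (fun t => φ t • z t) (volume.restrict (Ioo 0 T)) := fun φ hφ hc => by
    obtain ⟨C, hC⟩ := hc.exists_bound_of_continuous hφ
    exact Integrable.bdd_smul hz C hφ.aestronglyMeasurable (Eventually.of_forall hC)
  have hset : ∀ φ : ℝ → ℝ, tsupport φ ⊆ Ioo 0 T → ∫ t in Ioo 0 T, φ t = ∫ t, φ t := fun φ hs =>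
    setIntegral_eq_integral_of_forall_compl_eq_zero fun t ht =>
      image_eq_zero_of_notMem_tsupport fun h => ht (hs h)
  set c : X := ∫ t in Ioo 0 T, ψ t • z t with hcdef
  have hfin : IntegrableOn (fun _ : ℝ => c) (Ioo 0 T) := integrableOn_const (by simp)
  refine ⟨c, ?_⟩
  have key := isOpen_Ioo.ae_eq_zero_of_integral_contDiff_smul_eq_zero (μ := volume)
    (f := fun t => z t - c) (U := Ioo 0 T) (hz.sub hfin).locallyIntegrableOn fun η hη hηc hηs => by
    have hη' : ContDiff ℝ ((⊤ : ℕ∞) : WithTop ℕ∞) η := hη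
    set k := ∫ t, η t with hk
    have hηi : Integrable η := hη.continuous.integrable_of_hasCompactSupport hηc
    have hψi : Integrable ψ := hψ.continuous.integrable_of_hasCompactSupport hψc
    have hθs : Function.support (fun t => η t - k * ψ t) ⊆ tsupport η ∪ tsupport ψ := by
      intro t ht
      by_contra hn
      rw [mem_union, not_or] at hn
      exact ht (by simp [image_eq_zero_of_notMem_tsupport hn.1,
        image_eq_zero_of_notMem_tsupport hn.2])
    -- `η - (∫ η) ψ` has integral zero, hence is the derivative of a test function
    obtain ⟨φ, hφ, hφc, hφs, hφd⟩ := exists_testFunction_deriv_eq (T := T)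
      (θ := fun t => η t - k * ψ t) (hη'.sub (contDiff_const.mul hψ))
      (HasCompactSupport.of_support_subset_isCompact (IsCompact.union hηc hψc) hθs)
      ((closure_minimal hθs ((isClosed_tsupport _).union (isClosed_tsupport _))).trans
        (union_subset hηs hψs))
      (by rw [integral_sub hηi (hψi.const_mul k), integral_const_mul, hψ1, mul_one, sub_self])
    have h1 := h0 φ hφ hφc hφs
    rw [hφd] at h1
    simp only [sub_smul, mul_smul] at h1
    have hk2 : Integrable (fun t => k • ψ t • z t) (volume.restrict (Ioo 0 T)) :=
      (hzφ ψ hψ.continuous hψc).smul k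
    rw [integral_sub (hzφ η hη.continuous hηc) hk2,
      integral_smul, ← hcdef, sub_eq_zero] at h1
    have h2 : ∫ x, η x • (z x - c) = ∫ x in Ioo 0 T, η x • (z x - c) := by
      refine (setIntegral_eq_integral_of_forall_compl_eq_zero fun t ht => ?_).symm
      rw [image_eq_zero_of_notMem_tsupport fun h => ht (hηs h), zero_smul]
    rw [h2]
    simp only [smul_sub]
    rw [integral_sub (hzφ η hη.continuous hηc) (hηi.restrict.smul_const c), h1,
      integral_smul_const, hset η hηs, sub_self]
  rw [ae_restrict_iff' measurableSet_Ioo]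
  filter_upwards [key] with t ht hmem
  exact sub_eq_zero.1 (ht hmem)

/-- A function of class `W^{1,1}` with the initial value `y` is the primitive of its derivative. -/
lemma HasWeakTimeDeriv.ae_eq (hT : 0 < T) {u g : ℝ → X} {y : X} (hw : HasWeakTimeDeriv T u g)
    (hi : HasInitialValue T u y) :
    ∀ᵐ t ∂volume.restrict (Ioo 0 T), u t = y + ∫ s in Ioc 0 t, g s := by
  have hg := hw.integrableOn_deriv
  have hp : IntegrableOn (fun t => ∫ s in Ioc 0 t, g s) (Ioo 0 T) := by
    simpa using integrableOn_add_primitive hg 0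
  obtain ⟨c, hc⟩ := exists_ae_eq_const hT (hw.integrableOn.sub hp) fun φ hφ hφc hφs => by
    have hdc : Continuous (deriv φ) := hφ.continuous_deriv (by simp)
    obtain ⟨C, hC⟩ := hφc.deriv.exists_bound_of_continuous hdc
    have hb : ∀ f : ℝ → X, IntegrableOn f (Ioo 0 T) →
        Integrable (fun t => deriv φ t • f t) (volume.restrict (Ioo 0 T)) := fun f hf =>
      Integrable.bdd_smul hf C hdc.aestronglyMeasurable (Eventually.of_forall hC)
    simp only [Pi.sub_apply, smul_sub]
    rw [integral_sub (hb _ hw.integrableOn) (hb _ hp), hw.integral_eq φ hφ hφc hφs,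
      integral_deriv_smul_primitive hg hφ hφc hφs, sub_self]
  have hu : ∀ᵐ t ∂volume.restrict (Ioo 0 T), u t = c + ∫ s in Ioc 0 t, g s := by
    filter_upwards [hc] with t ht
    rw [← ht]
    simp
  obtain ⟨v, hv, hvu, hv0⟩ := hi
  have hae : v =ᵐ[volume.restrict (Icc 0 T)] fun t => c + ∫ s in Ioc 0 t, g s := by
    rw [Filter.EventuallyEq, ← Measure.restrict_congr_set Ioo_ae_eq_Icc]
    filter_upwards [hvu, hu] with t h1 h2
    rw [h1, h2]
  have := Measure.eqOn_Icc_of_ae_eq volume hT.ne hae hv (continuousOn_add_primitive hg c)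
    (left_mem_Icc.2 hT.le)
  have hcy : y = c := by
    rw [← hv0, this]
    simp
  rwa [hcy]

end weakDerivative

/-! ### Duhamel's formula -/

section duhamel
variable {X : Type*} [NormedAddCommGroup X] [NormedSpace ℂ X] {T : ℝ}

/-- The integrand `S(t - s) f(s)` of Duhamel's formula, extended by zero to `s ≥ t`. -/
def duhamelKernel (S : ℝ → X →L[ℂ] X) (f : ℝ → X) (p : ℝ × ℝ) : X :=
  {p : ℝ × ℝ | p.2 < p.1}.indicator (fun p => S (p.1 - p.2) (f p.2)) p

lemma stronglyMeasurable_duhamelKernel {S : ℝ → X →L[ℂ] X}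
    (hS : ∀ g, ContinuousOn (fun τ => S τ g) (Ioi 0)) {f : ℝ → X} (hf : StronglyMeasurable f) :
    StronglyMeasurable (duhamelKernel S f) := by
  -- `S` need not be continuous at `0`, so its argument is first kept away from `0`.
  have hpos : ∀ j : ℕ, (0 : ℝ) < 1 / (j + 1) := fun j => Nat.one_div_pos_of_nat
  have h1 : ∀ j : ℕ, StronglyMeasurable
      (Function.uncurry fun (τ s : ℝ) => S (max τ (1 / ((j : ℝ) + 1))) (f s)) := fun j => by
    refine stronglyMeasurable_uncurry_of_continuous_of_stronglyMeasurable (fun s => ?_) fun τ =>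
      (S _).continuous.comp_stronglyMeasurable hf
    refine (hS (f s)).comp_continuous (by fun_prop) fun τ => ?_
    exact (hpos j).trans_le (le_max_right _ _)
  have hm : Measurable fun p : ℝ × ℝ => (p.1 - p.2, p.2) := by fun_prop
  have hset : MeasurableSet {p : ℝ × ℝ | p.2 < p.1} :=
    measurableSet_lt measurable_snd measurable_fst
  refine stronglyMeasurable_of_tendsto atTop
    (f := fun j : ℕ => {p : ℝ × ℝ | p.2 < p.1}.indicator fun p : ℝ × ℝ =>
      S (max (p.1 - p.2) (1 / ((j : ℝ) + 1))) (f p.2))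
    (fun j => ((h1 j).comp_measurable hm).indicator hset) ?_
  rw [tendsto_pi_nhds]
  intro p
  by_cases hp : p.2 < p.1
  · have : ∀ᶠ j : ℕ in atTop, 1 / ((j : ℝ) + 1) < p.1 - p.2 :=
      (tendsto_order.1 (tendsto_one_div_add_atTop_nhds_zero_nat (𝕜 := ℝ))).2 _ (sub_pos.2 hp)
    refine tendsto_const_nhds.congr' ?_
    filter_upwards [this] with j hj
    have hmax : max (p.1 - p.2) (1 / ((j : ℝ) + 1)) = p.1 - p.2 := max_eq_left hj.le
    simp only [duhamelKernel, Set.indicator, mem_ofPred_eq, if_pos hp, hmax]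
  · simp [duhamelKernel, Set.indicator, hp]

lemma lintegral_duhamelKernel_le {S : ℝ → X →L[ℂ] X} {K : ℝ≥0}
    (hK : ∀ g, ∫⁻ τ in Ioo 0 T, ‖S τ g‖ₑ ≤ K * ‖g‖ₑ) (f : ℝ → X) {s : ℝ} (hs : 0 < s) :
    ∫⁻ t in Ioo 0 T, ‖duhamelKernel S f (t, s)‖ₑ ≤ K * ‖f s‖ₑ := by
  refine le_trans ?_ (hK (f s))
  have e := lintegral_sub_right_eq_self (μ := volume)
    ((Ioo 0 T).indicator fun τ => ‖S τ (f s)‖ₑ) s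
  rw [← lintegral_indicator measurableSet_Ioo, ← lintegral_indicator measurableSet_Ioo, ← e]
  refine lintegral_mono fun t => ?_
  by_cases ht : t ∈ Ioo 0 T
  · by_cases h : s < t
    · have : t - s ∈ Ioo 0 T := ⟨sub_pos.2 h, by linarith [ht.2]⟩
      rw [indicator_of_mem ht, indicator_of_mem this]
      simp [duhamelKernel, Set.indicator, h]
    · rw [indicator_of_mem ht]
      simp [duhamelKernel, Set.indicator, h]
  · rw [indicator_of_notMem ht]
    exact zero_le

lemma integrable_duhamelKernel {S : ℝ → X →L[ℂ] X}
    (hS : ∀ g, ContinuousOn (fun τ => S τ g) (Ioi 0)) {K : ℝ≥0}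
    (hK : ∀ g, ∫⁻ τ in Ioo 0 T, ‖S τ g‖ₑ ≤ K * ‖g‖ₑ) {f : ℝ → X} (hf : StronglyMeasurable f)
    (hfi : IntegrableOn f (Ioo 0 T)) :
    Integrable (duhamelKernel S f) ((volume.restrict (Ioo 0 T)).prod (volume.restrict (Ioo 0 T))) ∧
    ∫⁻ p, ‖duhamelKernel S f p‖ₑ ∂((volume.restrict (Ioo 0 T)).prod (volume.restrict (Ioo 0 T))) ≤
      K * ∫⁻ s in Ioo 0 T, ‖f s‖ₑ := by
  have hm := stronglyMeasurable_duhamelKernel hS hf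
  have hb : ∫⁻ p, ‖duhamelKernel S f p‖ₑ
      ∂((volume.restrict (Ioo 0 T)).prod (volume.restrict (Ioo 0 T))) ≤
      K * ∫⁻ s in Ioo 0 T, ‖f s‖ₑ := by
    rw [lintegral_prod_symm _ hm.enorm.aemeasurable, ← lintegral_const_mul' _ _ (by simp)]
    refine setLIntegral_mono' measurableSet_Ioo fun s hs => lintegral_duhamelKernel_le hK f hs.1
  exact ⟨⟨hm.aestronglyMeasurable, hb.trans_lt (ENNReal.mul_lt_top (by simp) hfi.2)⟩, hb⟩

variable [CompleteSpace X]

/-- Duhamel's formula. Here `R` and `A` are bounded regularisations of the identity and of the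
generator of the evolution family, `S` is the evolution family followed by the inverse of `R`, and
`P` is the projection to the space on which it acts; `hA` is its evolution equation, integrated in
time. The integrability of `‖S τ g‖` up to `τ = 0` makes the convolution with an integrable `f`
integrable. -/
lemma exists_duhamel {S : ℝ → X →L[ℂ] X} {P A R : X →L[ℂ] X}
    (hS : ∀ g, ContinuousOn (fun τ => S τ g) (Ioi 0)) {K : ℝ≥0}
    (hK : ∀ g, ∫⁻ τ in Ioo 0 T, ‖S τ g‖ₑ ≤ K * ‖g‖ₑ)
    (hA : ∀ g, ∀ t ∈ Ioo 0 T, A (∫ τ in Ioc 0 t, S τ g) = P g - R (S t g))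
    {f : ℝ → X} (hf : IntegrableOn f (Ioo 0 T)) (y : X) :
    ∃ w : ℝ → X, IntegrableOn w (Ioo 0 T) ∧
      ∫ t in Ioo 0 T, ‖w t‖ ≤ K * ((∫ t in Ioo 0 T, ‖f t‖) + ‖y‖) ∧
      (∀ᵐ t ∂volume.restrict (Ioo 0 T),
        R (w t) = P y + ∫ s in Ioc 0 t, (P (f s) - A (w s))) ∧
      ∀ B : X →L[ℂ] X, (∀ τ, 0 < τ → ∀ g, B (S τ g) = S τ g) →
        ∀ᵐ t ∂volume.restrict (Ioo 0 T), B (w t) = w t := by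
  set μ := volume.restrict (Ioo 0 T) with hμ
  obtain ⟨f', hf'm, hff'⟩ := hf.aestronglyMeasurable
  have hf' : IntegrableOn f' (Ioo 0 T) := hf.congr hff'
  set F := duhamelKernel S f' with hF
  obtain ⟨hFi, hFb⟩ := integrable_duhamelKernel hS hK hf'm hf'
  have hSy : ∀ g, IntegrableOn (fun t => S t g) (Ioo 0 T) := fun g =>
    ⟨((hS g).mono Ioo_subset_Ioi_self).aestronglyMeasurable measurableSet_Ioo,
      (hK g).trans_lt (ENNReal.mul_lt_top (by simp) (by simp))⟩
  have hFr : ∀ᵐ t ∂μ, Integrable (fun s => F (t, s)) μ := hFi.prod_right_ae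
  have hIi : Integrable (fun t => ∫ s, F (t, s) ∂μ) μ := hFi.integral_prod_left
  have hw : IntegrableOn (fun t => S t y + ∫ s, F (t, s) ∂μ) (Ioo 0 T) := (hSy y).add hIi
  refine ⟨fun t => S t y + ∫ s, F (t, s) ∂μ, hw, ?_, ?_, fun B hB => ?_⟩
  · have hle : ∫⁻ t, ‖S t y + ∫ s, F (t, s) ∂μ‖ₑ ∂μ ≤ K * ((∫⁻ t, ‖f t‖ₑ ∂μ) + ‖y‖ₑ) := by
      calc ∫⁻ t, ‖S t y + ∫ s, F (t, s) ∂μ‖ₑ ∂μ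
          ≤ ∫⁻ t, (‖S t y‖ₑ + ∫⁻ s, ‖F (t, s)‖ₑ ∂μ) ∂μ :=
            lintegral_mono fun t => (enorm_add_le _ _).trans
              (add_le_add le_rfl (enorm_integral_le_lintegral_enorm _))
        _ = (∫⁻ t, ‖S t y‖ₑ ∂μ) + ∫⁻ t, ∫⁻ s, ‖F (t, s)‖ₑ ∂μ ∂μ :=
            lintegral_add_left' (hSy y).aestronglyMeasurable.enorm _
        _ ≤ K * ‖y‖ₑ + K * ∫⁻ t, ‖f' t‖ₑ ∂μ := by
            rw [← lintegral_prod _ hFi.aestronglyMeasurable.enorm]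
            exact add_le_add (hK y) hFb
        _ = K * ((∫⁻ t, ‖f t‖ₑ ∂μ) + ‖y‖ₑ) := by
            rw [mul_add, add_comm]
            congr 2
            exact lintegral_congr_ae (hff'.mono fun t h => by simp only [h])
    have hfin : (K : ℝ≥0∞) * ((∫⁻ t, ‖f t‖ₑ ∂μ) + ‖y‖ₑ) ≠ ∞ :=
      ENNReal.mul_ne_top (by simp) (ENNReal.add_ne_top.2 ⟨hf.2.ne, by simp⟩)
    have h := ENNReal.toReal_mono hfin hle
    rw [ENNReal.toReal_mul, ENNReal.toReal_add hf.2.ne (by simp)] at h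
    rw [integral_norm_eq_lintegral_enorm hw.aestronglyMeasurable,
      integral_norm_eq_lintegral_enorm hf.aestronglyMeasurable]
    simpa using h
  · filter_upwards [hFr, ae_restrict_mem measurableSet_Ioo] with t hFt ht
    have hsub : Ioc 0 t ⊆ Ioo 0 T := fun s hs => ⟨hs.1, hs.2.trans_lt ht.2⟩
    have hres : volume.restrict (Ioc 0 t) ≤ μ := Measure.restrict_mono_set _ hsub
    have hPf : Integrable (fun s => P (f' s)) (volume.restrict (Ioc 0 t)) :=
      P.integrable_comp (Integrable.mono_measure hf' hres)
    have hwt : Integrable (fun t => S t y + ∫ s, F (t, s) ∂μ) (volume.restrict (Ioc 0 t)) :=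
      Integrable.mono_measure hw hres
    have hFi' : Integrable (Function.uncurry fun r s => F (r, s))
        ((volume.restrict (Ioc 0 t)).prod μ) :=
      hFi.mono_measure (Measure.prod_mono hres le_rfl)
    -- for fixed `s` the substitution `τ = r - s` turns the integral over `r` into that in `hA`
    have hinner : ∀ᵐ s ∂μ, A (∫ r in Ioc 0 t, F (r, s)) =
        (Ioc 0 t).indicator (fun s => P (f' s)) s - R (F (t, s)) := by
      have hne : ∀ᵐ s ∂μ, s ≠ t := ae_restrict_of_ae (by simp [ae_iff])
      filter_upwards [ae_restrict_mem measurableSet_Ioo, hne] with s hs hst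
      rcases lt_or_gt_of_ne hst with h | h
      · have e : ∫ r in Ioc 0 t, F (r, s) = ∫ τ in Ioc 0 (t - s), S τ (f' s) := by
          rw [← integral_indicator measurableSet_Ioc, ← integral_indicator measurableSet_Ioc,
            ← integral_sub_right_eq_self (μ := volume)
              ((Ioc 0 (t - s)).indicator fun τ => S τ (f' s)) s]
          congr 1
          funext r
          by_cases hr : s < r
          · by_cases hrt : r ≤ t
            · simp [Set.indicator, hr, hrt, hs.1.trans hr, hF, duhamelKernel]
            · simp [Set.indicator, hrt]
          · simp [Set.indicator, hr, hF, duhamelKernel]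
        rw [e, hA _ _ ⟨sub_pos.2 h, by linarith [hs.1, ht.2]⟩,
          indicator_of_mem (show s ∈ Ioc 0 t from ⟨hs.1, h.le⟩)]
        simp [hF, duhamelKernel, Set.indicator, h]
      · have e : ∫ r in Ioc 0 t, F (r, s) = 0 := by
          refine (setIntegral_congr_fun measurableSet_Ioc fun r hr => ?_).trans
            (integral_zero ℝ X)
          simp [hF, duhamelKernel, Set.indicator, (hr.2.trans h.le).not_gt]
        rw [e, indicator_of_notMem fun h' => h.not_ge h'.2]
        simp [hF, duhamelKernel, Set.indicator, h.not_gt]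
    have hA2 : A (∫ r in Ioc 0 t, ∫ s, F (r, s) ∂μ) =
        (∫ s in Ioc 0 t, P (f' s)) - R (∫ s, F (t, s) ∂μ) := by
      have hPi : Integrable ((Ioc 0 t).indicator fun s => P (f' s)) μ :=
        (P.integrable_comp hf').indicator measurableSet_Ioc
      have hFs : Integrable (fun s => ∫ r in Ioc 0 t, F (r, s)) μ := hFi'.integral_prod_right
      rw [integral_integral_swap (f := fun r s => F (r, s)) hFi', ← A.integral_comp_comm hFs, integral_congr_ae hinner,
        integral_sub hPi (R.integrable_comp hFt), R.integral_comp_comm hFt,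
        integral_indicator measurableSet_Ioc, hμ, Measure.restrict_restrict measurableSet_Ioc,
        inter_eq_left.2 hsub]
    have hPff : ∫ s in Ioc 0 t, P (f s) = ∫ s in Ioc 0 t, P (f' s) :=
      integral_congr_ae ((hff'.filter_mono (ae_mono hres)).mono fun s h => by simp only [h])
    have hPf2 : Integrable (fun s => P (f s)) (volume.restrict (Ioc 0 t)) :=
      P.integrable_comp (Integrable.mono_measure hf hres)
    rw [integral_sub hPf2 (A.integrable_comp hwt), A.integral_comp_comm hwt,
      integral_add (Integrable.mono_measure (hSy y) hres) (hIi.mono_measure hres), map_add, map_add, hA y t ht,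
      hA2, hPff]
    abel
  · filter_upwards [hFr, ae_restrict_mem measurableSet_Ioo] with t ht ht0
    rw [map_add, hB t ht0.1, ← B.integral_comp_comm ht]
    congr 2
    funext s
    by_cases h : s < t
    · simp [hF, duhamelKernel, Set.indicator, h, hB _ (sub_pos.2 h)]
    · simp [hF, duhamelKernel, Set.indicator, h]

end duhamel

/-! ### Families of multipliers -/

section families
variable {n m : ℕ}

lemma IsSymbol.const_smul {a : RSpace n → CSpace m →L[ℂ] CSpace m} (ha : IsSymbol a) (c : ℂ) :
    IsSymbol fun x => c • a x := by
  obtain ⟨C, hC⟩ := ha.bounded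
  refine ⟨ha.1.const_smul c, ‖c‖ * C, fun x => ?_⟩
  rw [norm_smul]
  exact mul_le_mul_of_nonneg_left (hC x) (norm_nonneg _)

namespace FM

lemma mult_const_smul {a : RSpace n → CSpace m →L[ℂ] CSpace m} (ha : IsSymbol a) (c : ℂ)
    (u : FM n m) : mult (fun x => c • a x) u = c • mult a u := by
  obtain ⟨ν, h, hν, hh, rfl⟩ := exists_ofDensity_eq u
  rw [mult_ofDensity ha hh, mult_ofDensity (ha.const_smul c) hh, ← ofDensity_smul]
  rfl

/-- Multipliers depend strongly continuously on their symbols under bounded pointwise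
convergence. -/
lemma tendsto_mult {ι : Type*} {l : Filter ι} [l.IsCountablyGenerated]
    {k : ι → RSpace n → CSpace m →L[ℂ] CSpace m} {k₀ : RSpace n → CSpace m →L[ℂ] CSpace m}
    (hk : ∀ᶠ i in l, IsSymbol (k i)) (hk₀ : IsSymbol k₀) {C : ℝ}
    (hC : ∀ᶠ i in l, ∀ x, ‖k i x‖ ≤ C) (hlim : ∀ x, Tendsto (fun i => k i x) l (𝓝 (k₀ x)))
    (u : FM n m) : Tendsto (fun i => mult (k i) u) l (𝓝 (mult k₀ u)) := by
  obtain ⟨ν, h, hν, hh, rfl⟩ := exists_ofDensity_eq u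
  obtain ⟨D, hD⟩ := hk₀.bounded
  rw [tendsto_iff_norm_sub_tendsto_zero]
  have e : (fun i => ∫ x, ‖(k i x - k₀ x) (h x)‖ ∂ν) =ᶠ[l]
      fun i => ‖mult (k i) (ofDensity ν h) - mult k₀ (ofDensity ν h)‖ := by
    filter_upwards [hk] with i hi
    rw [← mult_sub hi hk₀, mult_ofDensity (hi.sub hk₀) hh,
      norm_ofDensity ((hi.sub hk₀).integrable hh)]
  refine Tendsto.congr' e ?_
  have h0 : ∫ x, ‖(0 : CSpace m →L[ℂ] CSpace m) (h x)‖ ∂ν = 0 := by simp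
  rw [← h0]
  refine tendsto_integral_filter_of_dominated_convergence (fun x => (C + D) * ‖h x‖) ?_ ?_
    (hh.norm.const_mul _) (Eventually.of_forall fun x => ?_)
  · filter_upwards [hk] with i hi
    exact ((hi.sub hk₀).integrable hh).1.norm
  · filter_upwards [hC] with i hi
    refine Eventually.of_forall fun x => ?_
    rw [norm_norm]
    exact (k i x - k₀ x).le_of_opNorm_le ((norm_sub_le _ _).trans (add_le_add (hi x) (hD x))) _
  · have h1 : Tendsto (fun i => k i x - k₀ x) l (𝓝 0) := by
      simpa using (hlim x).sub_const (k₀ x)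
    have h2 : Continuous fun L : CSpace m →L[ℂ] CSpace m => ‖L (h x)‖ := by fun_prop
    exact (h2.tendsto _).comp h1

/-- A multiplier whose symbol is differentiable in a parameter, with a bounded derivative, is
strongly differentiable. -/
lemma hasDerivAt_mult {k k' : ℝ → RSpace n → CSpace m →L[ℂ] CSpace m} {τ₀ : ℝ} {s : Set ℝ}
    (hs : s ∈ 𝓝 τ₀) (hconv : Convex ℝ s) (hk : ∀ τ ∈ s, IsSymbol (k τ)) (hk' : IsSymbol (k' τ₀))
    (hd : ∀ x, ∀ τ ∈ s, HasDerivAt (fun τ => k τ x) (k' τ x) τ) {C : ℝ}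
    (hC : ∀ τ ∈ s, ∀ x, ‖k' τ x‖ ≤ C) (u : FM n m) :
    HasDerivAt (fun τ => mult (k τ) u) (mult (k' τ₀) u) τ₀ := by
  have hτ₀ : τ₀ ∈ s := mem_of_mem_nhds hs
  have hs' : ∀ᶠ τ in 𝓝[≠] τ₀, τ ∈ s := mem_nhdsWithin_of_mem_nhds hs
  rw [hasDerivAt_iff_tendsto_slope]
  have hsym : ∀ τ ∈ s, IsSymbol fun x => ((τ - τ₀ : ℝ) : ℂ)⁻¹ • (k τ x - k τ₀ x) := fun τ hτ =>
    ((hk τ hτ).sub (hk τ₀ hτ₀)).const_smul _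
  have hslope : ∀ x τ, slope (fun τ => k τ x) τ₀ τ =
      ((τ - τ₀ : ℝ) : ℂ)⁻¹ • (k τ x - k τ₀ x) := fun x τ => by
    rw [slope_def_module, ← Complex.ofReal_inv]
    ext v i
    simp
  have e : (fun τ => mult (fun x => ((τ - τ₀ : ℝ) : ℂ)⁻¹ • (k τ x - k τ₀ x)) u) =ᶠ[𝓝[≠] τ₀]
      slope (fun τ => mult (k τ) u) τ₀ := by
    filter_upwards [hs'] with τ hτ
    rw [mult_const_smul ((hk τ hτ).sub (hk τ₀ hτ₀)), mult_sub (hk τ hτ) (hk τ₀ hτ₀),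
      slope_def_module, ← Complex.ofReal_inv, Complex.coe_smul]
  refine Tendsto.congr' e (tendsto_mult (C := C) (hs'.mono hsym) hk' ?_ (fun x => ?_) u)
  · filter_upwards [hs'] with τ hτ x
    rw [norm_smul, norm_inv, Complex.norm_real]
    have := hconv.norm_image_sub_le_of_norm_hasDerivWithin_le
      (fun t ht => (hd x t ht).hasDerivWithinAt) (fun t ht => hC t ht x) hτ₀ hτ
    refine inv_mul_le_of_le_mul₀ (norm_nonneg _) ((norm_nonneg _).trans (hC τ₀ hτ₀ x)) ?_
    rwa [mul_comm]
  · have := hasDerivAt_iff_tendsto_slope.1 (hd x τ₀ hτ₀)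
    exact this.congr fun τ => hslope x τ

/-- An `L¹` bound in time for a family of multipliers, by Tonelli's theorem: only the time integral of
the symbol has to be bounded uniformly in the frequency. This is where `FM`, which consists of
measures, allows maximal regularity in `L¹`. -/
lemma lintegral_enorm_mult_le {T : ℝ} {k : ℝ → RSpace n → CSpace m →L[ℂ] CSpace m}
    {b : ℝ → RSpace n → ℝ≥0∞} (hk : ∀ τ ∈ Ioo 0 T, IsSymbol (k τ))
    (hb : Measurable (Function.uncurry b)) (hkb : ∀ τ ∈ Ioo 0 T, ∀ x, ‖k τ x‖ₑ ≤ b τ x) {K : ℝ≥0∞}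
    (hK : ∀ x, ∫⁻ τ in Ioo 0 T, b τ x ≤ K) (u : FM n m) :
    ∫⁻ τ in Ioo 0 T, ‖mult (k τ) u‖ₑ ≤ K * ‖u‖ₑ := by
  obtain ⟨ν, h, hν, hh, rfl⟩ := exists_ofDensity_eq u
  have hen : ∀ {g : RSpace n → CSpace m}, Integrable g ν → ‖ofDensity ν g‖ₑ = ∫⁻ x, ‖g x‖ₑ ∂ν :=
    fun {g} hg => by
      rw [← ofReal_norm, norm_ofDensity hg, ofReal_integral_norm_eq_lintegral_enorm hg]
  calc ∫⁻ τ in Ioo 0 T, ‖mult (k τ) (ofDensity ν h)‖ₑ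
      ≤ ∫⁻ τ in Ioo 0 T, ∫⁻ x, b τ x * ‖h x‖ₑ ∂ν := by
        refine setLIntegral_mono' measurableSet_Ioo fun τ hτ => ?_
        rw [mult_ofDensity (hk τ hτ) hh, hen ((hk τ hτ).integrable hh)]
        refine lintegral_mono fun x => ((k τ x).le_opENorm (h x)).trans ?_
        gcongr
        exact hkb τ hτ x
    _ = ∫⁻ x, (∫⁻ τ in Ioo 0 T, b τ x) * ‖h x‖ₑ ∂ν := by
        rw [lintegral_lintegral_swap]
        · refine lintegral_congr fun x => ?_
          have hm : Measurable fun τ => b τ x :=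
            hb.comp (by fun_prop : Measurable fun τ : ℝ => (τ, x))
          rw [lintegral_mul_const _ hm]
        · exact hb.aemeasurable.mul hh.1.enorm.comp_snd
    _ ≤ ∫⁻ x, K * ‖h x‖ₑ ∂ν := lintegral_mono fun x => by gcongr; exact hK x
    _ = K * ‖ofDensity ν h‖ₑ := by rw [lintegral_const_mul'' _ hh.1.enorm, hen hh]

end FM
end families

/-! ### Exponentials and the parabolic smoothing estimate -/

section exponential
variable {𝔸 : Type*} [NormedRing 𝔸] [NormedAlgebra ℂ 𝔸]

lemma norm_exp_le_exp_norm (h1 : ‖(1 : 𝔸)‖ ≤ 1) (y : 𝔸) : ‖NormedSpace.exp y‖ ≤ Real.exp ‖y‖ := by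
  have hy : ∀ k : ℕ, ‖y ^ k‖ ≤ ‖y‖ ^ k := fun k => by
    rcases Nat.eq_zero_or_pos k with rfl | hk
    · simpa using h1
    · exact norm_pow_le' y hk
  have hs : HasSum (fun k : ℕ => ((k.factorial : ℝ)⁻¹) • ‖y‖ ^ k) (Real.exp ‖y‖) := by
    rw [Real.exp_eq_exp_ℝ]
    exact NormedSpace.exp_series_hasSum_exp' ‖y‖
  rw [NormedSpace.exp_eq_tsum ℂ]
  refine tsum_of_norm_bounded hs fun k => ?_
  rw [norm_smul, norm_inv, smul_eq_mul, Complex.norm_natCast]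
  exact mul_le_mul_of_nonneg_left (hy k) (by positivity)

lemma continuous_exp [CompleteSpace 𝔸] : Continuous (NormedSpace.exp : 𝔸 → 𝔸) :=
  letI : NormedAlgebra ℚ 𝔸 := NormedAlgebra.restrictScalars ℚ ℂ 𝔸
  NormedSpace.exp_continuous

lemma exp_zero_smul_mul (b P : 𝔸) : NormedSpace.exp ((-((0 : ℝ) : ℂ)) • b) * P = P := by
  simp

/-- The scalar part of an exponent splits off as a factor. -/
lemma exp_smul_smul_one_add [CompleteSpace 𝔸] (z σ : ℂ) (B : 𝔸) :
    NormedSpace.exp (z • (σ • (1 : 𝔸) + B)) = Complex.exp (z * σ) • NormedSpace.exp (z • B) := by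
  have h : z • (σ • (1 : 𝔸) + B) = algebraMap ℂ 𝔸 (z * σ) + z • B := by
    rw [smul_add, smul_smul, Algebra.algebraMap_eq_smul_one]
  let _ : NormedAlgebra ℚ 𝔸 := NormedAlgebra.restrictScalars ℚ ℂ 𝔸
  rw [h, NormedSpace.exp_add_of_commute (Algebra.commutes (z * σ) (z • B)),
    ← NormedSpace.algebraMap_exp_comm, ← Complex.exp_eq_exp_ℂ, ← Algebra.smul_def]

lemma hasDerivAt_exp_neg_smul_mul [CompleteSpace 𝔸] (b P : 𝔸) (τ : ℝ) :
    HasDerivAt (fun τ : ℝ => NormedSpace.exp ((-(τ : ℂ)) • b) * P)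
      (-(b * (NormedSpace.exp ((-(τ : ℂ)) • b) * P))) τ := by
  have h1 := hasDerivAt_exp_smul_const' (𝕂 := ℂ) b (-(τ : ℂ))
  have h2 : HasDerivAt (fun τ : ℝ => -(τ : ℂ)) (-1) τ := by
    simpa using! (Complex.ofRealCLM.hasDerivAt (x := τ)).neg
  have h3 := h1.scomp τ h2
  have h4 := h3.mul_const P
  rw [neg_one_smul, neg_mul, mul_assoc] at h4
  exact h4

end exponential

section kernel

lemma pow_mul_exp_neg_le {c τ r : ℝ} (hc : 0 < c) (hτ : 0 < τ) :
    (1 + r ^ 4) * Real.exp (-(c * τ * r ^ 4)) ≤ 1 + (c * τ)⁻¹ := by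
  have hr : 0 ≤ r ^ 4 := by positivity
  have h1 : Real.exp (-(c * τ * r ^ 4)) ≤ 1 := Real.exp_le_one_iff.2 (by
    rw [neg_nonpos]; positivity)
  have h2 : c * τ * r ^ 4 * Real.exp (-(c * τ * r ^ 4)) ≤ 1 := by
    rw [Real.exp_neg, ← div_eq_mul_inv, div_le_one (Real.exp_pos _)]
    linarith [Real.add_one_le_exp (c * τ * r ^ 4)]
  have h3 : r ^ 4 * Real.exp (-(c * τ * r ^ 4)) ≤ (c * τ)⁻¹ := by
    rw [← one_div, le_div_iff₀ (by positivity)]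
    linarith
  linarith

/-- The parabolic smoothing estimate `∫₀ᵀ |x|⁴ exp(-cτ|x|⁴) dτ ≤ 1/c`, with a lower order term. -/
lemma lintegral_pow_mul_exp_neg_le {c T : ℝ} (hc : 0 < c) (hT : 0 < T) (r : ℝ) :
    ∫⁻ τ in Ioo 0 T, ENNReal.ofReal ((1 + r ^ 4) * Real.exp (-(c * τ * r ^ 4))) ≤
      ENNReal.ofReal (T + c⁻¹) := by
  have hcont : Continuous fun τ : ℝ => (1 + r ^ 4) * Real.exp (-(c * τ * r ^ 4)) := by fun_prop
  have hnn : ∀ τ : ℝ, 0 ≤ (1 + r ^ 4) * Real.exp (-(c * τ * r ^ 4)) := fun τ => by positivity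
  have hi : IntegrableOn (fun τ : ℝ => (1 + r ^ 4) * Real.exp (-(c * τ * r ^ 4))) (Ioo 0 T) :=
    (hcont.integrableOn_Icc).mono_set Ioo_subset_Icc_self
  rw [← ofReal_integral_eq_lintegral_ofReal hi (Eventually.of_forall hnn)]
  refine ENNReal.ofReal_le_ofReal ?_
  have hd : ∀ τ : ℝ, HasDerivAt (fun τ : ℝ => τ - c⁻¹ * Real.exp (-(c * τ * r ^ 4)))
      (1 + r ^ 4 * Real.exp (-(c * τ * r ^ 4))) τ := fun τ => by
    have h1 : HasDerivAt (fun τ : ℝ => -(c * τ * r ^ 4)) (-(c * r ^ 4)) τ := by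
      simpa using! (((hasDerivAt_id τ).const_mul c).mul_const (r ^ 4)).neg
    have h2 := (hasDerivAt_id τ).sub ((h1.exp).const_mul c⁻¹)
    refine h2.congr_deriv ?_
    field_simp
    ring
  have hcont' : Continuous fun τ : ℝ => 1 + r ^ 4 * Real.exp (-(c * τ * r ^ 4)) := by fun_prop
  calc ∫ τ in Ioo 0 T, (1 + r ^ 4) * Real.exp (-(c * τ * r ^ 4))
      ≤ ∫ τ in Ioo 0 T, (1 + r ^ 4 * Real.exp (-(c * τ * r ^ 4))) := by
        refine setIntegral_mono_on hi
          ((hcont'.integrableOn_Icc).mono_set Ioo_subset_Icc_self) measurableSet_Ioo fun τ hτ => ?_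
        have : Real.exp (-(c * τ * r ^ 4)) ≤ 1 := Real.exp_le_one_iff.2 (by
          have := hτ.1
          rw [neg_nonpos]; positivity)
        linarith
    _ = (T - c⁻¹ * Real.exp (-(c * T * r ^ 4))) - (0 - c⁻¹ * Real.exp (-(c * 0 * r ^ 4))) := by
        rw [← integral_Ioc_eq_integral_Ioo, ← intervalIntegral.integral_of_le hT.le]
        exact intervalIntegral.integral_eq_sub_of_hasDerivAt (fun τ _ => hd τ)
          (hcont'.intervalIntegrable _ _)
    _ ≤ T + c⁻¹ := by
        have : 0 ≤ c⁻¹ * Real.exp (-(c * T * r ^ 4)) := by positivity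
        simp only [mul_zero, zero_mul, neg_zero, Real.exp_zero, mul_one]
        linarith

end kernel

/-! ### The semigroup on solenoidal fields -/

section parabolic
variable {n : ℕ}

/-- The hypotheses on the symbol `σ + B` of a fourth order parabolic operator acting on solenoidal
fields: a scalar principal part `σ` and a bounded matrix part `B` on the range of the Helmholtz
projection. -/
structure IsParabolic (σ : RSpace n → ℂ) (B : RSpace n → CSpace n →L[ℂ] CSpace n) : Prop where
  measurable : Measurable σ
  growth : ∃ C, ∀ x, ‖σ x‖ ≤ C * (1 + ‖x‖ ^ 4)
  coercive : ∃ c > 0, ∃ D, ∀ x, c * ‖x‖ ^ 4 - D ≤ (σ x).re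
  isSymbol : IsSymbol B
  helmholtz_mul : ∀ x, helmholtzSymbol x * B x = B x
  mul_helmholtz : ∀ x, B x * helmholtzSymbol x = B x

/-- The symbol `σ + B`. -/
def generatorSymbol (σ : RSpace n → ℂ) (B : RSpace n → CSpace n →L[ℂ] CSpace n) (x : RSpace n) :
    CSpace n →L[ℂ] CSpace n := σ x • 1 + B x

/-- The symbol `exp(-τ(σ + B))` of the semigroup, preceded by the Helmholtz projection. -/
def semigroupSymbol (σ : RSpace n → ℂ) (B : RSpace n → CSpace n →L[ℂ] CSpace n) (τ : ℝ)
    (x : RSpace n) : CSpace n →L[ℂ] CSpace n :=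
  NormedSpace.exp ((-(τ : ℂ)) • generatorSymbol σ B x) * helmholtzSymbol x

/-- The symbol of `1 + Δ²` applied to the semigroup; it is bounded for each `τ > 0`, but blows up like
`1/τ` as `τ → 0`. -/
def smoothedSymbol (σ : RSpace n → ℂ) (B : RSpace n → CSpace n →L[ℂ] CSpace n) (τ : ℝ)
    (x : RSpace n) : CSpace n →L[ℂ] CSpace n :=
  ((1 + ‖x‖ ^ 4 : ℝ) : ℂ) • semigroupSymbol σ B τ x

/-- The generator composed with `(1 + Δ²)⁻¹`, which is a bounded operator. -/
def smoothedGenerator (σ : RSpace n → ℂ) (B : RSpace n → CSpace n →L[ℂ] CSpace n) :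
    FM n n →L[ℂ] FM n n := FM.mult fun x => decay x • generatorSymbol σ B x

namespace IsParabolic
variable {σ : RSpace n → ℂ} {B : RSpace n → CSpace n →L[ℂ] CSpace n}

lemma stronglyMeasurable_generatorSymbol (hp : IsParabolic σ B) :
    StronglyMeasurable (generatorSymbol σ B) :=
  (hp.measurable.stronglyMeasurable.smul_const _).add hp.isSymbol.1

lemma stronglyMeasurable_semigroupSymbol (hp : IsParabolic σ B) (τ : ℝ) :
    StronglyMeasurable (semigroupSymbol σ B τ) :=
  ((continuous_exp (𝔸 := CSpace n →L[ℂ] CSpace n)).comp_stronglyMeasurable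
    (hp.stronglyMeasurable_generatorSymbol.const_smul (-(τ : ℂ)))).mul
    isSymbol_helmholtzSymbol.1

lemma isSymbol_decay_smul_generatorSymbol (hp : IsParabolic σ B) :
    IsSymbol fun x => decay x • generatorSymbol σ B x := by
  obtain ⟨C, hC⟩ := hp.growth
  have h1 := isSymbol_smul_decay (m := n) hp.measurable hC
  have h2 := (isSymbol_decay (m := n)).mul hp.isSymbol
  have e : (fun x => decay x • generatorSymbol σ B x) = fun x =>
      (σ x * decay x) • (1 : CSpace n →L[ℂ] CSpace n) + decay x • (1 : CSpace n →L[ℂ] CSpace n) * B x :=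
    funext fun x => by
      rw [generatorSymbol, smul_add, smul_smul, mul_comm, smul_one_mul]
  rw [e]
  exact h1.add h2

lemma commute_exp_helmholtzSymbol (hp : IsParabolic σ B) (τ : ℝ) (x : RSpace n) :
    Commute (NormedSpace.exp ((-(τ : ℂ)) • generatorSymbol σ B x)) (helmholtzSymbol x) := by
  refine Commute.exp_left (Commute.smul_left ?_ _)
  refine Commute.add_left ((Commute.one_left _).smul_left _) ?_
  rw [Commute, SemiconjBy, hp.mul_helmholtz, hp.helmholtz_mul]

lemma helmholtzSymbol_mul_smoothedSymbol (hp : IsParabolic σ B) (τ : ℝ) (x : RSpace n) :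
    helmholtzSymbol x * smoothedSymbol σ B τ x = smoothedSymbol σ B τ x := by
  rw [smoothedSymbol, semigroupSymbol, mul_smul_comm,
    ← mul_assoc, ← (hp.commute_exp_helmholtzSymbol τ x).eq, mul_assoc, helmholtzSymbol_mul_self]

/-- Coercivity of the scalar part gives Gaussian-type decay in the frequency. -/
lemma exists_norm_semigroupSymbol_le (hp : IsParabolic σ B) :
    ∃ c > 0, ∃ D ≥ 0, ∃ E ≥ 0, ∀ τ : ℝ, 0 ≤ τ → ∀ x,
      ‖semigroupSymbol σ B τ x‖ ≤ E * Real.exp (D * τ) * Real.exp (-(c * τ * ‖x‖ ^ 4)) := by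
  obtain ⟨c, hc, D, hD⟩ := hp.coercive
  obtain ⟨CB, hCB⟩ := hp.isSymbol.bounded
  obtain ⟨E, hE⟩ := (isSymbol_helmholtzSymbol (n := n)).bounded
  refine ⟨c, hc, |D| + CB, add_nonneg (abs_nonneg _) ((norm_nonneg _).trans (hCB 0)), E,
    (norm_nonneg _).trans (hE 0), fun τ hτ x => ?_⟩
  have h1 : ‖(1 : CSpace n →L[ℂ] CSpace n)‖ ≤ 1 := ContinuousLinearMap.norm_id_le
  have h2 : ‖NormedSpace.exp ((-(τ : ℂ)) • generatorSymbol σ B x)‖ ≤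
      Real.exp (-(τ * (σ x).re)) * Real.exp (τ * CB) := by
    rw [generatorSymbol, exp_smul_smul_one_add, norm_smul, Complex.norm_exp]
    refine mul_le_mul (le_of_eq (by simp)) ((norm_exp_le_exp_norm h1 _).trans ?_)
      (norm_nonneg _) (Real.exp_pos _).le
    rw [Real.exp_le_exp, norm_smul, norm_neg, Complex.norm_real, Real.norm_of_nonneg hτ]
    exact mul_le_mul_of_nonneg_left (hCB x) hτ
  refine (norm_mul_le _ _).trans ((mul_le_mul h2 (hE x) (norm_nonneg _) (by positivity)).trans ?_)
  rw [mul_comm _ E, mul_assoc E, ← Real.exp_add, ← Real.exp_add]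
  refine mul_le_mul_of_nonneg_left (Real.exp_le_exp.2 ?_) ((norm_nonneg _).trans (hE 0))
  nlinarith [mul_le_mul_of_nonneg_left (hD x) hτ, mul_le_mul_of_nonneg_left (le_abs_self D) hτ]

lemma norm_smoothedSymbol (τ : ℝ) (x : RSpace n) :
    ‖smoothedSymbol σ B τ x‖ = (1 + ‖x‖ ^ 4) * ‖semigroupSymbol σ B τ x‖ := by
  rw [smoothedSymbol, norm_smul, Complex.norm_real, Real.norm_of_nonneg (by positivity)]

lemma decay_smul_smoothedSymbol (τ : ℝ) (x : RSpace n) :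
    decay x • smoothedSymbol σ B τ x = semigroupSymbol σ B τ x := by
  rw [smoothedSymbol, smul_smul, decay, inv_mul_cancel₀ (one_add_pow_ne_zero x), one_smul]

/-- On a compact subinterval of `(0,∞)` the smoothed semigroup is uniformly bounded. -/
lemma exists_norm_smoothedSymbol_le (hp : IsParabolic σ B) {τ₀ : ℝ} (hτ₀ : 0 < τ₀) :
    ∃ C, ∀ τ ∈ Ioo (τ₀ / 2) (2 * τ₀), ∀ x, ‖smoothedSymbol σ B τ x‖ ≤ C := by
  obtain ⟨c, hc, D, hD, E, hE, hb⟩ := hp.exists_norm_semigroupSymbol_le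
  refine ⟨E * Real.exp (D * (2 * τ₀)) * (1 + (c * (τ₀ / 2))⁻¹), fun τ hτ x => ?_⟩
  have hτ0 : 0 < τ := (half_pos hτ₀).trans hτ.1
  rw [norm_smoothedSymbol]
  calc (1 + ‖x‖ ^ 4) * ‖semigroupSymbol σ B τ x‖
      ≤ (1 + ‖x‖ ^ 4) * (E * Real.exp (D * τ) * Real.exp (-(c * τ * ‖x‖ ^ 4))) :=
        mul_le_mul_of_nonneg_left (hb τ hτ0.le x) (by positivity)
    _ = E * Real.exp (D * τ) * ((1 + ‖x‖ ^ 4) * Real.exp (-(c * τ * ‖x‖ ^ 4))) := by ring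
    _ ≤ E * Real.exp (D * (2 * τ₀)) * (1 + (c * (τ₀ / 2))⁻¹) := by
        refine mul_le_mul ?_ ((pow_mul_exp_neg_le hc hτ0).trans ?_) (by positivity) (by positivity)
        · refine mul_le_mul_of_nonneg_left (Real.exp_le_exp.2 ?_) hE
          exact mul_le_mul_of_nonneg_left hτ.2.le hD
        · gcongr
          exact hτ.1.le

lemma isSymbol_smoothedSymbol (hp : IsParabolic σ B) {τ : ℝ} (hτ : 0 < τ) :
    IsSymbol (smoothedSymbol σ B τ) := by
  obtain ⟨C, hC⟩ := hp.exists_norm_smoothedSymbol_le hτ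
  refine ⟨StronglyMeasurable.smul (f := fun x : RSpace n => ((1 + ‖x‖ ^ 4 : ℝ) : ℂ)) ?_
    (hp.stronglyMeasurable_semigroupSymbol τ), C, hC τ ⟨by linarith, by linarith⟩⟩
  exact Continuous.stronglyMeasurable (by fun_prop)

lemma isSymbol_semigroupSymbol (hp : IsParabolic σ B) {τ : ℝ} (hτ : 0 ≤ τ) :
    IsSymbol (semigroupSymbol σ B τ) := by
  obtain ⟨c, hc, D, hD, E, hE, hb⟩ := hp.exists_norm_semigroupSymbol_le
  refine ⟨hp.stronglyMeasurable_semigroupSymbol τ, E * Real.exp (D * τ), fun x => ?_⟩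
  refine (hb τ hτ x).trans (mul_le_of_le_one_right (by positivity) (Real.exp_le_one_iff.2 ?_))
  rw [neg_nonpos]
  positivity

lemma hasDerivAt_semigroupSymbol (τ : ℝ) (x : RSpace n) :
    HasDerivAt (fun τ => semigroupSymbol σ B τ x)
      (-(generatorSymbol σ B x * semigroupSymbol σ B τ x)) τ :=
  hasDerivAt_exp_neg_smul_mul (generatorSymbol σ B x) (helmholtzSymbol x) τ

lemma continuous_semigroupSymbol (x : RSpace n) : Continuous fun τ => semigroupSymbol σ B τ x :=
  continuous_iff_continuousAt.2 fun τ => (hasDerivAt_semigroupSymbol τ x).continuousAt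

lemma continuousOn_mult_smoothedSymbol (hp : IsParabolic σ B) (g : FM n n) :
    ContinuousOn (fun τ => FM.mult (smoothedSymbol σ B τ) g) (Ioi 0) := by
  refine fun τ₀ hτ₀ => ContinuousAt.continuousWithinAt ?_
  have hτ₀' : (0 : ℝ) < τ₀ := hτ₀
  obtain ⟨C, hC⟩ := hp.exists_norm_smoothedSymbol_le hτ₀'
  have hs : Ioo (τ₀ / 2) (2 * τ₀) ∈ 𝓝 τ₀ := Ioo_mem_nhds (by linarith) (by linarith)
  refine FM.tendsto_mult (C := C) ?_
    (hp.isSymbol_smoothedSymbol hτ₀') ?_ (fun x => ?_) g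
  · filter_upwards [lt_mem_nhds hτ₀'] with τ hτ using hp.isSymbol_smoothedSymbol hτ
  · filter_upwards [hs] with τ hτ using hC τ hτ
  · exact (((continuous_semigroupSymbol (σ := σ) (B := B) x).tendsto τ₀).const_smul
      ((1 + ‖x‖ ^ 4 : ℝ) : ℂ))

/-- The semigroup solves the evolution equation, in integrated form. -/
lemma smoothedGenerator_integral (hp : IsParabolic σ B) (g : FM n n) {t : ℝ} (ht : 0 < t)
    (hi : IntegrableOn (fun τ => FM.mult (smoothedSymbol σ B τ) g) (Ioc 0 t)) :
    smoothedGenerator σ B (∫ τ in Ioc 0 t, FM.mult (smoothedSymbol σ B τ) g) =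
      helmholtz g - smoothing (FM.mult (smoothedSymbol σ B t) g) := by
  have hgen : ∀ τ, 0 < τ → smoothedGenerator σ B (FM.mult (smoothedSymbol σ B τ) g) =
      FM.mult (fun x => generatorSymbol σ B x * semigroupSymbol σ B τ x) g ∧
      IsSymbol (fun x => generatorSymbol σ B x * semigroupSymbol σ B τ x) := fun τ hτ => by
    have e : (fun x => decay x • generatorSymbol σ B x * smoothedSymbol σ B τ x) =
        fun x => generatorSymbol σ B x * semigroupSymbol σ B τ x := funext fun x => by
      rw [← decay_smul_smoothedSymbol, smul_mul_assoc, mul_smul_comm]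
    have hm := hp.isSymbol_decay_smul_generatorSymbol.mul (hp.isSymbol_smoothedSymbol hτ)
    rw [e] at hm
    rw [smoothedGenerator, FM.mult_mult hp.isSymbol_decay_smul_generatorSymbol
      (hp.isSymbol_smoothedSymbol hτ), e]
    exact ⟨rfl, hm⟩
  have hderiv : ∀ τ ∈ Ioo 0 t, HasDerivAt (fun τ => FM.mult (semigroupSymbol σ B τ) g)
      (-smoothedGenerator σ B (FM.mult (smoothedSymbol σ B τ) g)) τ := fun τ₀ hτ₀ => by
    obtain ⟨C, hC⟩ := hp.exists_norm_smoothedSymbol_le hτ₀.1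
    obtain ⟨D, hD⟩ := hp.isSymbol_decay_smul_generatorSymbol.bounded
    rw [(hgen τ₀ hτ₀.1).1, ← neg_one_smul ℂ, ← FM.mult_const_smul (hgen τ₀ hτ₀.1).2]
    have hpos : ∀ τ ∈ Ioo (τ₀ / 2) (2 * τ₀), 0 < τ := fun τ hτ => (half_pos hτ₀.1).trans hτ.1
    refine FM.hasDerivAt_mult
      (k' := fun τ x => (-1 : ℂ) • (generatorSymbol σ B x * semigroupSymbol σ B τ x))
      (C := D * C) (Ioo_mem_nhds (by linarith [hτ₀.1]) (by linarith [hτ₀.1]))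
      (convex_Ioo _ _) (fun τ hτ => hp.isSymbol_semigroupSymbol (hpos τ hτ).le)
      ((hgen τ₀ hτ₀.1).2.const_smul _) (fun x τ _ => ?_) (fun τ hτ x => ?_) g
    · rw [neg_one_smul ℂ (generatorSymbol σ B x * semigroupSymbol σ B τ x)]
      exact hasDerivAt_semigroupSymbol τ x
    · rw [neg_one_smul ℂ (generatorSymbol σ B x * semigroupSymbol σ B τ x), norm_neg, ← decay_smul_smoothedSymbol, mul_smul_comm, ← smul_mul_assoc]
      exact (norm_mul_le _ _).trans
        (mul_le_mul (hD x) (hC τ hτ x) (norm_nonneg _) ((norm_nonneg _).trans (hD x)))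
  have hcont : ContinuousOn (fun τ => FM.mult (semigroupSymbol σ B τ) g) (Icc 0 t) := by
    obtain ⟨c, hc, D, hD, E, hE, hb⟩ := hp.exists_norm_semigroupSymbol_le
    intro τ₀ hτ₀
    refine FM.tendsto_mult (C := E * Real.exp (D * t)) ?_ (hp.isSymbol_semigroupSymbol hτ₀.1) ?_
      (fun x => ((continuous_semigroupSymbol x).tendsto τ₀).mono_left nhdsWithin_le_nhds) g
    · filter_upwards [self_mem_nhdsWithin] with τ hτ using hp.isSymbol_semigroupSymbol hτ.1
    · filter_upwards [self_mem_nhdsWithin] with τ hτ x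
      have hx : 0 ≤ c * τ * ‖x‖ ^ 4 := mul_nonneg (mul_nonneg hc.le hτ.1) (by positivity)
      refine (hb τ hτ.1 x).trans ((mul_le_of_le_one_right (by positivity)
        (Real.exp_le_one_iff.2 (neg_nonpos.2 hx))).trans ?_)
      exact mul_le_mul_of_nonneg_left
        (Real.exp_le_exp.2 (mul_le_mul_of_nonneg_left hτ.2 hD)) hE
  have hii : IntervalIntegrable
      (fun τ => -smoothedGenerator σ B (FM.mult (smoothedSymbol σ B τ) g)) volume 0 t :=
    (intervalIntegrable_iff_integrableOn_Ioc_of_le ht.le).2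
      ((smoothedGenerator σ B).integrable_comp hi).neg
  have hftc := intervalIntegral.integral_eq_sub_of_hasDerivAt_of_le ht.le hcont hderiv hii
  rw [intervalIntegral.integral_neg, intervalIntegral.integral_of_le ht.le,
    ContinuousLinearMap.integral_comp_comm _ hi] at hftc
  have h0 : FM.mult (semigroupSymbol σ B 0) g = helmholtz g := by
    have : semigroupSymbol σ B 0 = helmholtzSymbol := funext fun x =>
      exp_zero_smul_mul _ _
    rw [this, helmholtz]
  have h1 : smoothing (FM.mult (smoothedSymbol σ B t) g) = FM.mult (semigroupSymbol σ B t) g := by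
    rw [smoothing, FM.mult_mult isSymbol_decay (hp.isSymbol_smoothedSymbol ht)]
    congr 2
    funext x
    rw [smul_one_mul, decay_smul_smoothedSymbol]
  rw [h1, ← h0, ← neg_sub, ← hftc, neg_neg]

/-- The evolution equation with generator `σ + B` on solenoidal fields has maximal regularity in
`L¹(0,T)`: the function `w` is `(1 + Δ²)u` for the solution `u`. -/
lemma exists_solution (hp : IsParabolic σ B) {T : ℝ} (hT : 0 < T) :
    ∃ K : ℝ≥0, ∀ f : ℝ → FM n n, IntegrableOn f (Ioo 0 T) → ∀ y : FM n n,
      ∃ w : ℝ → FM n n, IntegrableOn w (Ioo 0 T) ∧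
        ∫ t in Ioo 0 T, ‖w t‖ ≤ K * ((∫ t in Ioo 0 T, ‖f t‖) + ‖y‖) ∧
        (∀ᵐ t ∂volume.restrict (Ioo 0 T), smoothing (w t) =
          helmholtz y + ∫ s in Ioc 0 t, (helmholtz (f s) - smoothedGenerator σ B (w s))) ∧
        ∀ᵐ t ∂volume.restrict (Ioo 0 T), helmholtz (w t) = w t := by
  obtain ⟨c, hc, D, hD, E, hE, hb⟩ := hp.exists_norm_semigroupSymbol_le
  have hF : 0 ≤ E * Real.exp (D * T) := by positivity
  have hK : ∀ g : FM n n, ∫⁻ τ in Ioo 0 T, ‖FM.mult (smoothedSymbol σ B τ) g‖ₑ ≤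
      ((E * Real.exp (D * T) * (T + c⁻¹)).toNNReal : ℝ≥0) * ‖g‖ₑ := fun g => by
    refine FM.lintegral_enorm_mult_le (b := fun τ x => ENNReal.ofReal (E * Real.exp (D * T)) *
      ENNReal.ofReal ((1 + ‖x‖ ^ 4) * Real.exp (-(c * τ * ‖x‖ ^ 4))))
      (fun τ hτ => hp.isSymbol_smoothedSymbol hτ.1) ?_ (fun τ hτ x => ?_) (fun x => ?_) g
    · have hcont : Continuous fun p : ℝ × RSpace n =>
          (1 + ‖p.2‖ ^ 4) * Real.exp (-(c * p.1 * ‖p.2‖ ^ 4)) := by fun_prop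
      exact hcont.measurable.ennreal_ofReal.const_mul _
    · rw [← ofReal_norm, ← ENNReal.ofReal_mul hF, norm_smoothedSymbol]
      refine ENNReal.ofReal_le_ofReal ?_
      calc (1 + ‖x‖ ^ 4) * ‖semigroupSymbol σ B τ x‖
          ≤ (1 + ‖x‖ ^ 4) * (E * Real.exp (D * T) * Real.exp (-(c * τ * ‖x‖ ^ 4))) := by
            refine mul_le_mul_of_nonneg_left ((hb τ hτ.1.le x).trans ?_) (by positivity)
            gcongr
            exact hτ.2.le
        _ = _ := by ring
    · rw [lintegral_const_mul' _ _ ENNReal.ofReal_ne_top]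
      refine (mul_le_mul_right (lintegral_pow_mul_exp_neg_le hc hT ‖x‖) _).trans (le_of_eq ?_)
      rw [← ENNReal.ofReal_mul hF]
      rfl
  refine ⟨(E * Real.exp (D * T) * (T + c⁻¹)).toNNReal, fun f hf y => ?_⟩
  have hS : ∀ g : FM n n, ∀ t ∈ Ioo 0 T,
      IntegrableOn (fun τ => FM.mult (smoothedSymbol σ B τ) g) (Ioc 0 t) := fun g t ht =>
    IntegrableOn.mono_set (t := Ioo 0 T)
      ⟨((hp.continuousOn_mult_smoothedSymbol g).mono Ioo_subset_Ioi_self).aestronglyMeasurable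
        measurableSet_Ioo, (hK g).trans_lt (ENNReal.mul_lt_top (by simp) (by simp))⟩
      fun s hs => ⟨hs.1, hs.2.trans_lt ht.2⟩
  obtain ⟨w, hw, hwb, hweq, hwB⟩ := exists_duhamel (S := fun τ => FM.mult (smoothedSymbol σ B τ))
    (P := helmholtz) (A := smoothedGenerator σ B) (R := smoothing)
    hp.continuousOn_mult_smoothedSymbol hK (fun g t ht => hp.smoothedGenerator_integral g ht.1 (hS g t ht))
    hf y
  refine ⟨w, hw, hwb, hweq, hwB helmholtz fun τ hτ g => ?_⟩
  rw [helmholtz, FM.mult_mult isSymbol_helmholtzSymbol (hp.isSymbol_smoothedSymbol hτ)]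
  simp only [hp.helmholtzSymbol_mul_smoothedSymbol]

end IsParabolic
end parabolic

/-! ### Uniqueness for the evolution equation -/

section uniqueness

/-- The homogeneous linear Volterra equation has only the trivial solution. -/
lemma ae_eq_zero_of_volterra {X : Type*} [NormedAddCommGroup X] [NormedSpace ℂ X] [CompleteSpace X]
    {T : ℝ} (hT : 0 < T) (L : X →L[ℂ] X) {z : ℝ → X} (hz : IntegrableOn z (Ioo 0 T))
    (heq : ∀ᵐ t ∂volume.restrict (Ioo 0 T), z t = -∫ s in Ioc 0 t, L (z s)) :
    ∀ᵐ t ∂volume.restrict (Ioo 0 T), z t = 0 := by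
  have hres : ∀ {t}, t ∈ Icc 0 T → volume.restrict (Ioc 0 t) ≤ volume.restrict (Ioo 0 T) :=
    fun {t} ht => by
      rw [← Measure.restrict_congr_set (Ioo_ae_eq_Ioc (a := (0 : ℝ)) (b := t))]
      exact Measure.restrict_mono_set _ (Ioo_subset_Ioo_right ht.2)
  have hZc : ContinuousOn (fun t => ∫ s in Ioc 0 t, z s) (Icc 0 T) := by
    simpa using continuousOn_add_primitive hz 0
  -- the primitive of `z`, extended continuously to the line; it solves `Z' = -LZ`, `Z(0) = 0`
  set Z : ℝ → X := IccExtend hT.le ((Icc 0 T).domRestrict fun t => ∫ s in Ioc 0 t, z s) with hZ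
  have hZcont : Continuous Z := (continuousOn_iff_continuous_domRestrict.1 hZc).Icc_extend'
  have hZeq : ∀ t ∈ Icc 0 T, Z t = ∫ s in Ioc 0 t, z s := fun t ht => by
    rw [hZ, IccExtend_of_mem _ _ ht]
    rfl
  have hzZ : ∀ᵐ t ∂volume.restrict (Ioo 0 T), z t = -L (Z t) := by
    filter_upwards [heq, ae_restrict_mem measurableSet_Ioo] with t ht hmem
    have hm := Ioo_subset_Icc_self hmem
    rw [ht, hZeq t hm, L.integral_comp_comm (Integrable.mono_measure hz (hres hm))]
  have hLZ : Continuous fun t => -L (Z t) := (L.continuous.comp hZcont).neg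
  have hW : ∀ t ∈ Icc 0 T, ∫ s in (0 : ℝ)..t, -L (Z s) = Z t := fun t ht => by
    rw [hZeq t ht, intervalIntegral.integral_of_le ht.1]
    refine integral_congr_ae ?_
    filter_upwards [hzZ.filter_mono (ae_mono (hres ht))] with s hs using hs.symm
  have hzero := eq_zero_of_abs_deriv_le_mul_abs_self_of_eq_zero_right (a := 0) (b := T)
    (f := fun t => ∫ s in (0 : ℝ)..t, -L (Z s)) (f' := fun t => -L (Z t)) (K := ‖L‖)
    (fun t _ => (hLZ.integral_hasStrictDerivAt 0 t).hasDerivAt.continuousAt.continuousWithinAt)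
    (fun t _ => (hLZ.integral_hasStrictDerivAt 0 t).hasDerivAt.hasDerivWithinAt)
    intervalIntegral.integral_same (fun t ht => by
      rw [hW t (Ico_subset_Icc_self ht), norm_neg]
      exact L.le_opNorm _)
  filter_upwards [hzZ, ae_restrict_mem measurableSet_Ioo] with t ht hmem
  have hm := Ioo_subset_Icc_self hmem
  rw [ht, ← hW t hm, hzero t hm, map_zero, neg_zero]

variable {n m : ℕ}

lemma smoothing_injective : Function.Injective (smoothing : FM n m →L[ℂ] FM n m) := by
  rw [injective_iff_map_eq_zero]
  intro u hu
  obtain ⟨ν, h, hν, hh, rfl⟩ := FM.exists_ofDensity_eq u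
  rw [smoothing_ofDensity hh, ← FM.ofDensity_zero (ν := ν)] at hu
  rw [← FM.ofDensity_zero (ν := ν)]
  refine FM.ofDensity_congr ?_
  filter_upwards [FM.ofDensity_inj (integrable_decay_smul hh) (integrable_zero _ _ _) hu] with x hx
  exact (smul_eq_zero.1 hx).resolve_left (inv_ne_zero (one_add_pow_ne_zero x))

/-- The indicator of the closed ball of radius `R`. -/
def cutoff (R : ℕ) (x : RSpace n) : ℂ := if ‖x‖ ≤ R then 1 else 0

lemma measurable_cutoff (R : ℕ) : Measurable (cutoff R : RSpace n → ℂ) :=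
  Measurable.ite (measurableSet_le measurable_norm measurable_const)
    measurable_const measurable_const

lemma isSymbol_cutoff (R : ℕ) :
    IsSymbol fun x : RSpace n => cutoff R x • (1 : CSpace m →L[ℂ] CSpace m) :=
  IsSymbol.scalar (C := 1) (measurable_cutoff R) fun x => by
    unfold cutoff
    split_ifs <;> simp

lemma isSymbol_cutoff_weight (R : ℕ) : IsSymbol fun x : RSpace n =>
    (cutoff R x * ((1 + ‖x‖ ^ 4 : ℝ) : ℂ)) • (1 : CSpace m →L[ℂ] CSpace m) := by
  refine IsSymbol.scalar (C := 1 + (R : ℝ) ^ 4) ((measurable_cutoff R).mul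
    (Continuous.measurable (by fun_prop))) fun x => ?_
  rw [norm_mul, Complex.norm_real, Real.norm_of_nonneg (by positivity)]
  unfold cutoff
  split_ifs with h
  · rw [norm_one, one_mul]
    gcongr
  · rw [norm_zero, zero_mul]
    positivity

/-- On frequencies in a bounded set the generator is bounded, so that uniqueness for the evolution
equation reduces to that for Volterra equations. -/
lemma IsParabolic.ae_eq_zero {σ : RSpace n → ℂ} {B : RSpace n → CSpace n →L[ℂ] CSpace n}
    (hp : IsParabolic σ B) {T : ℝ} (hT : 0 < T) {z : ℝ → FM n n}
    (hz : IntegrableOn (fun t => smoothedGenerator σ B (z t)) (Ioo 0 T))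
    (heq : ∀ᵐ t ∂volume.restrict (Ioo 0 T),
      smoothing (z t) = -∫ s in Ioc 0 t, smoothedGenerator σ B (z s)) :
    ∀ᵐ t ∂volume.restrict (Ioo 0 T), z t = 0 := by
  have hR : ∀ R : ℕ, ∀ᵐ t ∂volume.restrict (Ioo 0 T),
      FM.mult (fun x => cutoff R x • (1 : CSpace n →L[ℂ] CSpace n)) (z t) = 0 := fun R => by
    -- `G` is `χ(1 + Δ²)`, and `L` is the truncated generator
    let G : FM n n →L[ℂ] FM n n := FM.mult fun x => (cutoff R x * ((1 + ‖x‖ ^ 4 : ℝ) : ℂ)) • 1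
    let χ : FM n n →L[ℂ] FM n n := FM.mult fun x => cutoff R x • 1
    let L : FM n n →L[ℂ] FM n n := FM.mult fun x =>
      (cutoff R x * ((1 + ‖x‖ ^ 4 : ℝ) : ℂ)) • (1 : CSpace n →L[ℂ] CSpace n) *
        decay x • generatorSymbol σ B x
    have hgs := hp.isSymbol_decay_smul_generatorSymbol
    have hG : ∀ u, G (smoothing u) = χ u := fun u => by
      refine (FM.mult_mult (isSymbol_cutoff_weight R) isSymbol_decay u).trans ?_
      have : (fun x : RSpace n => (cutoff R x * ((1 + ‖x‖ ^ 4 : ℝ) : ℂ)) •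
          (1 : CSpace n →L[ℂ] CSpace n) * decay x • (1 : CSpace n →L[ℂ] CSpace n)) =
          fun x => cutoff R x • 1 := funext fun x => by
        rw [smul_one_mul, smul_smul, decay, mul_inv_cancel_right₀ (one_add_pow_ne_zero x)]
      rw [this]
    have hL : ∀ u, G (smoothedGenerator σ B u) = L (χ u) := fun u => by
      refine (FM.mult_mult (isSymbol_cutoff_weight R) hgs u).trans ?_
      refine Eq.trans ?_ (FM.mult_mult ((isSymbol_cutoff_weight R).mul hgs)
        (isSymbol_cutoff R) u).symm
      have : (fun x : RSpace n => (cutoff R x * ((1 + ‖x‖ ^ 4 : ℝ) : ℂ)) •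
            (1 : CSpace n →L[ℂ] CSpace n) * decay x • generatorSymbol σ B x *
              cutoff R x • (1 : CSpace n →L[ℂ] CSpace n)) =
          fun x => (cutoff R x * ((1 + ‖x‖ ^ 4 : ℝ) : ℂ)) •
            (1 : CSpace n →L[ℂ] CSpace n) * decay x • generatorSymbol σ B x := funext fun x => by
        by_cases h : ‖x‖ ≤ R
        · rw [cutoff, if_pos h, one_smul, mul_one]
        · rw [cutoff, if_neg h, zero_mul, zero_smul ℂ (1 : CSpace n →L[ℂ] CSpace n), zero_mul, zero_mul]
      rw [this]
    have hint : IntegrableOn (fun t => ∫ s in Ioc 0 t, smoothedGenerator σ B (z s)) (Ioo 0 T) := by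
      simpa using integrableOn_add_primitive hz 0
    have hχ : IntegrableOn (fun t => χ (z t)) (Ioo 0 T) := by
      refine (G.integrable_comp hint.neg).congr ?_
      filter_upwards [heq] with t ht
      rw [← hG, ht]
      rfl
    refine ae_eq_zero_of_volterra hT L hχ ?_
    filter_upwards [heq, ae_restrict_mem measurableSet_Ioo] with t ht hmem
    have hi : Integrable (fun s => smoothedGenerator σ B (z s)) (volume.restrict (Ioc 0 t)) :=
      IntegrableOn.mono_set (t := Ioo 0 T) hz fun s hs => ⟨hs.1, hs.2.trans_lt hmem.2⟩
    rw [← hG, ht, map_neg, ← G.integral_comp_comm hi]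
    simp only [hL]
    rfl
  filter_upwards [ae_all_iff.2 hR] with t ht
  exact FM.eq_zero_of_forall_mult_indicator ht

end uniqueness

/-! ### The symbol of the system -/

section system
variable {n : ℕ}

lemma FM.mult_const_apply (L : CSpace n →L[ℂ] CSpace n) (u : FM n n) (ξ : RSpace n) :
    mult (fun _ => L) u ξ = L (u ξ) := by
  obtain ⟨ν, h, hν, hh, rfl⟩ := exists_ofDensity_eq u
  have hi : Integrable
      (fun x => Complex.exp (-((inner ℝ x ξ : ℝ) : ℂ) * Complex.I) • h x) ν := by
    refine Integrable.bdd_smul hh 1 (RadonMeasure.continuous_kernel ξ).aestronglyMeasurable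
      (Eventually.of_forall fun x => ?_)
    rw [← Complex.ofReal_neg, Complex.norm_exp_ofReal_mul_I]
  rw [mult_ofDensity (IsSymbol.const L) hh, ofDensity_apply ((IsSymbol.const L).integrable hh),
    ofDensity_apply hh, L.map_smul_of_tower, ← L.integral_comp_comm hi]
  simp only [map_smul]

/-- The matrix `M` acting on `ℂⁿ`. -/
def matrixCLM (M : Matrix (Fin n) (Fin n) ℝ) : CSpace n →L[ℂ] CSpace n :=
  LinearMap.toContinuousLinearMap (Matrix.toEuclideanLin (M.map Complex.ofReal))

/-- The scalar part `-iλ₀ x·V + Γ₀|x|² + Γ₂|x|⁴` of the symbol of the system. -/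
def scalarSymbol (lam₀ Γ₀ Γ₂ : ℝ) (V x : RSpace n) : ℂ :=
  lam₀ * (-Complex.I * (inner ℝ x V : ℝ)) + Γ₀ * (‖x‖ : ℂ) ^ 2 + Γ₂ * (‖x‖ : ℂ) ^ 4

/-- The symbol of the restriction of `M` to solenoidal fields. -/
def projectedMatrix (M : Matrix (Fin n) (Fin n) ℝ) (x : RSpace n) : CSpace n →L[ℂ] CSpace n :=
  helmholtzSymbol x * matrixCLM M * helmholtzSymbol x

lemma measurable_scalarSymbol (lam₀ Γ₀ Γ₂ : ℝ) (V : RSpace n) :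
    Measurable (scalarSymbol lam₀ Γ₀ Γ₂ V) := by
  refine Continuous.measurable ?_
  unfold scalarSymbol
  fun_prop

lemma norm_scalarSymbol_le (lam₀ Γ₀ Γ₂ : ℝ) (V x : RSpace n) :
    ‖scalarSymbol lam₀ Γ₀ Γ₂ V x‖ ≤ (|lam₀| * ‖V‖ + |Γ₀| + |Γ₂|) * (1 + ‖x‖ ^ 4) := by
  have h1 : ‖(lam₀ * (-Complex.I * (inner ℝ x V : ℝ)) : ℂ)‖ ≤ |lam₀| * ‖V‖ * (1 + ‖x‖ ^ 4) := by
    simp only [norm_mul, norm_neg, Complex.norm_I, one_mul, Complex.norm_real, Real.norm_eq_abs]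
    rw [mul_assoc]
    refine mul_le_mul_of_nonneg_left ?_ (abs_nonneg _)
    refine (abs_real_inner_le_norm x V).trans ?_
    rw [mul_comm]
    refine mul_le_mul_of_nonneg_left ?_ (norm_nonneg _)
    simpa using pow_le_one_add_pow (norm_nonneg x) (k := 1) (by norm_num)
  have h2 : ‖(Γ₀ * (‖x‖ : ℂ) ^ 2 : ℂ)‖ ≤ |Γ₀| * (1 + ‖x‖ ^ 4) := by
    simp only [norm_mul, norm_pow, Complex.norm_real, Real.norm_eq_abs, abs_norm]
    exact mul_le_mul_of_nonneg_left (pow_le_one_add_pow (norm_nonneg x) (by norm_num))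
      (abs_nonneg _)
  have h3 : ‖(Γ₂ * (‖x‖ : ℂ) ^ 4 : ℂ)‖ ≤ |Γ₂| * (1 + ‖x‖ ^ 4) := by
    simp only [norm_mul, norm_pow, Complex.norm_real, Real.norm_eq_abs, abs_norm]
    exact mul_le_mul_of_nonneg_left (by simp) (abs_nonneg _)
  rw [scalarSymbol, add_mul, add_mul]
  exact (norm_add_le _ _).trans (add_le_add ((norm_add_le _ _).trans (add_le_add h1 h2)) h3)

lemma isParabolic (lam₀ Γ₀ : ℝ) {Γ₂ : ℝ} (hΓ₂ : 0 < Γ₂) (V : RSpace n)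
    (M : Matrix (Fin n) (Fin n) ℝ) :
    IsParabolic (scalarSymbol lam₀ Γ₀ Γ₂ V) (projectedMatrix M) where
  measurable := measurable_scalarSymbol lam₀ Γ₀ Γ₂ V
  growth := ⟨_, norm_scalarSymbol_le lam₀ Γ₀ Γ₂ V⟩
  coercive := by
    refine ⟨Γ₂ / 2, half_pos hΓ₂, Γ₀ ^ 2 / (2 * Γ₂), fun x => ?_⟩
    have e : (scalarSymbol lam₀ Γ₀ Γ₂ V x).re = Γ₀ * ‖x‖ ^ 2 + Γ₂ * ‖x‖ ^ 4 := by
      have : scalarSymbol lam₀ Γ₀ Γ₂ V x =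
          ((Γ₀ * ‖x‖ ^ 2 + Γ₂ * ‖x‖ ^ 4 : ℝ) : ℂ) + ((-(lam₀ * inner ℝ x V) : ℝ) : ℂ) * Complex.I := by
        rw [scalarSymbol]
        push_cast
        ring
      rw [this, Complex.add_re, Complex.ofReal_re, Complex.re_ofReal_mul, Complex.I_re, mul_zero,
        add_zero]
    -- completing the square in `|x|²`
    have h : Γ₀ * ‖x‖ ^ 2 + Γ₂ * ‖x‖ ^ 4 - (Γ₂ / 2 * ‖x‖ ^ 4 - Γ₀ ^ 2 / (2 * Γ₂)) =
        (Γ₂ * ‖x‖ ^ 2 + Γ₀) ^ 2 / (2 * Γ₂) := by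
      field_simp
      ring
    have h' : 0 ≤ (Γ₂ * ‖x‖ ^ 2 + Γ₀) ^ 2 / (2 * Γ₂) := by positivity
    rw [e]
    linarith
  isSymbol := (isSymbol_helmholtzSymbol.mul (IsSymbol.const _)).mul isSymbol_helmholtzSymbol
  helmholtz_mul x := by
    rw [projectedMatrix, ← mul_assoc, ← mul_assoc, helmholtzSymbol_mul_self]
  mul_helmholtz x := by
    rw [projectedMatrix, mul_assoc, helmholtzSymbol_mul_self]

/-- The spatial operator of the system, without the pressure, composed with `(1 + Δ²)⁻¹`. -/
def spatialOperator (lam₀ Γ₀ Γ₂ : ℝ) (V : RSpace n) (M : Matrix (Fin n) (Fin n) ℝ) :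
    FM n n →L[ℂ] FM n n :=
  smoothedGenerator (scalarSymbol lam₀ Γ₀ Γ₂ V) fun _ => matrixCLM M

variable (lam₀ Γ₀ Γ₂ : ℝ) (V : RSpace n) (M : Matrix (Fin n) (Fin n) ℝ)

lemma isSymbol_scalarSymbol :
    IsSymbol fun x => (scalarSymbol lam₀ Γ₀ Γ₂ V x * decay x) • (1 : CSpace n →L[ℂ] CSpace n) :=
  isSymbol_smul_decay (measurable_scalarSymbol lam₀ Γ₀ Γ₂ V)
    (norm_scalarSymbol_le lam₀ Γ₀ Γ₂ V)

lemma decay_smul_generatorSymbol {n : ℕ} (σ : RSpace n → ℂ)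
    (B : RSpace n → CSpace n →L[ℂ] CSpace n) :
    (fun x => decay x • generatorSymbol σ B x) = fun x =>
      (σ x * decay x) • (1 : CSpace n →L[ℂ] CSpace n) + B x * decay x • 1 := funext fun x => by
  rw [generatorSymbol, smul_add, smul_smul, mul_comm, mul_smul_one]

lemma smoothedGenerator_eq {B : RSpace n → CSpace n →L[ℂ] CSpace n} (hB : IsSymbol B)
    (w : FM n n) : smoothedGenerator (scalarSymbol lam₀ Γ₀ Γ₂ V) B w =
    FM.mult (fun x => (scalarSymbol lam₀ Γ₀ Γ₂ V x * decay x) • 1) w +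
      FM.mult B (smoothing w) := by
  rw [smoothedGenerator, decay_smul_generatorSymbol,
    FM.mult_add (isSymbol_scalarSymbol lam₀ Γ₀ Γ₂ V) (hB.mul isSymbol_decay),
    smoothing, FM.mult_mult hB isSymbol_decay]

lemma isSymbol_inner_decay : IsSymbol fun x : RSpace n =>
    ((-Complex.I * (inner ℝ x V : ℝ)) * decay x) • (1 : CSpace n →L[ℂ] CSpace n) := by
  have := isSymbol_scalarSymbol 1 0 0 V
  simpa [scalarSymbol] using this

open scoped Laplacian in
lemma spatialOperator_apply (w : FM n n) (ξ : RSpace n) :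
    spatialOperator lam₀ Γ₀ Γ₂ V M w ξ = lam₀ • fderiv ℝ (smoothing w) ξ V
      + Matrix.toEuclideanLin (M.map Complex.ofReal) (smoothing w ξ)
      - Γ₀ • Δ (⇑(smoothing w)) ξ + Γ₂ • Δ (Δ (⇑(smoothing w))) ξ := by
  have hs : (fun x : RSpace n => (scalarSymbol lam₀ Γ₀ Γ₂ V x * decay x) •
      (1 : CSpace n →L[ℂ] CSpace n)) = fun x =>
      (lam₀ : ℂ) • ((-Complex.I * (inner ℝ x V : ℝ)) * decay x) • (1 : CSpace n →L[ℂ] CSpace n)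
        - (Γ₀ : ℂ) • ((-(‖x‖ : ℂ) ^ 2) * decay x) • (1 : CSpace n →L[ℂ] CSpace n)
        + (Γ₂ : ℂ) • ((‖x‖ : ℂ) ^ 4 * decay x) • (1 : CSpace n →L[ℂ] CSpace n) := funext fun x => by
    rw [scalarSymbol]
    module
  have h1 := isSymbol_inner_decay V
  have h2 := isSymbol_sq_decay (n := n) (m := n)
  have h3 := isSymbol_pow_four_decay (n := n) (m := n)
  rw [spatialOperator, smoothedGenerator_eq _ _ _ _ (IsSymbol.const _), hs, FM.mult_add ((h1.const_smul _).sub (h2.const_smul _))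
    (h3.const_smul _), FM.mult_sub (h1.const_smul _) (h2.const_smul _), FM.mult_const_smul h1,
    FM.mult_const_smul h2, FM.mult_const_smul h3, laplacian_laplacian_smoothing,
    laplacian_smoothing, fderiv_smoothing]
  simp only [FM.coe_add, FM.coe_sub, FM.coe_smul, Pi.add_apply, Pi.sub_apply, Pi.smul_apply,
    FM.mult_const_apply]
  simp only [Complex.coe_smul]
  rw [matrixCLM, LinearMap.coe_toContinuousLinearMap']
  abel

end system

/-! ### Existence, estimates and uniqueness for the system -/

section bounds
variable {X : Type*} [NormedAddCommGroup X] [NormedSpace ℂ X] {s : Set ℝ} {f w : ℝ → X}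

lemma integral_norm_clm_le (L : X →L[ℂ] X) (hw : IntegrableOn w s) :
    ∫ t in s, ‖L (w t)‖ ≤ ‖L‖ * ∫ t in s, ‖w t‖ := by
  rw [← integral_const_mul]
  exact integral_mono (L.integrable_comp hw).norm (hw.norm.const_mul _) fun t => L.le_opNorm _

lemma integral_norm_sub_clm_le (P A : X →L[ℂ] X) (hf : IntegrableOn f s) (hw : IntegrableOn w s) :
    ∫ t in s, ‖P (f t) - A (w t)‖ ≤ ‖P‖ * (∫ t in s, ‖f t‖) + ‖A‖ * ∫ t in s, ‖w t‖ := by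
  have hP := P.integrable_comp hf
  have hA := A.integrable_comp hw
  calc ∫ t in s, ‖P (f t) - A (w t)‖ ≤ ∫ t in s, (‖P (f t)‖ + ‖A (w t)‖) :=
        integral_mono (hP.sub hA).norm (hP.norm.add hA.norm) fun t => norm_sub_le _ _
    _ = (∫ t in s, ‖P (f t)‖) + ∫ t in s, ‖A (w t)‖ := integral_add hP.norm hA.norm
    _ ≤ _ := add_le_add (integral_norm_clm_le P hf) (integral_norm_clm_le A hw)

lemma sum_le_of_bounds {a b c d s p A D G K F W y : ℝ} (h1 : a ≤ s * W) (h2 : b ≤ p * F + A * W)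
    (h3 : c ≤ D * W) (h4 : d ≤ G * W) (hW : W ≤ K * (F + y)) (h0 : 0 ≤ s + A + D + G) (hp : 0 ≤ p)
    (hF : 0 ≤ F) (hy : 0 ≤ y) : a + b + c + d ≤ ((s + A + D + G) * K + p + 1) * (F + y) := by
  have h5 := mul_le_mul_of_nonneg_left hW h0
  have h6 := mul_nonneg hp hy
  linarith

variable {n m : ℕ} {T : ℝ} {w : ℝ → FM n m}

lemma integrableOn_smoothingLift (hw : IntegrableOn w s) :
    IntegrableOn (fun t => smoothingLift (w t)) s := by
  obtain ⟨D, hD0, hD⟩ := exists_norm_smoothingLift_le n m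
  exact Integrable.mono' (hw.norm.const_mul D)
    (continuous_smoothingLift.comp_aestronglyMeasurable hw.1) (Eventually.of_forall fun t => hD _)

lemma integral_norm_smoothingLift_le {D : ℝ} (hD : ∀ w : FM n m, ‖smoothingLift w‖ ≤ D * ‖w‖)
    (hw : IntegrableOn w s) : ∫ t in s, ‖smoothingLift (w t)‖ ≤ D * ∫ t in s, ‖w t‖ := by
  rw [← integral_const_mul]
  exact integral_mono (integrableOn_smoothingLift hw).norm (hw.norm.const_mul _) fun t => hD _

end bounds

section wellPosed
variable {n : ℕ}

lemma helmholtz_smoothing (w : FM n n) : helmholtz (smoothing w) = smoothing (helmholtz w) := by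
  rw [helmholtz, smoothing, FM.mult_mult isSymbol_helmholtzSymbol isSymbol_decay,
    FM.mult_mult isSymbol_decay isSymbol_helmholtzSymbol]
  congr 2
  funext x
  rw [mul_smul_one, smul_one_mul]

lemma helmholtz_mult_gradSymbol (w : FM n n) : helmholtz (FM.mult gradSymbol w) = 0 := by
  obtain ⟨q, hq⟩ := exists_pressure w
  rw [← hq, q.helmholtz_grad]

lemma IsParabolic.helmholtz_smoothedGenerator {σ : RSpace n → ℂ}
    {B : RSpace n → CSpace n →L[ℂ] CSpace n} (hp : IsParabolic σ B) (w : FM n n) :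
    helmholtz (smoothedGenerator σ B w) = smoothedGenerator σ B (helmholtz w) := by
  have hg := hp.isSymbol_decay_smul_generatorSymbol
  rw [helmholtz, smoothedGenerator, FM.mult_mult isSymbol_helmholtzSymbol hg,
    FM.mult_mult hg isSymbol_helmholtzSymbol]
  congr 2
  funext x
  rw [generatorSymbol, mul_smul_comm, smul_mul_assoc, mul_add, add_mul, hp.helmholtz_mul,
    hp.mul_helmholtz, mul_smul_one, smul_one_mul]

variable {lam₀ Γ₀ Γ₂ : ℝ} {V : RSpace n} {M : Matrix (Fin n) (Fin n) ℝ}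

/-- On solenoidal fields the spatial operator is the generator of the evolution plus a gradient,
because `1 - x xᵀ/|x|²` is the Helmholtz projection away from the origin, where solenoidal fields
have no mass. -/
lemma spatialOperator_eq_add (hΓ₂ : 0 < Γ₂) {w : FM n n} (hw : helmholtz w = w) :
    spatialOperator lam₀ Γ₀ Γ₂ V M w =
      smoothedGenerator (scalarSymbol lam₀ Γ₀ Γ₂ V) (projectedMatrix M) w +
        FM.mult gradSymbol (FM.mult (fun _ => matrixCLM M) (smoothing w)) := by
  have hB := (isParabolic lam₀ Γ₀ hΓ₂ V M).isSymbol
  have hsw : helmholtz (smoothing w) = smoothing w := by rw [helmholtz_smoothing, hw]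
  rw [spatialOperator, smoothedGenerator_eq _ _ _ _ (IsSymbol.const _),
    smoothedGenerator_eq _ _ _ _ hB, add_assoc]
  congr 1
  have hM : IsSymbol fun _ : RSpace n => matrixCLM M := IsSymbol.const _
  have hN := isSymbol_gradSymbol (n := n)
  have hP := isSymbol_helmholtzSymbol (n := n)
  rw [← hsw, helmholtz, FM.mult_mult hM hP, FM.mult_mult hB hP, FM.mult_mult hN (hM.mul hP),
    ← FM.mult_add (hB.mul hP) (hN.mul (hM.mul hP))]
  congr 2
  funext x
  rw [projectedMatrix, mul_assoc _ (helmholtzSymbol x), helmholtzSymbol_mul_self, mul_assoc,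
    ← add_mul]
  rcases eq_or_ne x 0 with rfl | hx
  · rw [helmholtzSymbol_zero, mul_zero, mul_zero]
  · rw [helmholtzSymbol_of_ne hx, sub_add_cancel, one_mul]

lemma helmholtz_spatialOperator (hΓ₂ : 0 < Γ₂) {w : FM n n} (hw : helmholtz w = w) :
    helmholtz (spatialOperator lam₀ Γ₀ Γ₂ V M w) =
      smoothedGenerator (scalarSymbol lam₀ Γ₀ Γ₂ V) (projectedMatrix M) w := by
  rw [spatialOperator_eq_add hΓ₂ hw, map_add, helmholtz_mult_gradSymbol, add_zero,
    (isParabolic lam₀ Γ₀ hΓ₂ V M).helmholtz_smoothedGenerator, hw]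

/-- The system as an identity in `FM`. -/
lemma equation_iff {w d g f : FM n n} :
    (∀ x : RSpace n, d x + lam₀ • fderiv ℝ (smoothing w) x V
      + Matrix.toEuclideanLin (M.map Complex.ofReal) (smoothing w x)
      - Γ₀ • Laplacian.laplacian (⇑(smoothing w)) x
      + Γ₂ • Laplacian.laplacian (Laplacian.laplacian (⇑(smoothing w))) x + g x = f x) ↔
    d + spatialOperator lam₀ Γ₀ Γ₂ V M w + g = f := by
  rw [← (DFunLike.coe_injective (F := FM n n)).eq_iff, funext_iff]
  refine forall_congr' fun x => ?_
  simp only [FM.coe_add, Pi.add_apply, spatialOperator_apply]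
  rw [← add_assoc (d x), ← add_sub_assoc (d x), ← add_assoc (d x)]

/-- A pressure whose gradient balances the non-solenoidal part of `M u`, where `u = (1 + Δ²)⁻¹ w`. -/
def balancingPressure (M : Matrix (Fin n) (Fin n) ℝ) (w : FM n n) : Pressure n :=
  (exists_pressure (-FM.mult (fun _ => matrixCLM M) (smoothing w))).choose

/-- The gradient of the balancing pressure as a bounded operator. -/
def balancingGradient (M : Matrix (Fin n) (Fin n) ℝ) : FM n n →L[ℂ] FM n n :=
  -(FM.mult gradSymbol ∘L FM.mult (fun _ => matrixCLM M) ∘L smoothing)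

lemma grad_balancingPressure (w : FM n n) :
    (balancingPressure M w).grad = balancingGradient M w := by
  refine (exists_pressure (-FM.mult (fun _ => matrixCLM M) (smoothing w))).choose_spec.trans ?_
  rw [map_neg]
  rfl

/-- The solution of the evolution equation for solenoidal fields, together with the balancing
pressure, solves the system. -/
lemma isSolution_smoothingLift (hΓ₂ : 0 < Γ₂) {T : ℝ} (hT : 0 < T) {A : FM n n →L[ℂ] FM n n}
    (hA : A = smoothedGenerator (scalarSymbol lam₀ Γ₀ Γ₂ V) (projectedMatrix M))
    {f w : ℝ → FM n n} {u₀ : FM n n} (hf : IntegrableOn f (Ioo 0 T)) (hw : IntegrableOn w (Ioo 0 T))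
    (hfσ : ∀ᵐ t ∂volume.restrict (Ioo 0 T), f t ∈ FM₀σ n) (hu₀ : u₀ ∈ FM₀σ n)
    (hweq : ∀ᵐ t ∂volume.restrict (Ioo 0 T), smoothing (w t) =
      helmholtz u₀ + ∫ s in Ioc 0 t, (helmholtz (f s) - A (w s)))
    (hwP : ∀ᵐ t ∂volume.restrict (Ioo 0 T), helmholtz (w t) = w t) :
    IsSolution lam₀ Γ₀ Γ₂ V M T f u₀ (fun t => smoothingLift (w t))
      (fun t => helmholtz (f t) - A (w t)) (fun t => balancingPressure M (w t)) := by
  have hp := isParabolic lam₀ Γ₀ hΓ₂ V M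
  rw [mem_FM₀σ_iff] at hu₀
  have hu' : IntegrableOn (fun t => helmholtz (f t) - A (w t)) (Ioo 0 T) :=
    (helmholtz.integrable_comp hf).sub (A.integrable_comp hw)
  have hprim : ∀ᵐ t ∂volume.restrict (Ioo 0 T), (smoothingLift (w t)).toFM =
      u₀ + ∫ s in Ioc 0 t, (helmholtz (f s) - A (w s)) := by
    filter_upwards [hweq] with t ht
    rw [toFM_smoothingLift, ht, hu₀]
  refine ⟨hasWeakTimeDeriv_of_ae_eq hT hu' hprim, ?_, integrableOn_smoothingLift hw, ?_, ?_,
    hasInitialValue_of_ae_eq hu' hprim⟩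
  · filter_upwards [hwP] with t ht
    rw [mem_FM₀σ_iff, mem_FM₀σ_iff, toFM_smoothingLift, helmholtz_smoothing, ht, map_sub,
      helmholtz_helmholtz, hA, hp.helmholtz_smoothedGenerator, ht]
    exact ⟨rfl, rfl⟩
  · simp only [grad_balancingPressure]
    exact (balancingGradient M).integrable_comp hw
  · filter_upwards [hwP, hfσ] with t ht hft
    rw [mem_FM₀σ_iff] at hft
    refine equation_iff.2 ?_
    rw [hft, spatialOperator_eq_add hΓ₂ ht, ← hA, grad_balancingPressure]
    change f t - A (w t) + (A (w t) + FM.mult gradSymbol (FM.mult (fun _ => matrixCLM M)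
      (smoothing (w t)))) + -FM.mult gradSymbol (FM.mult (fun _ => matrixCLM M)
      (smoothing (w t))) = f t
    abel

lemma exists_isSolution (hΓ₂ : 0 < Γ₂) {T : ℝ} (hT : 0 < T) :
    ∃ C : ℝ, 0 < C ∧
      ∀ f : ℝ → FM n n, IntegrableOn f (Ioo 0 T) →
        (∀ᵐ t ∂volume.restrict (Ioo 0 T), f t ∈ FM₀σ n) →
      ∀ u₀ ∈ FM₀σ n,
      ∃ (u : ℝ → FMk n n 4) (u' : ℝ → FM n n) (q : ℝ → Pressure n),
        IsSolution lam₀ Γ₀ Γ₂ V M T f u₀ u u' q ∧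
        ((∫ t in Ioo 0 T, ‖(u t).toFM‖) + ∫ t in Ioo 0 T, ‖u' t‖)
            + (∫ t in Ioo 0 T, ‖u t‖) + (∫ t in Ioo 0 T, ‖(q t).grad‖)
          ≤ C * ((∫ t in Ioo 0 T, ‖f t‖) + ‖u₀‖) := by
  obtain ⟨A, hA⟩ : ∃ A : FM n n →L[ℂ] FM n n,
    A = smoothedGenerator (scalarSymbol lam₀ Γ₀ Γ₂ V) (projectedMatrix M) := ⟨_, rfl⟩
  obtain ⟨K, hK⟩ := (isParabolic lam₀ Γ₀ hΓ₂ V M).exists_solution hT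
  rw [← hA] at hK
  obtain ⟨D, hD0, hD⟩ := exists_norm_smoothingLift_le n n
  have hS := norm_nonneg (smoothing : FM n n →L[ℂ] FM n n)
  have hAn := norm_nonneg A
  have hQ := norm_nonneg (balancingGradient M)
  have hH := norm_nonneg (helmholtz : FM n n →L[ℂ] FM n n)
  refine ⟨(‖(smoothing : FM n n →L[ℂ] FM n n)‖ + ‖A‖ + D + ‖balancingGradient M‖) * K +
    ‖(helmholtz : FM n n →L[ℂ] FM n n)‖ + 1, ?_, fun f hf hfσ u₀ hu₀ => ?_⟩
  · have := mul_nonneg (add_nonneg (add_nonneg (add_nonneg hS hAn) hD0) hQ) K.2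
    exact add_pos_of_nonneg_of_pos (add_nonneg this hH) one_pos
  obtain ⟨w, hw, hwb, hweq, hwP⟩ := hK f hf u₀
  refine ⟨_, _, _, isSolution_smoothingLift hΓ₂ hT hA hf hw hfσ hu₀ hweq hwP, ?_⟩
  simp only [toFM_smoothingLift, grad_balancingPressure]
  exact sum_le_of_bounds (integral_norm_clm_le smoothing hw)
    (integral_norm_sub_clm_le helmholtz A hf hw) (integral_norm_smoothingLift_le hD hw)
    (integral_norm_clm_le (balancingGradient M) hw)
    hwb (add_nonneg (add_nonneg (add_nonneg hS hAn) hD0) hQ) hH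
    (integral_nonneg fun t => norm_nonneg _) (norm_nonneg u₀)

/-- Two solutions have the form `(1 + Δ²)⁻¹ w` and `(1 + Δ²)⁻¹ z`, and `z - w` solves the homogeneous
evolution equation. -/
lemma IsSolution.unique (hΓ₂ : 0 < Γ₂) {T : ℝ} (hT : 0 < T) {f : ℝ → FM n n} {u₀ : FM n n}
    {u v : ℝ → FMk n n 4} {u' v' : ℝ → FM n n} {q r : ℝ → Pressure n}
    (hu : IsSolution lam₀ Γ₀ Γ₂ V M T f u₀ u u' q)
    (hv : IsSolution lam₀ Γ₀ Γ₂ V M T f u₀ v v' r) :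
    ∀ᵐ t ∂volume.restrict (Ioo 0 T), v t = u t ∧ v' t = u' t ∧
      ∃ c : ℂ, ∀ x, (r t).toFun x = (q t).toFun x + c := by
  have hp := isParabolic lam₀ Γ₀ hΓ₂ V M
  set A := smoothedGenerator (scalarSymbol lam₀ Γ₀ Γ₂ V) (projectedMatrix M) with hA
  choose w hw using fun t => surjective_smoothingLift (u t)
  choose z hz using fun t => surjective_smoothingLift (v t)
  have hsol : ∀ {y : FM n n}, smoothing y ∈ FM₀σ n → helmholtz y = y := fun {y} hy => by
    rw [mem_FM₀σ_iff, helmholtz_smoothing] at hy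
    exact smoothing_injective hy
  -- the Helmholtz projection of the difference of the equations
  have hdiff : ∀ᵐ t ∂volume.restrict (Ioo 0 T),
      A (z t - w t) = -(v' t - u' t) ∧
      (z t = w t → v' t = u' t → (q t).grad = (r t).grad) := by
    filter_upwards [hu.solenoidal, hv.solenoidal, hu.equation, hv.equation] with t h1 h2 h3 h4
    rw [← hw, toFM_smoothingLift] at h1
    rw [← hz, toFM_smoothingLift] at h2
    simp only [← hw, toFM_smoothingLift] at h3
    simp only [← hz, toFM_smoothingLift] at h4
    have e1 := equation_iff.1 h3
    have e2 := equation_iff.1 h4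
    have e : v' t - u' t + spatialOperator lam₀ Γ₀ Γ₂ V M (z t - w t) +
        ((r t).grad - (q t).grad) = 0 := by
      rw [map_sub, ← sub_eq_zero.2 (e2.trans e1.symm)]
      abel
    refine ⟨?_, fun hzw hvu => ?_⟩
    · have e' := congrArg helmholtz e
      have hzw : helmholtz (z t - w t) = z t - w t := by
        rw [map_sub, hsol h1.1, hsol h2.1]
      have hvu : helmholtz (v' t - u' t) = v' t - u' t := by
        rw [map_sub, (mem_FM₀σ_iff _).1 h1.2, (mem_FM₀σ_iff _).1 h2.2]
      have hgrad : helmholtz ((r t).grad - (q t).grad) = 0 := by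
        rw [map_sub, Pressure.helmholtz_grad, Pressure.helmholtz_grad, sub_zero]
      rw [map_add, map_add, helmholtz_spatialOperator hΓ₂ hzw, hvu, hgrad, add_zero,
        map_zero] at e'
      exact eq_neg_of_add_eq_zero_right e'
    · rw [hzw, hvu, sub_self, sub_self, map_zero, zero_add, zero_add] at e
      exact (sub_eq_zero.1 e).symm
  have hzw : ∀ᵐ t ∂volume.restrict (Ioo 0 T), z t - w t = 0 := by
    have hvu := hv.weakDeriv.integrableOn_deriv.sub hu.weakDeriv.integrableOn_deriv
    refine hp.ae_eq_zero hT (hvu.neg.congr (hdiff.mono fun t ht => ht.1.symm)) ?_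
    filter_upwards [hu.weakDeriv.ae_eq hT hu.initial, hv.weakDeriv.ae_eq hT hv.initial,
      ae_restrict_mem measurableSet_Ioo] with t h1 h2 hmem
    have hsub : Ioc 0 t ⊆ Ioo 0 T := fun s hs => ⟨hs.1, hs.2.trans_lt hmem.2⟩
    rw [← hw, toFM_smoothingLift] at h1
    rw [← hz, toFM_smoothingLift] at h2
    have e : ∫ s in Ioc 0 t, A (z s - w s) = ∫ s in Ioc 0 t, -(v' s - u' s) :=
      setIntegral_congr_ae measurableSet_Ioc (by
        have := (ae_restrict_iff' measurableSet_Ioo).1 hdiff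
        filter_upwards [this] with s hs hs' using (hs (hsub hs')).1)
    rw [e, integral_neg, neg_neg, map_sub, h1, h2,
      integral_sub (hv.weakDeriv.integrableOn_deriv.mono_set hsub)
        (hu.weakDeriv.integrableOn_deriv.mono_set hsub)]
    abel
  filter_upwards [hdiff, hzw] with t h1 h2
  have hzt : z t = w t := sub_eq_zero.1 h2
  have hvt : v' t = u' t := by
    have := h1.1
    rw [h2, map_zero, zero_eq_neg] at this
    exact sub_eq_zero.1 this
  exact ⟨by rw [← hz, ← hw, hzt], hvt, Pressure.exists_eq_add_const (h1.2 hzt hvt)⟩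

end wellPosed

end ActiveFluid

end

open ActiveFluid MeasureTheory Set in
theorem theorem3p4 (n : ℕ) (hn : n = 2 ∨ n = 3) (lam₀ Γ₀ Γ₂ : ℝ) (hΓ₂ : 0 < Γ₂)
    (V : RSpace n) (M : Matrix (Fin n) (Fin n) ℝ) (hM : M.IsSymm) (T : ℝ) (hT : 0 < T) :
    ∃ C : ℝ, 0 < C ∧
      ∀ f : ℝ → FM n n, IntegrableOn f (Ioo 0 T) →
        (∀ᵐ t ∂volume.restrict (Ioo 0 T), f t ∈ FM₀σ n) →
      ∀ u₀ ∈ FM₀σ n,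
      ∃ (u : ℝ → FMk n n 4) (u' : ℝ → FM n n) (q : ℝ → Pressure n),
        IsSolution lam₀ Γ₀ Γ₂ V M T f u₀ u u' q ∧
        ((∫ t in Ioo 0 T, ‖(u t).toFM‖) + ∫ t in Ioo 0 T, ‖u' t‖)
            + (∫ t in Ioo 0 T, ‖u t‖) + (∫ t in Ioo 0 T, ‖(q t).grad‖)
          ≤ C * ((∫ t in Ioo 0 T, ‖f t‖) + ‖u₀‖) ∧
        ∀ (v : ℝ → FMk n n 4) (v' : ℝ → FM n n) (r : ℝ → Pressure n),
          IsSolution lam₀ Γ₀ Γ₂ V M T f u₀ v v' r →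
          ∀ᵐ t ∂volume.restrict (Ioo 0 T), v t = u t ∧ v' t = u' t ∧
            ∃ c : ℂ, ∀ x, (r t).toFun x = (q t).toFun x + c := by
  obtain ⟨C, hC, h⟩ := exists_isSolution (lam₀ := lam₀) (Γ₀ := Γ₀) (V := V) (M := M) hΓ₂ hT
  refine ⟨C, hC, fun f hf hfσ u₀ hu₀ => ?_⟩
  obtain ⟨u, u', q, hu, hb⟩ := h f hf hfσ u₀ hu₀
  exact ⟨u, u', q, hu, hb, fun v v' r hv => hu.unique hΓ₂ hT hv⟩
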